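/- A $\mathbb Z_2$-graded Hilbert space is a pair $(\mathcal H,U)$ of a complex Hilbert space and a self-adjoint unitary $U$ on it. A bounded operator $T$ splits as $T=T_++T_-$ with $T_\pm=\tfrac12(T\pm UTU)$ (even and odd part); a vector is even or odd if $Ux=x$ or $Ux=-x$. Put $\eta_U(T)=T_++iUT_-$. For a von Neumann algebra $\mathcal M\subset\mathcal B(\mathcal H)$ with $U\mathcal MU=\mathcal M$, the twisted commutant is $\mathcal M^{\wr}=\eta_U(\mathcal M')$. Let $(\mathcal H_i,U_i)_{i\in\mathbb N}$ be a sequence of $\mathbb Z_2$-graded Hilbert spaces and let $\boldsymbol\xi=(\xi_i)_{i\in\mathbb N}$ be unit vectors $\xi_i\in\mathcal H_i$ with $U_i\xi_i=\xi_i$. Let $\bigotimes_{\boldsymbol\xi}\mathcal H_i$ be von Neumann's infinite tensor product: the Hilbert space completion of the span of the elementary tensors $\otimes_i x_i$ with $x_i=\xi_i$ for all but finitely many $i$, with $\langle\otimes_i x_i,\otimes_i y_i\rangle=\prod_i\langle x_i,y_i\rangle$. It is graded by the self-adjoint unitary $\bigotimes_i U_i$, $\otimes_i x_i\mapsto\otimes_i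 U_ix_i$ (the strong limit of the finite products of the $U_i$). For operators $T_i\in\mathcal B(\mathcal H_i)$, the operator $T_1\hat\otimes\cdots\hat\otimes T_k\hat\otimes1\hat\otimes1\hat\otimes\cdots$ on $\bigotimes_{\boldsymbol\xi}\mathcal H_i$ is multilinear in $(T_1,\dots,T_k)$ and, for homogeneous $T_i$ and homogeneous $x_j$, is given by $$(T_1\hat\otimes\cdots\hat\otimes T_k\hat\otimes1\hat\otimes\cdots)(\otimes_j x_j)=\prod_{1\le j<i\le k}\varepsilon(T_i,x_j)\; T_1x_1\otimes\cdots\otimes T_kx_k\otimes x_{k+1}\otimes\cdots,$$ where $\varepsilon(T_i,x_j)=-1$ if $T_i$ and $x_j$ are both odd, and $1$ otherwise. For von Neumann algebras $\mathcal M_i\subset\mathcal B(\mathcal H_i)$ with $U_i\mathcal M_iU_i=\mathcal M_i$, the infinite Fermi product $\hat\bigotimes_{\boldsymbol\xi}\mathcal M_i$ is the von Neumann algebra on $\bigotimes_{\boldsymbol\xi}\mathcal H_i$ generated by all operators $T_1\hat\otimes\cdots\hat\otimes T_k\hat\otimes1\hat\otimes1\hat\otimes\cdots$ with $k\in\mathbb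 N$ and $T_i\in\mathcal M_i$. **Theorem.** Let $\mathcal N_i\subset\mathcal B(\mathcal H_i)$ be von Neumann algebras with $U_i\mathcal N_iU_i=\mathcal N_i$ for every $i\in\mathbb N$. Then $$\Big(\hat\bigotimes_{\boldsymbol\xi}\mathcal N_i\Big)^{\wr}=\hat\bigotimes_{\boldsymbol\xi}\mathcal N_i^{\wr},$$ where the twisted commutant on the left is taken with respect to the grading $\bigotimes_iU_i$ and $\mathcal N_i^{\wr}$ is taken with respect to $U_i$. -/

import Mathlib

open scoped InnerProductSpace ComplexOrder

noncomputable section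

namespace FermiTensor

/-! ### Graded Hilbert spaces, the twist automorphism and twisted commutants -/

section Graded

variable {H : Type*} [NormedAddCommGroup H] [InnerProductSpace ℂ H] [CompleteSpace H]

variable (H) in
/-- A `ℤ/2`-grading of a Hilbert space: a self-adjoint unitary operator. -/
structure Grading where
  /-- the self-adjoint unitary -/
  op : H →L[ℂ] H
  star_op : star op = op
  op_mul_op : op * op = 1

/-- The even part `T₊ = (T + UTU) / 2` of an operator. -/
def evenPart (U : Grading H) (T : H →L[ℂ] H) : H →L[ℂ] H :=
  (1 / 2 : ℂ) • (T + U.op * T * U.op)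

/-- The odd part `T₋ = (T - UTU) / 2` of an operator. -/
def oddPart (U : Grading H) (T : H →L[ℂ] H) : H →L[ℂ] H :=
  (1 / 2 : ℂ) • (T - U.op * T * U.op)

/-- The twist `η_U (T₊ + T₋) = T₊ + i U T₋`. -/
def twist (U : Grading H) (T : H →L[ℂ] H) : H →L[ℂ] H :=
  evenPart U T + Complex.I • (U.op * oddPart U T)

/-- The twist is implemented by the unitary `(1 + i U) / √2`. -/
theorem twist_eq (U : Grading H) (T : H →L[ℂ] H) :
    twist U T = (1 / 2 : ℂ) • ((1 + Complex.I • U.op) * T * (1 - Complex.I • U.op)) := by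
  have h := U.op_mul_op
  have h2 : U.op * (U.op * T * U.op) = T * U.op := by
    rw [← mul_assoc, ← mul_assoc, h, one_mul]
  simp only [twist, evenPart, oddPart, mul_smul_comm, mul_sub, h2, smul_sub, smul_add, add_mul,
    mul_one, one_mul, smul_mul_assoc, smul_smul]
  match_scalars <;> first | ring1 | linear_combination (1 / 2 : ℂ) * Complex.I_mul_I

theorem twist_mul (U : Grading H) (S T : H →L[ℂ] H) :
    twist U (S * T) = twist U S * twist U T := by
  have h := U.op_mul_op
  have h2 : (1 - Complex.I • U.op) * (1 + Complex.I • U.op) = (2 : ℂ) • 1 := by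
    simp only [mul_add, sub_mul, one_mul, mul_one, smul_mul_assoc, mul_smul_comm, h]
    match_scalars
    · linear_combination -Complex.I_mul_I
    · ring
  rw [twist_eq, twist_eq, twist_eq, smul_mul_smul_comm]
  have : (1 + Complex.I • U.op) * S * (1 - Complex.I • U.op) *
      ((1 + Complex.I • U.op) * T * (1 - Complex.I • U.op))
      = (1 + Complex.I • U.op) * S * ((1 - Complex.I • U.op) * (1 + Complex.I • U.op)) * T *
        (1 - Complex.I • U.op) := by
    simp only [mul_assoc]
  rw [this, h2]
  simp only [mul_smul_comm, smul_mul_assoc, mul_one, smul_smul, mul_assoc]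
  norm_num

theorem twist_add (U : Grading H) (S T : H →L[ℂ] H) :
    twist U (S + T) = twist U S + twist U T := by
  simp only [twist_eq, mul_add, add_mul, smul_add]

theorem twist_star (U : Grading H) (T : H →L[ℂ] H) :
    twist U (star T) = star (twist U T) := by
  rw [twist_eq, twist_eq]
  simp only [star_smul, star_mul, star_add, star_sub, star_one, U.star_op, mul_assoc]
  simp [sub_eq_add_neg]

theorem twist_algebraMap (U : Grading H) (c : ℂ) :
    twist U (algebraMap ℂ _ c) = algebraMap ℂ _ c := by
  simp only [twist, evenPart, oddPart, Algebra.algebraMap_eq_smul_one, mul_smul_comm,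
    smul_mul_assoc, mul_one, U.op_mul_op]
  rw [sub_self, mul_zero, smul_zero, smul_zero, add_zero, ← two_smul ℂ, smul_smul]
  norm_num

/-- The twist is bijective. -/
theorem twist_bijective (U : Grading H) : Function.Bijective (twist U) := by
  have h4 : ∀ T, twist U (twist U T) = U.op * T * U.op := by
    intro T
    have h := U.op_mul_op
    have ha : (1 + Complex.I • U.op) * (1 + Complex.I • U.op) = (2 * Complex.I) • U.op := by
      simp only [mul_add, add_mul, one_mul, mul_one, smul_mul_assoc, mul_smul_comm, h]
      match_scalars
      · linear_combination Complex.I_mul_I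
      · ring
    have hb : (1 - Complex.I • U.op) * (1 - Complex.I • U.op) = (-2 * Complex.I) • U.op := by
      simp only [mul_sub, sub_mul, one_mul, mul_one, smul_mul_assoc, mul_smul_comm, h]
      match_scalars
      · linear_combination Complex.I_mul_I
      · ring
    rw [twist_eq, twist_eq, mul_smul_comm, smul_mul_assoc]
    have : (1 + Complex.I • U.op) * ((1 + Complex.I • U.op) * T * (1 - Complex.I • U.op)) *
        (1 - Complex.I • U.op) = ((1 + Complex.I • U.op) * (1 + Complex.I • U.op)) * T *
        ((1 - Complex.I • U.op) * (1 - Complex.I • U.op)) := by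
      simp only [mul_assoc]
    rw [this, ha, hb]
    simp only [mul_smul_comm, smul_mul_assoc, smul_smul]
    have : (1 / 2 * (1 / 2 * (-2 * Complex.I * (2 * Complex.I))) : ℂ) = 1 := by
      linear_combination (-1 : ℂ) * Complex.I_mul_I
    rw [this, one_smul]
  have h8 : ∀ T, twist U (twist U (twist U (twist U T))) = T := by
    intro T
    have h := U.op_mul_op
    rw [h4, h4]
    have : U.op * (U.op * T * U.op) * U.op = (U.op * U.op) * T * (U.op * U.op) := by
      simp only [mul_assoc]
    rw [this, h, one_mul, mul_one]
  refine ⟨fun S T hST => ?_, fun T => ⟨_, h8 T⟩⟩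
  rw [← h8 S, ← h8 T, hST]

theorem twist_image_centralizer (U : Grading H) (s : Set (H →L[ℂ] H)) :
    twist U '' Set.centralizer s = Set.centralizer (twist U '' s) := by
  ext T
  constructor
  · rintro ⟨S, hS, rfl⟩ _ ⟨R, hR, rfl⟩
    rw [← twist_mul, ← twist_mul, hS R hR]
  · intro hT
    obtain ⟨S, rfl⟩ := (twist_bijective U).2 T
    refine ⟨S, fun R hR => (twist_bijective U).1 ?_, rfl⟩
    rw [twist_mul, twist_mul]
    exact hT _ ⟨R, hR, rfl⟩

/-- The twisted commutant `η_U(M')` of a von Neumann algebra `M`. -/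
def twistedCommutant (U : Grading H) (M : VonNeumannAlgebra H) : VonNeumannAlgebra H where
  carrier := twist U '' (M.commutant : Set (H →L[ℂ] H))
  mul_mem' := by
    rintro _ _ ⟨S, hS, rfl⟩ ⟨T, hT, rfl⟩
    exact ⟨S * T, mul_mem hS hT, twist_mul U S T⟩
  add_mem' := by
    rintro _ _ ⟨S, hS, rfl⟩ ⟨T, hT, rfl⟩
    exact ⟨S + T, add_mem hS hT, twist_add U S T⟩
  algebraMap_mem' c :=
    ⟨algebraMap ℂ _ c, M.commutant.toStarSubalgebra.algebraMap_mem c, twist_algebraMap U c⟩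
  star_mem' := by
    rintro _ ⟨S, hS, rfl⟩
    exact ⟨star S, star_mem hS, twist_star U S⟩
  centralizer_centralizer' := by
    rw [← twist_image_centralizer, ← twist_image_centralizer,
      VonNeumannAlgebra.centralizer_centralizer]

/-- `(M, U)` is a graded von Neumann algebra: `U M U = M`. -/
def IsGraded (U : Grading H) (M : VonNeumannAlgebra H) : Prop :=
  (fun T => U.op * T * U.op) '' (M : Set (H →L[ℂ] H)) = M

/-- The von Neumann algebra generated by a set `s` of operators: the double commutant of
`s ∪ s*`. -/
def generatedBy (s : Set (H →L[ℂ] H)) : VonNeumannAlgebra H where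
  toStarSubalgebra :=
    StarSubalgebra.centralizer ℂ (StarSubalgebra.centralizer ℂ s : Set (H →L[ℂ] H))
  centralizer_centralizer' := by
    change Set.centralizer (Set.centralizer
      (StarSubalgebra.centralizer ℂ (StarSubalgebra.centralizer ℂ s : Set (H →L[ℂ] H)) : Set (H →L[ℂ] H)))
      = (StarSubalgebra.centralizer ℂ (StarSubalgebra.centralizer ℂ s : Set (H →L[ℂ] H)) : Set (H →L[ℂ] H))
    simp

theorem subset_generatedBy (s : Set (H →L[ℂ] H)) : s ⊆ generatedBy s := by
  intro T hT
  change T ∈ StarSubalgebra.centralizer ℂ (StarSubalgebra.centralizer ℂ s : Set (H →L[ℂ] H))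
  rw [StarSubalgebra.mem_centralizer_iff]
  intro S hS
  have hS' := (StarSubalgebra.mem_centralizer_iff ℂ).1 hS T hT
  refine ⟨hS'.1.symm, ?_⟩
  have := congrArg star hS'.2
  simpa using this

/-- `generatedBy s` is the smallest von Neumann algebra containing `s`. -/
theorem generatedBy_le (s : Set (H →L[ℂ] H)) (M : VonNeumannAlgebra H)
    (h : s ⊆ (M : Set (H →L[ℂ] H))) : generatedBy s ≤ M := by
  intro T hT
  change T ∈ StarSubalgebra.centralizer ℂ (StarSubalgebra.centralizer ℂ s : Set (H →L[ℂ] H)) at hT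
  rw [← M.commutant_commutant, VonNeumannAlgebra.mem_commutant_iff]
  intro S hS
  refine ((StarSubalgebra.mem_centralizer_iff ℂ).1 hT S ?_).1
  refine (StarSubalgebra.mem_centralizer_iff ℂ).2 fun R hR => ?_
  rw [VonNeumannAlgebra.mem_commutant_iff] at hS
  exact ⟨hS R (h hR), hS _ (star_mem (h hR))⟩

end Graded

/-! ### The infinite tensor product of Hilbert spaces along a sequence of unit vectors -/

section Tensor

variable {H : ℕ → Type*} [∀ i, NormedAddCommGroup (H i)] [∀ i, InnerProductSpace ℂ (H i)]

/-- Sequences `(x i)` of vectors with `x i = ξ i` for all but finitely many `i`; they index the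
elementary tensors `⊗ x i`. -/
def RSeq (ξ : ∀ i, Metric.sphere (0 : H i) 1) : Type _ :=
  {x : ∀ i, H i // {i | x i ≠ ξ i}.Finite}

variable {ξ : ∀ i, Metric.sphere (0 : H i) 1}

theorem inner_unit (i : ℕ) : ⟪(ξ i : H i), (ξ i : H i)⟫_ℂ = 1 := by
  have : ‖(ξ i : H i)‖ = 1 := by simp
  rw [inner_self_eq_norm_sq_to_K, this]; simp

theorem RSeq.mulSupport_finite (x y : RSeq ξ) :
    (Function.mulSupport fun i => ⟪x.1 i, y.1 i⟫_ℂ).Finite := by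
  refine (x.2.union y.2).subset fun i hi => ?_
  by_contra h
  simp only [Set.mem_union, Set.mem_ofPred_eq, not_or, not_not] at h
  exact hi (by simp only [h.1, h.2, inner_unit])

/-- The inner product `∏ ⟨x i, y i⟩` of two elementary tensors; all but finitely many factors
are `1`. -/
def kernel (x y : RSeq ξ) : ℂ := ∏ᶠ i, ⟪x.1 i, y.1 i⟫_ℂ

theorem kernel_conj (x y : RSeq ξ) : (starRingEnd ℂ) (kernel x y) = kernel y x := by
  unfold kernel
  rw [show (starRingEnd ℂ) (∏ᶠ i, ⟪x.1 i, y.1 i⟫_ℂ) = ∏ᶠ i, (starRingEnd ℂ) ⟪x.1 i, y.1 i⟫_ℂ from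
    MonoidHom.map_finprod (starRingEnd ℂ : ℂ →* ℂ) (x.mulSupport_finite y)]
  simp

theorem kernel_posSemidef (s : Finset (RSeq ξ)) :
    (Matrix.of fun x y : s => kernel x.1 y.1).PosSemidef := by
  classical
  have hfin : (⋃ x : s, {i | x.1.1 i ≠ ξ i}).Finite := Set.finite_iUnion fun x => x.1.2
  set F : Finset ℕ := hfin.toFinset with hF
  have hk : ∀ x y : s, kernel x.1 y.1 = ∏ i ∈ F, ⟪x.1.1 i, y.1.1 i⟫_ℂ := by
    intro x y
    refine finprod_eq_prod_of_mulSupport_subset _ fun i hi => ?_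
    by_contra h
    simp only [hF, Set.Finite.coe_toFinset, Set.mem_iUnion, not_exists, Set.mem_ofPred_eq,
      not_not] at h
    exact hi (by simp only [h x, h y, inner_unit])
  simp only [hk]
  clear hk
  clear_value F
  clear hF
  induction F using Finset.induction_on with
  | empty =>
    simp only [Finset.prod_empty]
    have e : (Matrix.of fun _ _ : s => (1 : ℂ)) = Matrix.gram ℂ fun _ : s => (1 : ℂ) := by
      ext i j
      simp [Matrix.gram]
    rw [e]
    exact Matrix.posSemidef_gram ℂ _
  | insert a F ha ih =>
    simp only [Finset.prod_insert ha]
    exact Matrix.PosSemidef.hadamard (Matrix.posSemidef_gram ℂ fun x : s => x.1.1 a) ih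

/-- The sesquilinear extension of `kernel` to formal linear combinations. -/
def preInner (f g : RSeq ξ →₀ ℂ) : ℂ :=
  f.sum fun x a => g.sum fun y b => (starRingEnd ℂ) a * b * kernel x y

theorem preInner_conj (f g : RSeq ξ →₀ ℂ) :
    (starRingEnd ℂ) (preInner g f) = preInner f g := by
  simp only [preInner, Finsupp.sum, map_sum, map_mul, kernel_conj]
  rw [Finset.sum_comm]
  refine Finset.sum_congr rfl fun y _ => Finset.sum_congr rfl fun x _ => ?_
  simp only [RingHomCompTriple.comp_apply, RingHom.id_apply]
  ring

theorem preInner_self_nonneg (f : RSeq ξ →₀ ℂ) : 0 ≤ preInner f f := by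
  have h := (kernel_posSemidef f.support).dotProduct_mulVec_nonneg fun x => f x.1
  have h2 : preInner f f = star (fun x : f.support => f x.1) ⬝ᵥ
      ((Matrix.of fun x y : f.support => kernel x.1 y.1).mulVec fun x : f.support => f x.1) := by
    simp only [preInner, Finsupp.sum, dotProduct, Matrix.mulVec, Finset.mul_sum]
    rw [← Finset.sum_coe_sort]
    refine Finset.sum_congr rfl fun x _ => ?_
    rw [← Finset.sum_coe_sort]
    refine Finset.sum_congr rfl fun y _ => ?_
    simp only [Pi.star_apply, Matrix.of_apply, RCLike.star_def]
    ring
  rwa [← h2] at h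

theorem preInner_add_left (f g h : RSeq ξ →₀ ℂ) :
    preInner (f + g) h = preInner f h + preInner g h := by
  unfold preInner
  refine Finsupp.sum_add_index' (by simp [Finsupp.sum]) fun x a b => ?_
  simp only [map_add, add_mul, Finsupp.sum, Finset.sum_add_distrib]

theorem preInner_smul_left (f g : RSeq ξ →₀ ℂ) (r : ℂ) :
    preInner (r • f) g = (starRingEnd ℂ) r * preInner f g := by
  unfold preInner
  refine (Finsupp.sum_smul_index' (by simp [Finsupp.sum])).trans ?_
  simp only [Finsupp.sum, smul_eq_mul, map_mul, Finset.mul_sum, mul_assoc]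

/-- Formal linear combinations of elementary tensors, with the semi-inner product `preInner`. -/
def PreTensor (ξ : ∀ i, Metric.sphere (0 : H i) 1) : Type _ := RSeq ξ →₀ ℂ

instance : AddCommGroup (PreTensor ξ) := inferInstanceAs (AddCommGroup (RSeq ξ →₀ ℂ))
instance : Module ℂ (PreTensor ξ) := inferInstanceAs (Module ℂ (RSeq ξ →₀ ℂ))

/-- The underlying finitely supported function on elementary tensors. -/
def toFun : PreTensor ξ ≃ₗ[ℂ] (RSeq ξ →₀ ℂ) := LinearEquiv.refl ℂ _

instance : PreInnerProductSpace.Core ℂ (PreTensor ξ) where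
  inner f g := preInner (toFun f) (toFun g)
  conj_inner_symm f g := preInner_conj (toFun f) (toFun g)
  re_inner_nonneg f := (Complex.nonneg_iff.1 (preInner_self_nonneg (toFun f))).1
  add_left f g h := by rw [map_add, preInner_add_left]
  smul_left f g r := by rw [map_smul, preInner_smul_left]

instance : SeminormedAddCommGroup (PreTensor ξ) :=
  InnerProductSpace.Core.toSeminormedAddCommGroup (𝕜 := ℂ)

instance : InnerProductSpace ℂ (PreTensor ξ) := InnerProductSpace.ofCore inferInstance

/-- The infinite tensor product `⊗_ξ H i`: the Hilbert space completion of the span of the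
elementary tensors `⊗ x i`, `x i = ξ i` for almost all `i`, with
`⟨⊗ x i, ⊗ y i⟩ = ∏ ⟨x i, y i⟩`. -/
abbrev InfTensor (ξ : ∀ i, Metric.sphere (0 : H i) 1) : Type _ :=
  UniformSpace.Completion (PreTensor ξ)

/-- A formal elementary tensor. -/
def preTprod (x : RSeq ξ) : PreTensor ξ := toFun.symm (Finsupp.single x 1)

/-- The elementary tensor `⊗ x i`. -/
def tprod (x : RSeq ξ) : InfTensor ξ := (preTprod x : PreTensor ξ)

theorem preTensor_inner (f g : PreTensor ξ) : ⟪f, g⟫_ℂ = preInner (toFun f) (toFun g) := rfl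

theorem inner_tprod (x y : RSeq ξ) : ⟪tprod x, tprod y⟫_ℂ = ∏ᶠ i, ⟪x.1 i, y.1 i⟫_ℂ := by
  rw [tprod, tprod, UniformSpace.Completion.inner_coe, preTensor_inner]
  simp only [preInner, preTprod, LinearEquiv.apply_symm_apply]
  rw [Finsupp.sum_single_index (by simp), Finsupp.sum_single_index (by simp)]
  simp [kernel]

theorem mapDomain_inner (φ : RSeq ξ → RSeq ξ) (f g : RSeq ξ →₀ ℂ) :
    preInner f (g.mapDomain φ) =
      f.sum fun x a => g.sum fun y b => (starRingEnd ℂ) a * b * kernel x (φ y) := by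
  unfold preInner
  refine Finsupp.sum_congr fun x _ => ?_
  exact Finsupp.sum_mapDomain_index (by simp) (fun _ _ _ => by ring)

/-- Maps of elementary tensors that are adjoint for `kernel` are adjoint for `preInner`. -/
theorem preInner_adjoint (φ ψ : RSeq ξ → RSeq ξ) (h : ∀ x y, kernel (φ x) y = kernel x (ψ y))
    (f g : RSeq ξ →₀ ℂ) : preInner (f.mapDomain φ) g = preInner f (g.mapDomain ψ) := by
  rw [mapDomain_inner]
  unfold preInner
  rw [Finsupp.sum_mapDomain_index (by simp [Finsupp.sum])
    (fun _ _ _ => by simp only [map_add, add_mul, Finsupp.sum, Finset.sum_add_distrib])]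
  simp only [h]

theorem norm_sq_eq (f : PreTensor ξ) : (‖f‖ ^ 2 : ℝ) = (preInner (toFun f) (toFun f)).re :=
  (inner_self_eq_norm_sq (𝕜 := ℂ) f).symm

/-- Apply `T` in the `i`-th place. -/
def RSeq.site (i : ℕ) (T : H i →L[ℂ] H i) (x : RSeq ξ) : RSeq ξ :=
  ⟨Function.update x.1 i (T (x.1 i)), (x.2.insert i).subset fun j hj => by
    by_cases h : j = i
    · exact Or.inl h
    · exact Or.inr (by simpa [Function.update_of_ne h] using hj)⟩

theorem RSeq.site_site (i : ℕ) (S T : H i →L[ℂ] H i) (x : RSeq ξ) :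
    (x.site i T).site i S = x.site i (S * T) :=
  Subtype.ext (by simp [RSeq.site])

/-- Apply `V j` in the `j`-th place for every `j`, where `V j` fixes `ξ j`. -/
def RSeq.all (V : ∀ j, H j →L[ℂ] H j) (hV : ∀ j, V j (ξ j) = ξ j) (x : RSeq ξ) : RSeq ξ :=
  ⟨fun j => V j (x.1 j), x.2.subset fun j hj h => hj (by
    change x.1 j = ξ j at h
    change V j (x.1 j) = ξ j
    rw [h, hV])⟩

theorem kernel_site (i : ℕ) (T : H i →L[ℂ] H i) (x y : RSeq ξ) :
    kernel x (y.site i T) =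
      ⟪x.1 i, T (y.1 i)⟫_ℂ * ∏ᶠ j, if j = i then 1 else ⟪x.1 j, y.1 j⟫_ℂ := by
  have h1 : (∏ᶠ j, if j = i then ⟪x.1 i, T (y.1 i)⟫_ℂ else 1) = ⟪x.1 i, T (y.1 i)⟫_ℂ := by
    rw [finprod_eq_single _ i (fun j hj => if_neg hj), if_pos rfl]
  rw [← h1, ← finprod_mul_distrib]
  · refine finprod_congr fun j => ?_
    by_cases h : j = i
    · subst h; simp [RSeq.site]
    · simp [RSeq.site, h]
  · refine (Set.finite_singleton i).subset fun j hj => ?_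
    by_contra h
    exact hj (if_neg h)
  · refine (x.mulSupport_finite y).subset fun j hj h => hj ?_
    change (if j = i then (1 : ℂ) else ⟪x.1 j, y.1 j⟫_ℂ) = 1
    rw [show ⟪x.1 j, y.1 j⟫_ℂ = 1 from h, ite_self]

theorem kernel_site_add (i : ℕ) (S T : H i →L[ℂ] H i) (x y : RSeq ξ) :
    kernel x (y.site i (S + T)) = kernel x (y.site i S) + kernel x (y.site i T) := by
  simp only [kernel_site, _root_.add_apply, inner_add_right, add_mul]

theorem kernel_site_smul_one (i : ℕ) (c : ℂ) (x y : RSeq ξ) :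
    kernel x (y.site i (c • 1)) = c * kernel x y := by
  have h : kernel x (y.site i 1) = kernel x y := by
    congr 1
    exact Subtype.ext (by simp [RSeq.site])
  rw [← h, kernel_site, kernel_site]
  simp only [_root_.smul_apply, inner_smul_right, mul_assoc]

/-- The linear extension to formal linear combinations of a map of elementary tensors. -/
def preMap (φ : RSeq ξ → RSeq ξ) : PreTensor ξ →ₗ[ℂ] PreTensor ξ :=
  toFun.symm.toLinearMap ∘ₗ Finsupp.lmapDomain ℂ ℂ φ ∘ₗ toFun.toLinearMap

theorem toFun_preMap (φ : RSeq ξ → RSeq ξ) (f : PreTensor ξ) :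
    toFun (preMap φ f) = (toFun f).mapDomain φ := rfl

theorem preMap_preTprod (φ : RSeq ξ → RSeq ξ) (x : RSeq ξ) :
    preMap φ (preTprod x) = preTprod (φ x) := by
  apply toFun.injective
  rw [toFun_preMap]
  exact Finsupp.mapDomain_single

variable [∀ i, CompleteSpace (H i)]

theorem kernel_site_adjoint (i : ℕ) (T : H i →L[ℂ] H i) (x y : RSeq ξ) :
    kernel (x.site i T) y = kernel x (y.site i (star T)) := by
  refine finprod_congr fun j => ?_
  by_cases h : j = i
  · subst h
    simp [RSeq.site, ContinuousLinearMap.star_eq_adjoint, ContinuousLinearMap.adjoint_inner_right]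
  · simp [RSeq.site, h]

theorem preInner_site_self (i : ℕ) (T : H i →L[ℂ] H i) (f : RSeq ξ →₀ ℂ) :
    preInner (f.mapDomain (RSeq.site i T)) (f.mapDomain (RSeq.site i T)) =
      preInner f (f.mapDomain (RSeq.site i (star T * T))) := by
  rw [preInner_adjoint _ (RSeq.site i (star T)) (kernel_site_adjoint i T),
    ← Finsupp.mapDomain_comp]
  congr 2
  funext x
  exact RSeq.site_site i _ _ x

theorem norm_site_le (i : ℕ) (T : H i →L[ℂ] H i) (f : PreTensor ξ) :
    ‖preMap (RSeq.site i T) f‖ ≤ ‖T‖ * ‖f‖ := by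
  have h0 : 0 ≤ algebraMap ℝ (H i →L[ℂ] H i) (‖T‖ ^ 2) - star T * T :=
    sub_nonneg.2 CStarAlgebra.star_mul_le_algebraMap_norm_sq
  obtain ⟨S, hS⟩ := CStarAlgebra.nonneg_iff_eq_star_mul_self.1 h0
  have hsum : star T * T + star S * S = ((‖T‖ ^ 2 : ℝ) : ℂ) • 1 := by
    rw [← hS, add_sub_cancel, Algebra.algebraMap_eq_smul_one, Complex.coe_smul]
  have key : ∀ g : RSeq ξ →₀ ℂ, preInner g (g.mapDomain (RSeq.site i (star T * T))) +
      preInner g (g.mapDomain (RSeq.site i (star S * S))) =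
        ((‖T‖ ^ 2 : ℝ) : ℂ) * preInner g g := by
    intro g
    rw [mapDomain_inner, mapDomain_inner]
    unfold preInner
    simp only [Finsupp.sum, Finset.mul_sum]
    rw [← Finset.sum_add_distrib]
    refine Finset.sum_congr rfl fun x _ => ?_
    rw [← Finset.sum_add_distrib]
    refine Finset.sum_congr rfl fun y _ => ?_
    rw [← mul_add, ← kernel_site_add, hsum, kernel_site_smul_one]
    ring
  have key := key (toFun f)
  rw [← preInner_site_self, ← preInner_site_self] at key
  have hre := congrArg Complex.re key
  rw [Complex.add_re, Complex.re_ofReal_mul] at hre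
  have hpos := (Complex.nonneg_iff.1
    (preInner_self_nonneg ((toFun f).mapDomain (RSeq.site i S)))).1
  refine le_of_sq_le_sq ?_ (by positivity)
  rw [mul_pow, norm_sq_eq, norm_sq_eq, toFun_preMap]
  linarith

/-- The operator `1 ⊗ ⋯ ⊗ 1 ⊗ T ⊗ 1 ⊗ ⋯` on `⊗_ξ H i`, with `T` in the `i`-th place. -/
def siteOp (ξ : ∀ i, Metric.sphere (0 : H i) 1) (i : ℕ) (T : H i →L[ℂ] H i) :
    InfTensor ξ →L[ℂ] InfTensor ξ :=
  (LinearMap.mkContinuous (preMap (RSeq.site i T)) ‖T‖ (norm_site_le i T)).completion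

theorem siteOp_tprod (i : ℕ) (T : H i →L[ℂ] H i) (x : RSeq ξ) :
    siteOp ξ i T (tprod x) = tprod (x.site i T) := by
  rw [siteOp, tprod, ContinuousLinearMap.completion_apply_coe, tprod, LinearMap.mkContinuous_apply,
    preMap_preTprod]

/-- Elementary tensors are total. -/
theorem ext_tprod {E : Type*} [NormedAddCommGroup E] [NormedSpace ℂ E]
    {A B : InfTensor ξ →L[ℂ] E} (h : ∀ x, A (tprod x) = B (tprod x)) : A = B := by
  ext v
  induction v using UniformSpace.Completion.induction_on with
  | hp => exact isClosed_eq A.continuous B.continuous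
  | ih f =>
    obtain ⟨g, rfl⟩ := toFun.symm.surjective f
    induction g using Finsupp.induction_linear with
    | zero => rw [map_zero, UniformSpace.Completion.coe_zero, map_zero, map_zero]
    | add f g hf hg =>
      rw [map_add, UniformSpace.Completion.coe_add, map_add, map_add, hf, hg]
    | single x c =>
      have : (Finsupp.single x c : RSeq ξ →₀ ℂ) = c • Finsupp.single x 1 := by simp
      rw [this, map_smul, UniformSpace.Completion.coe_smul, map_smul, map_smul]
      exact congrArg (c • ·) (h x)

theorem ext_inner_tprod {A B : InfTensor ξ →L[ℂ] InfTensor ξ}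
    (h : ∀ x y, ⟪tprod x, A (tprod y)⟫_ℂ = ⟪tprod x, B (tprod y)⟫_ℂ) : A = B := by
  refine ext_tprod fun y => ?_
  have : innerSL ℂ (A (tprod y)) = innerSL ℂ (B (tprod y)) := ext_tprod fun x => by
    rw [innerSL_apply_apply, innerSL_apply_apply, ← inner_conj_symm, h x y, inner_conj_symm]
  exact innerSL_inj.1 this

theorem siteOp_add (i : ℕ) (S T : H i →L[ℂ] H i) :
    siteOp ξ i (S + T) = siteOp ξ i S + siteOp ξ i T := by
  refine ext_inner_tprod fun x y => ?_
  rw [_root_.add_apply, inner_add_right]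
  simp only [siteOp_tprod, inner_tprod]
  exact kernel_site_add i S T x y

theorem siteOp_smul (i : ℕ) (c : ℂ) (T : H i →L[ℂ] H i) :
    siteOp ξ i (c • T) = c • siteOp ξ i T := by
  refine ext_inner_tprod fun x y => ?_
  rw [_root_.smul_apply, inner_smul_right]
  simp only [siteOp_tprod, inner_tprod]
  change kernel x (y.site i (c • T)) = c * kernel x (y.site i T)
  rw [kernel_site, kernel_site, _root_.smul_apply, inner_smul_right, mul_assoc]

theorem siteOp_one (i : ℕ) : siteOp ξ i 1 = 1 := by
  refine ext_tprod fun x => ?_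
  rw [siteOp_tprod]
  exact congrArg _ (Subtype.ext (by simp [RSeq.site]))

theorem norm_siteOp_le (i : ℕ) (T : H i →L[ℂ] H i) : ‖siteOp ξ i T‖ ≤ ‖T‖ := by
  refine ContinuousLinearMap.opNorm_le_bound _ (norm_nonneg _) fun v => ?_
  induction v using UniformSpace.Completion.induction_on with
  | hp => exact isClosed_le (by fun_prop) (by fun_prop)
  | ih f =>
    rw [siteOp, ContinuousLinearMap.completion_apply_coe, UniformSpace.Completion.norm_coe,
      UniformSpace.Completion.norm_coe]
    exact norm_site_le i T f

/-! ### The grading of the infinite tensor product -/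

theorem norm_all_le (U : ∀ i, Grading (H i)) (hξ : ∀ i, (U i).op (ξ i) = ξ i)
    (f : PreTensor ξ) : ‖preMap (RSeq.all (fun i => (U i).op) hξ) f‖ ≤ 1 * ‖f‖ := by
  have hadj : ∀ x y : RSeq ξ, kernel (x.all (fun i => (U i).op) hξ) y =
      kernel x (y.all (fun i => (U i).op) hξ) := by
    intro x y
    refine finprod_congr fun i => ?_
    change ⟪(U i).op (x.1 i), y.1 i⟫_ℂ = ⟪x.1 i, (U i).op (y.1 i)⟫_ℂ
    rw [← ContinuousLinearMap.adjoint_inner_right, ← ContinuousLinearMap.star_eq_adjoint,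
      (U i).star_op]
  have hsq : RSeq.all (fun i => (U i).op) hξ ∘ RSeq.all (fun i => (U i).op) hξ = id := by
    funext x
    refine Subtype.ext (funext fun i => ?_)
    exact congrArg (fun A : H i →L[ℂ] H i => A (x.1 i)) (U i).op_mul_op
  rw [one_mul]
  refine le_of_sq_le_sq (le_of_eq ?_) (norm_nonneg _)
  rw [norm_sq_eq, norm_sq_eq, toFun_preMap, preInner_adjoint _ _ hadj,
    ← Finsupp.mapDomain_comp, hsq, Finsupp.mapDomain_id]

/-- The operator `⊗ U i`, well defined because `U i ξ i = ξ i`. -/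
def tensorGradingOp (U : ∀ i, Grading (H i)) (hξ : ∀ i, (U i).op (ξ i) = ξ i) :
    InfTensor ξ →L[ℂ] InfTensor ξ :=
  (LinearMap.mkContinuous (preMap (RSeq.all (fun i => (U i).op) hξ)) 1
    (norm_all_le U hξ)).completion

theorem tensorGradingOp_tprod (U : ∀ i, Grading (H i)) (hξ : ∀ i, (U i).op (ξ i) = ξ i)
    (x : RSeq ξ) :
    tensorGradingOp U hξ (tprod x) = tprod (x.all (fun i => (U i).op) hξ) := by
  rw [tensorGradingOp, tprod, ContinuousLinearMap.completion_apply_coe, tprod,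
    LinearMap.mkContinuous_apply, preMap_preTprod]

/-- The grading `⊗ U i` of `⊗_ξ H i`, with `(⊗ U i) (⊗ x i) = ⊗ U i x i`. -/
def tensorGrading (U : ∀ i, Grading (H i)) (hξ : ∀ i, (U i).op (ξ i) = ξ i) :
    Grading (InfTensor ξ) where
  op := tensorGradingOp U hξ
  star_op := by
    refine ext_inner_tprod fun x y => ?_
    rw [ContinuousLinearMap.star_eq_adjoint, ContinuousLinearMap.adjoint_inner_right,
      tensorGradingOp_tprod, tensorGradingOp_tprod, inner_tprod, inner_tprod]
    refine finprod_congr fun i => ?_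
    change ⟪(U i).op (x.1 i), y.1 i⟫_ℂ = ⟪x.1 i, (U i).op (y.1 i)⟫_ℂ
    rw [← ContinuousLinearMap.adjoint_inner_right, ← ContinuousLinearMap.star_eq_adjoint,
      (U i).star_op]
  op_mul_op := by
    refine ext_tprod fun x => ?_
    rw [mul_apply_eq_comp, tensorGradingOp_tprod, tensorGradingOp_tprod]
    refine congrArg tprod (Subtype.ext (funext fun i => ?_))
    exact congrArg (fun A : H i →L[ℂ] H i => A (x.1 i)) (U i).op_mul_op

/-- The finite products `U 0 ⊗ ⋯ ⊗ U (n - 1) ⊗ 1 ⊗ 1 ⊗ ⋯`. -/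
def partialGrading (U : ∀ i, Grading (H i)) (ξ : ∀ i, Metric.sphere (0 : H i) 1) :
    ℕ → (InfTensor ξ →L[ℂ] InfTensor ξ)
  | 0 => 1
  | n + 1 => partialGrading U ξ n * siteOp ξ n (U n).op

theorem partialGrading_tprod (U : ∀ i, Grading (H i)) (n : ℕ) (x y : RSeq ξ)
    (h : ∀ i, y.1 i = if i < n then (U i).op (x.1 i) else x.1 i) :
    partialGrading U ξ n (tprod x) = tprod y := by
  induction n generalizing x with
  | zero =>
    have : x = y := Subtype.ext (funext fun i => by simp [h])
    rw [this]; rfl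
  | succ n ih =>
    rw [partialGrading, mul_apply_eq_comp, siteOp_tprod]
    refine ih _ fun i => ?_
    rw [h]
    by_cases hi : i = n
    · subst hi; simp [RSeq.site]
    · rw [if_congr (show i < n + 1 ↔ i < n by omega) rfl rfl]
      simp [RSeq.site, hi]

theorem Grading.norm_op_le {K : Type*} [NormedAddCommGroup K] [InnerProductSpace ℂ K]
    [CompleteSpace K] (U : Grading K) : ‖U.op‖ ≤ 1 := by
  have h : ‖U.op‖ * ‖U.op‖ ≤ 1 := by
    rw [← CStarRing.norm_star_mul_self, U.star_op, U.op_mul_op]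
    exact ContinuousLinearMap.norm_id_le
  nlinarith [norm_nonneg U.op]

/-- `⊗ U i` is the strong limit of the finite products. -/
theorem tendsto_partialGrading (U : ∀ i, Grading (H i)) (hξ : ∀ i, (U i).op (ξ i) = ξ i)
    (v : InfTensor ξ) :
    Filter.Tendsto (fun n => partialGrading U ξ n v) Filter.atTop
      (nhds ((tensorGrading U hξ).op v)) := by
  have hn : ∀ n, ‖partialGrading U ξ n‖ ≤ 1 := by
    intro n
    induction n with
    | zero => exact ContinuousLinearMap.norm_id_le
    | succ n ih =>
      refine (norm_mul_le _ _).trans (mul_le_one₀ ih (norm_nonneg _) ?_)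
      exact (norm_siteOp_le n _).trans (U n).norm_op_le
  have hev : ∀ g : RSeq ξ →₀ ℂ, ∀ᶠ n in Filter.atTop,
      partialGrading U ξ n ((toFun.symm g : PreTensor ξ) : InfTensor ξ) =
        (tensorGrading U hξ).op ((toFun.symm g : PreTensor ξ) : InfTensor ξ) := by
    intro g
    induction g using Finsupp.induction_linear with
    | zero =>
      refine Filter.Eventually.of_forall fun n => ?_
      rw [map_zero, UniformSpace.Completion.coe_zero, map_zero, map_zero]
    | add f g hf hg =>
      filter_upwards [hf, hg] with n h1 h2
      rw [map_add, UniformSpace.Completion.coe_add, map_add, map_add, h1, h2]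
    | single x c =>
      have : (Finsupp.single x c : RSeq ξ →₀ ℂ) = c • Finsupp.single x 1 := by simp
      obtain ⟨m, hm⟩ := x.2.bddAbove
      filter_upwards [Filter.eventually_gt_atTop m] with n hmn
      rw [this, map_smul, UniformSpace.Completion.coe_smul, map_smul, map_smul]
      refine congrArg (c • ·) ?_
      change partialGrading U ξ n (tprod x) = tensorGradingOp U hξ (tprod x)
      rw [tensorGradingOp_tprod]
      refine partialGrading_tprod U n x _ fun i => ?_
      change (U i).op (x.1 i) = _
      split_ifs with hi
      · rfl
      · have hx : x.1 i = ξ i := by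
          by_contra hne
          exact hi ((hm hne).trans_lt hmn)
        rw [hx, hξ]
  rw [Metric.tendsto_atTop]
  intro ε hε
  obtain ⟨f, hf⟩ := (UniformSpace.Completion.denseRange_coe (α := PreTensor ξ)).exists_dist_lt v
    (half_pos hε)
  obtain ⟨N, hN⟩ := Filter.eventually_atTop.1 (hev (toFun f))
  refine ⟨N, fun n hnN => ?_⟩
  have h1 := hN n hnN
  rw [LinearEquiv.symm_apply_apply] at h1
  rw [dist_eq_norm] at hf ⊢
  have e : partialGrading U ξ n v - (tensorGrading U hξ).op v =
      partialGrading U ξ n (v - f) - (tensorGrading U hξ).op (v - f) := by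
    rw [map_sub, map_sub, h1]; abel
  have b1 := (partialGrading U ξ n).le_of_opNorm_le (hn n) (v - f)
  have b2 := (tensorGrading U hξ).op.le_of_opNorm_le (tensorGrading U hξ).norm_op_le (v - f)
  rw [e]
  refine (norm_sub_le _ _).trans_lt ?_
  linarith

/-! ### Fermi products of operators and of von Neumann algebras -/

/-- `1 ⊗̂ ⋯ ⊗̂ 1 ⊗̂ T ⊗̂ 1 ⊗̂ ⋯` with `T` in the `n`-th place: the odd part of `T` picks up the
gradings of the places before it. -/
def fermiSite (U : ∀ i, Grading (H i)) (ξ : ∀ i, Metric.sphere (0 : H i) 1) (n : ℕ)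
    (T : H n →L[ℂ] H n) : InfTensor ξ →L[ℂ] InfTensor ξ :=
  siteOp ξ n (evenPart (U n) T) + partialGrading U ξ n * siteOp ξ n (oddPart (U n) T)

/-- `T 0 ⊗̂ T 1 ⊗̂ ⋯ ⊗̂ T (k - 1) ⊗̂ 1 ⊗̂ 1 ⊗̂ ⋯`; for the action on homogeneous elementary tensors
see `fermiProd_tprod`. -/
def fermiProd (U : ∀ i, Grading (H i)) (ξ : ∀ i, Metric.sphere (0 : H i) 1)
    (T : ∀ i, H i →L[ℂ] H i) : ℕ → (InfTensor ξ →L[ℂ] InfTensor ξ)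
  | 0 => 1
  | k + 1 => fermiProd U ξ T k * fermiSite U ξ k (T k)

/-- The finite gradings multiply homogeneous elementary tensors by the expected sign. -/
theorem partialGrading_tprod_homogeneous (U : ∀ i, Grading (H i)) (n : ℕ) (x : RSeq ξ)
    (q : ℕ → ℕ) (hq : ∀ j < n, (U j).op (x.1 j) = (-1 : ℂ) ^ q j • x.1 j) :
    partialGrading U ξ n (tprod x) = (-1 : ℂ) ^ (∑ j ∈ Finset.range n, q j) • tprod x := by
  induction n with
  | zero => simp [partialGrading]
  | succ n ih =>
    have h1 : siteOp ξ n (U n).op (tprod x) = (-1 : ℂ) ^ q n • tprod x := by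
      have : x.site n (U n).op = x.site n ((-1 : ℂ) ^ q n • 1) := by
        refine Subtype.ext ?_
        simp only [RSeq.site]
        rw [hq n (Nat.lt_succ_self n)]
        simp
      rw [siteOp_tprod, this, ← siteOp_tprod, siteOp_smul, siteOp_one]
      rfl
    rw [partialGrading, mul_apply_eq_comp, h1, map_smul,
      ih fun j hj => hq j (hj.trans (Nat.lt_succ_self n)), smul_smul, ← pow_add,
      Finset.sum_range_succ, add_comm]

theorem fermiSite_tprod (U : ∀ i, Grading (H i)) (n : ℕ) (T : H n →L[ℂ] H n) (p : ℕ)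
    (hp : (U n).op * T * (U n).op = (-1 : ℂ) ^ p • T) (x : RSeq ξ) (q : ℕ → ℕ)
    (hq : ∀ j < n, (U j).op (x.1 j) = (-1 : ℂ) ^ q j • x.1 j) :
    fermiSite U ξ n T (tprod x) =
      (-1 : ℂ) ^ (∑ j ∈ Finset.range n, p * q j) • tprod (x.site n T) := by
  have h0 : siteOp ξ n (0 : H n →L[ℂ] H n) = 0 := by
    have := siteOp_smul (ξ := ξ) n 0 (0 : H n →L[ℂ] H n)
    simpa using this
  rw [← Finset.mul_sum, pow_mul]
  rcases Nat.even_or_odd p with he | ho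
  · rw [he.neg_one_pow] at hp ⊢
    have e1 : evenPart (U n) T = T := by
      rw [evenPart, hp]; module
    have e2 : oddPart (U n) T = 0 := by
      rw [oddPart, hp]; module
    rw [fermiSite, e1, e2, h0, mul_zero, add_zero, siteOp_tprod, one_pow, one_smul]
  · rw [ho.neg_one_pow] at hp ⊢
    have e1 : evenPart (U n) T = 0 := by
      rw [evenPart, hp]; module
    have e2 : oddPart (U n) T = T := by
      rw [oddPart, hp]; module
    rw [fermiSite, e1, e2, h0, zero_add, mul_apply_eq_comp, siteOp_tprod]
    refine partialGrading_tprod_homogeneous U n _ q fun j hj => ?_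
    have : (x.site n T).1 j = x.1 j := by simp [RSeq.site, hj.ne]
    rw [this, hq j hj]

/-- The sign rule: for homogeneous `T i` of degree `p i` and homogeneous `x j` of degree `q j`,
`(T 0 ⊗̂ ⋯ ⊗̂ T (k - 1) ⊗̂ 1 ⊗̂ ⋯) (⊗ x j) = ∏_{j < i < k} (-1) ^ (p i * q j) • ⊗ y j`, where
`y j = T j (x j)` for `j < k` and `y j = x j` for `j ≥ k`. -/
theorem fermiProd_tprod (U : ∀ i, Grading (H i)) (T : ∀ i, H i →L[ℂ] H i) (k : ℕ)
    (p : ℕ → ℕ) (hp : ∀ i < k, (U i).op * T i * (U i).op = (-1 : ℂ) ^ p i • T i)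
    (x y : RSeq ξ) (q : ℕ → ℕ) (hq : ∀ j < k, (U j).op (x.1 j) = (-1 : ℂ) ^ q j • x.1 j)
    (hy : ∀ j, y.1 j = if j < k then T j (x.1 j) else x.1 j) :
    fermiProd U ξ T k (tprod x) =
      (-1 : ℂ) ^ (∑ i ∈ Finset.range k, ∑ j ∈ Finset.range i, p i * q j) • tprod y := by
  induction k generalizing x with
  | zero =>
    have : x = y := Subtype.ext (funext fun i => by simp [hy])
    simp [fermiProd, this]
  | succ k ih =>
    rw [fermiProd, mul_apply_eq_comp,
      fermiSite_tprod U k (T k) (p k) (hp k (Nat.lt_succ_self k)) x q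
        fun j hj => hq j (hj.trans (Nat.lt_succ_self k)), map_smul,
      ih (fun i hi => hp i (hi.trans (Nat.lt_succ_self k))) (x.site k (T k)), smul_smul,
      ← pow_add, Finset.sum_range_succ, add_comm]
    · intro j hj
      have : (x.site k (T k)).1 j = x.1 j := by simp [RSeq.site, hj.ne]
      rw [this, hq j (hj.trans (Nat.lt_succ_self k))]
    · intro i
      rw [hy]
      by_cases hi : i = k
      · subst hi; simp [RSeq.site]
      · rw [if_congr (show i < k + 1 ↔ i < k by omega) rfl rfl]
        simp [RSeq.site, hi]

/-- The infinite Fermi product `⊗̂_ξ M i`: the von Neumann algebra on `⊗_ξ H i` generated by the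
operators `T 0 ⊗̂ ⋯ ⊗̂ T (k - 1) ⊗̂ 1 ⊗̂ 1 ⊗̂ ⋯` with `T i ∈ M i` and `k ∈ ℕ`. -/
def fermiTensor (U : ∀ i, Grading (H i)) (ξ : ∀ i, Metric.sphere (0 : H i) 1)
    (M : ∀ i, VonNeumannAlgebra (H i)) : VonNeumannAlgebra (InfTensor ξ) :=
  generatedBy {S | ∃ (T : ∀ i, H i →L[ℂ] H i) (k : ℕ), (∀ i < k, T i ∈ M i) ∧
    S = fermiProd U ξ T k}

end Tensor

end FermiTensor

end

/-! Write `V` for the total grading. The twist by `V` is an automorphism, and it carries the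
operators `rightSite`, in which an odd `S ∈ N n'` is followed by the gradings of all later places,
to the Fermi operators of the twisted elements (`twist_rightSite`). Fermi operators of the `N i`
commute with right operators of the `N i'` because the signs cancel in pairs
(`fermiSite_commute_rightSite`); this is one inclusion. By the double commutant theorem the other
one amounts to `commute_of_commute_fermiSite`: if `y` commutes with the Fermi operators of the `N i`
and `x` with the right operators of the `N i'`, then `x y = y x`.

Compressing `x` and `y` by `headProj ξ n` keeps the relations at the first `n` places, since the
gradings fix the `ξ i`. These projections converge strongly to `1`, so finitely many factors
suffice.

Without gradings, the finite case is Tomita's commutation theorem, proved with real subspaces in the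
manner of Rieffel and van Daele. Given `w`, the spaces `M_sa w` and `M'_sa w`, compressed to the
intersection of the closures of `M w` and `M' w`, form a dual pair: up to closure each is the
symplectic complement of the other (`isDualPair_realOrbit`). Dual pairs are stable under tensor
products (`isDualPair_tensor`), which rests on a vanishing theorem for bilinear forms
(`IsDualPair.bilinear_eq_zero`). Hence `⟨y w, x w⟩` is real for self-adjoint `x`, `y` and elementary
tensors `w`, and polarization in each factor gives `x y = y x`.

To bring in the gradings, suppose first that `y` also commutes with every single `U i`. Then the
ungraded theorem applies to the algebras generated by `N i` and `U i`, whose commutants are the even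
parts of the `N i'`. This extra assumption is removed one place at a time (`commute_of_odd`). If `y`
is odd at place `j`, then `R y` is even there for every right operator `R` of an odd `S ∈ N j'`, so
`R` kills `x y - y x`. The commutator therefore lives under the projection `r` onto the common
kernel of the odd elements of `N j'`. But `r` and `r U j` both lie in `N j`, which forces `r y = 0`.
-/

namespace FermiTensor

/-! ### Projections and invariant subspaces -/

section Hilbert

variable {H : Type*} [NormedAddCommGroup H] [InnerProductSpace ℂ H] [CompleteSpace H]

/-- A projection commutes with an operator that, together with its adjoint, leaves the range
invariant. -/
theorem starProjection_mul_comm (K : Submodule ℂ H) [K.HasOrthogonalProjection] (T : H →L[ℂ] H)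
    (h : ∀ v ∈ K, T v ∈ K) (h' : ∀ v ∈ K, star T v ∈ K) :
    K.starProjection * T = T * K.starProjection := by
  ext v
  rw [mul_apply_eq_comp, mul_apply_eq_comp]
  refine (Submodule.eq_starProjection_of_mem_orthogonal (h _ (K.starProjection_apply_mem v)) ?_)
  rw [← map_sub, Submodule.mem_orthogonal]
  intro w hw
  have := Submodule.inner_right_of_mem_orthogonal (h' w hw)
    (K.sub_starProjection_mem_orthogonal v)
  rwa [ContinuousLinearMap.star_eq_adjoint, ContinuousLinearMap.adjoint_inner_left] at this

theorem star_starProjection (K : Submodule ℂ H) [K.HasOrthogonalProjection] :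
    star K.starProjection = K.starProjection :=
  isSelfAdjoint_starProjection K

theorem inner_star_left (T : H →L[ℂ] H) (v w : H) : ⟪star T v, w⟫_ℂ = ⟪v, T w⟫_ℂ := by
  rw [ContinuousLinearMap.star_eq_adjoint, ContinuousLinearMap.adjoint_inner_left]

theorem inner_star_right (T : H →L[ℂ] H) (v w : H) : ⟪v, star T w⟫_ℂ = ⟪T v, w⟫_ℂ := by
  rw [ContinuousLinearMap.star_eq_adjoint, ContinuousLinearMap.adjoint_inner_right]

/-- A product of commuting self-adjoint operators is self-adjoint, so its expectation values are
real. -/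
theorem inner_im_eq_zero_of_comm {S T : H →L[ℂ] H} (hS : star S = S) (hT : star T = T)
    (h : S * T = T * S) (w : H) : (⟪S w, T w⟫_ℂ).im = 0 := by
  have h1 : ⟪S w, T w⟫_ℂ = ⟪T w, S w⟫_ℂ := by
    rw [← inner_star_right, hS, ← mul_apply_eq_comp, h, mul_apply_eq_comp, ← inner_star_left, hT]
  rw [← Complex.conj_eq_iff_im, inner_conj_symm, h1]

/-- The operators `T` such that `T` and `T*` leave a real subspace invariant. -/
noncomputable def realInvariants (W : Submodule ℝ H) : StarSubalgebra ℝ (H →L[ℂ] H) where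
  carrier := {T | (∀ w ∈ W, T w ∈ W) ∧ ∀ w ∈ W, star T w ∈ W}
  mul_mem' := by
    rintro S T ⟨hS, hS'⟩ ⟨hT, hT'⟩
    refine ⟨fun w hw => hS _ (hT _ hw), fun w hw => ?_⟩
    rw [star_mul]
    exact hT' _ (hS' _ hw)
  add_mem' := by
    rintro S T ⟨hS, hS'⟩ ⟨hT, hT'⟩
    refine ⟨fun w hw => W.add_mem (hS _ hw) (hT _ hw), fun w hw => ?_⟩
    rw [star_add]
    exact W.add_mem (hS' _ hw) (hT' _ hw)
  algebraMap_mem' r := by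
    refine ⟨fun w hw => ?_, fun w hw => ?_⟩
    · rw [Algebra.algebraMap_eq_smul_one]
      exact W.smul_mem r hw
    · rw [Algebra.algebraMap_eq_smul_one, star_smul, star_one, star_trivial]
      exact W.smul_mem r hw
  star_mem' := by
    rintro T ⟨hT, hT'⟩
    exact ⟨hT', by rwa [star_star]⟩

theorem isClosed_realInvariants {W : Submodule ℝ H} (hW : IsClosed (W : Set H)) :
    IsClosed (realInvariants W : Set (H →L[ℂ] H)) := by
  have : (realInvariants W : Set (H →L[ℂ] H)) =
      (⋂ w ∈ W, {T : H →L[ℂ] H | T w ∈ W}) ∩ ⋂ w ∈ W, {T : H →L[ℂ] H | star T w ∈ W} := by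
    ext T
    simp [realInvariants]
  rw [this]
  refine (isClosed_biInter fun w _ => hW.preimage (f := fun T : H →L[ℂ] H => T w) ?_).inter
    (isClosed_biInter fun w _ => hW.preimage (f := fun T : H →L[ℂ] H => star T w) ?_)
  · fun_prop
  · exact (ContinuousLinearMap.apply ℂ H w).continuous.comp continuous_star

/-- A positive operator whose square leaves a closed real subspace invariant leaves it
invariant. -/
theorem mapsTo_of_sq {A : H →L[ℂ] H} (hA : 0 ≤ A) {W : Submodule ℝ H}
    (hW : IsClosed (W : Set H)) (h : ∀ w ∈ W, A (A w) ∈ W) {w : H} (hw : w ∈ W) : A w ∈ W := by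
  have hsa : star A = A := hA.isSelfAdjoint
  have hmem : A * A ∈ realInvariants W := by
    refine ⟨h, ?_⟩
    rw [star_mul, hsa]
    exact h
  -- The square root of `A * A` lies in the closed unital star algebra that `A * A` generates over
  -- the reals. Real scalars are essential here, as `W` is only a real subspace.
  have hs : A = cfc Real.sqrt (A * A) := by
    have h2 : 0 ≤ A * A := by
      have := star_mul_self_nonneg A
      rwa [hsa] at this
    rw [← cfcₙ_eq_cfc, ← CFC.sqrt_eq_real_sqrt (A * A) h2, CFC.sqrt_mul_self A hA]
  have hc : StarAlgebra.elemental ℝ (A * A) ≤ realInvariants W :=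
    StarSubalgebra.topologicalClosure_minimal
      (StarAlgebra.adjoin_le (by simpa using hmem)) (isClosed_realInvariants hW)
  have : A ∈ realInvariants W := by
    rw [hs]
    exact hc (cfc_mem_elemental _ _)
  exact this.1 w hw

end Hilbert

/-! ### Dual pairs of real subspaces -/

section DualPair

variable {E F : Type*} [NormedAddCommGroup E] [InnerProductSpace ℂ E] [CompleteSpace E]
  [NormedAddCommGroup F] [InnerProductSpace ℂ F] [CompleteSpace F]

/-- Sets `K` and `L` spanning real subspaces that are symplectic complements of each other and
are complex total. -/
structure IsDualPair (K L : Set E) : Prop where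
  im_inner : ∀ k ∈ K, ∀ l ∈ L, (⟪k, l⟫_ℂ).im = 0
  -- The hypotheses say that `z` is real orthogonal to `K` and to `i L`; so `K` and `i L` together
  -- span a dense real subspace.
  sep : ∀ z : E, (∀ k ∈ K, (⟪z, k⟫_ℂ).re = 0) → (∀ l ∈ L, (⟪z, l⟫_ℂ).im = 0) → z = 0
  sep_left : ∀ z : E, (∀ k ∈ K, ⟪z, k⟫_ℂ = 0) → z = 0
  sep_right : ∀ z : E, (∀ l ∈ L, ⟪z, l⟫_ℂ = 0) → z = 0

omit [CompleteSpace E] in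
theorem im_inner_comm_eq_zero {v w : E} : (⟪v, w⟫_ℂ).im = 0 ↔ (⟪w, v⟫_ℂ).im = 0 := by
  rw [← inner_conj_symm w v, Complex.conj_im, neg_eq_zero]

omit [CompleteSpace E] in
theorem re_inner_I_smul (v w : E) : (⟪Complex.I • v, w⟫_ℂ).re = (⟪v, w⟫_ℂ).im := by
  rw [inner_smul_left]
  simp

omit [CompleteSpace E] in
theorem im_inner_I_smul (v w : E) : (⟪Complex.I • v, w⟫_ℂ).im = -(⟪v, w⟫_ℂ).re := by
  rw [inner_smul_left]
  simp

/-- The symplectic complement of a set. -/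
noncomputable def symplecticComplement (K : Set E) : Submodule ℝ E where
  carrier := {g | ∀ k ∈ K, (⟪g, k⟫_ℂ).im = 0}
  add_mem' hg hh k hk := by rw [inner_add_left, Complex.add_im, hg k hk, hh k hk, add_zero]
  zero_mem' k _ := by simp
  smul_mem' r g hg k hk := by
    rw [← Complex.coe_smul, inner_smul_left, Complex.conj_ofReal, Complex.im_ofReal_mul, hg k hk,
      mul_zero]

omit [CompleteSpace E] in
theorem mem_symplecticComplement {K : Set E} {g : E} :
    g ∈ symplecticComplement K ↔ ∀ k ∈ K, (⟪g, k⟫_ℂ).im = 0 := Iff.rfl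

omit [CompleteSpace E] in
theorem isClosed_symplecticComplement (K : Set E) :
    IsClosed (symplecticComplement K : Set E) := by
  have : (symplecticComplement K : Set E) = ⋂ k ∈ K, {g | (⟪g, k⟫_ℂ).im = 0} := by
    ext g
    simp [mem_symplecticComplement]
  rw [this]
  exact isClosed_biInter fun k _ => isClosed_eq (by fun_prop) continuous_const

/-- By separation, the symplectic complement of `K` is no larger than the closed real span of `L`.
So `g` is a limit of real combinations of elements of `L`, against which `g'` has real inner
products. -/
theorem IsDualPair.im_inner_of_mem {K L : Set E} (h : IsDualPair K L) {g g' : E}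
    (hg : g ∈ symplecticComplement K) (hg' : g' ∈ symplecticComplement L) :
    (⟪g, g'⟫_ℂ).im = 0 := by
  let _ : InnerProductSpace ℝ E := InnerProductSpace.complexToReal
  set Λ : Submodule ℝ E := (Submodule.span ℝ L).topologicalClosure with hΛ
  have hle : ∀ S : Set E, (∀ l ∈ L, ∀ s ∈ S, (⟪l, s⟫_ℂ).im = 0) →
      Λ ≤ symplecticComplement S := fun S hS =>
    Submodule.topologicalClosure_minimal _ (Submodule.span_le.2 fun l hl => hS l hl)
      (isClosed_symplecticComplement S)
  have hmem : Λ.starProjection g ∈ Λ := Λ.starProjection_apply_mem g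
  have h1 : g - Λ.starProjection g ∈ symplecticComplement K :=
    Submodule.sub_mem _ hg (hle K (fun l hl k hk => im_inner_comm_eq_zero.1 (h.im_inner k hk l hl))
      hmem)
  have h2 : ∀ l ∈ L, (⟪g - Λ.starProjection g, l⟫_ℂ).re = 0 := fun l hl =>
    Submodule.inner_left_of_mem_orthogonal
      (Submodule.le_topologicalClosure _ (Submodule.subset_span hl))
      (Λ.sub_starProjection_mem_orthogonal g)
  -- The defect of `g` is symplectically orthogonal to `K` and real orthogonal to `L`;
  -- multiplication by `i` turns these into the two conditions of `sep`.
  have h3 : Complex.I • (g - Λ.starProjection g) = 0 := by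
    refine h.sep _ (fun k hk => ?_) fun l hl => ?_
    · rw [re_inner_I_smul, h1 k hk]
    · rw [im_inner_I_smul, h2 l hl, neg_zero]
  have h4 : g = Λ.starProjection g :=
    sub_eq_zero.1 ((smul_eq_zero.1 h3).resolve_left Complex.I_ne_zero)
  rw [h4]
  refine hle {g'} (fun l hl s hs => ?_) hmem g' rfl
  rw [Set.mem_singleton_iff.1 hs]
  exact im_inner_comm_eq_zero.1 (hg' l hl)

/-- A bounded bilinear form that is imaginary on `K × K'` and real on `L × L'` vanishes. -/
theorem IsDualPair.bilinear_eq_zero {K L : Set E} {K' L' : Set F} (h : IsDualPair K L)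
    (h' : IsDualPair K' L') (b : E →L[ℂ] F →L[ℂ] ℂ)
    (hK : ∀ k ∈ K, ∀ k' ∈ K', (b k k').re = 0) (hL : ∀ l ∈ L, ∀ l' ∈ L', (b l l').im = 0) :
    b = 0 := by
  -- `C` and `B` are the conjugate-linear Riesz maps of `b` in its two variables. Their composite
  -- `A` is linear and positive, and `⟨A v, v⟩ = ‖B v‖²`, so it suffices to kill `A` on a large
  -- enough set.
  let C : E → F := fun v => (InnerProductSpace.toDual ℂ F).symm (b v)
  have hC : ∀ v w, ⟪C v, w⟫_ℂ = b v w := fun v w =>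
    InnerProductSpace.toDual_symm_apply
  let B : F →L⋆[ℂ] E :=
    ((InnerProductSpace.toDual ℂ E).symm.toContinuousLinearEquiv : _ →L⋆[ℂ] E).comp b.flip
  have hB : ∀ v w, ⟪B w, v⟫_ℂ = b v w := fun v w => InnerProductSpace.toDual_symm_apply
  let C' : E →L⋆[ℂ] F :=
    ((InnerProductSpace.toDual ℂ F).symm.toContinuousLinearEquiv : _ →L⋆[ℂ] F).comp b
  have hC' : ∀ v w, ⟪C' v, w⟫_ℂ = b v w := hC
  let A : F →L[ℂ] F := C'.comp B
  have hA : ∀ v w, ⟪A v, w⟫_ℂ = ⟪B w, B v⟫_ℂ := fun v w => by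
    rw [hB, ← hC']; rfl
  have hpos : 0 ≤ A := by
    rw [ContinuousLinearMap.nonneg_iff_isPositive, ContinuousLinearMap.isPositive_iff]
    refine ⟨fun v w => ?_, fun v => ?_⟩
    · change ⟪A v, w⟫_ℂ = ⟪v, A w⟫_ℂ
      rw [← inner_conj_symm v, hA, hA, inner_conj_symm]
    · rw [hA, inner_self_eq_norm_sq_to_K]
      positivity
  have hBK : ∀ g ∈ symplecticComplement L', ∀ k ∈ K, (⟪B g, k⟫_ℂ).re = 0 := by
    intro g hg k hk
    have h1 : Complex.I • C k ∈ symplecticComplement K' := fun k' hk' => by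
      rw [im_inner_I_smul, hC, hK k hk k' hk', neg_zero]
    have := h'.im_inner_of_mem h1 hg
    rw [im_inner_I_smul, hC, neg_eq_zero] at this
    rwa [hB]
  have hBL : ∀ g ∈ symplecticComplement K', B g ∈ symplecticComplement L := by
    intro g hg l hl
    have h1 : C l ∈ symplecticComplement L' := fun l' hl' => by
      rw [hC, hL l hl l' hl']
    have := h'.im_inner_of_mem hg h1
    rw [im_inner_comm_eq_zero, hC] at this
    rwa [hB]
  -- With `W` the symplectic complement of `L'`, the form being imaginary on one pair and real on
  -- the other makes `i A` preserve `W`. Then `A²` preserves `W`, hence so does its positive root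
  -- `A`. As both `A g` and `i A g` lie in `W`, the vector `A g` is orthogonal to `L'` and vanishes.
  have hAW : ∀ g ∈ symplecticComplement L', Complex.I • A g ∈ symplecticComplement L' := by
    intro g hg l hl
    have h1 : Complex.I • B g ∈ symplecticComplement K := fun k hk => by
      rw [im_inner_I_smul, hBK g hg k hk, neg_zero]
    have h2 := h.im_inner_of_mem h1
      (hBL l fun k hk => im_inner_comm_eq_zero.1 (h'.im_inner k hk l hl))
    rw [im_inner_I_smul, ← inner_conj_symm, Complex.conj_re] at h2
    rw [im_inner_I_smul, hA, h2]
  have hA2 : ∀ g ∈ symplecticComplement L', A (A g) ∈ symplecticComplement L' := by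
    intro g hg
    have := hAW _ (hAW g hg)
    rw [map_smul, smul_smul, Complex.I_mul_I, neg_one_smul] at this
    exact neg_mem_iff.1 this
  have hAg : ∀ g ∈ symplecticComplement L', A g = 0 := by
    intro g hg
    have h1 := mapsTo_of_sq hpos (isClosed_symplecticComplement L') hA2 hg
    refine h'.sep_right _ fun l hl => Complex.ext ?_ (h1 l hl)
    have := hAW g hg l hl
    rw [im_inner_I_smul, neg_eq_zero] at this
    rw [this, Complex.zero_re]
  -- `K'` lies in the symplectic complement of `L'`, where `A` vanishes.
  have hBk : ∀ k ∈ K', B k = 0 := by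
    intro k hk
    have := hA k k
    rw [hAg k (fun l hl => h'.im_inner k hk l hl), inner_zero_left] at this
    exact inner_self_eq_zero.1 this.symm
  ext v w
  have : C v = 0 := h'.sep_left _ fun k hk => by rw [hC, ← hB, hBk k hk, inner_zero_left]
  rw [← hC, this, inner_zero_left]
  rfl

end DualPair

/-! ### The real subspaces of a von Neumann algebra and its commutant -/

section Site

variable {H : Type*} [NormedAddCommGroup H] [InnerProductSpace ℂ H] [CompleteSpace H]

theorem smul_mem_vonNeumann (M : VonNeumannAlgebra H) (c : ℂ) {T : H →L[ℂ] H} (hT : T ∈ M) :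
    c • T ∈ M :=
  M.toStarSubalgebra.smul_mem hT c

/-- Every element of a star-closed space of operators is `S + i T` with self-adjoint elements `S` and `T`. -/
theorem exists_selfAdjoint_decomposition_of_star_mem (V : Submodule ℂ (H →L[ℂ] H))
    (hV : ∀ T ∈ V, star T ∈ V) {R : H →L[ℂ] H} (hR : R ∈ V) :
    ∃ S ∈ V, ∃ T ∈ V, star S = S ∧ star T = T ∧ R = S + Complex.I • T := by
  refine ⟨(1 / 2 : ℂ) • (R + star R), V.smul_mem _ (add_mem hR (hV _ hR)),
    (-Complex.I / 2) • (R - star R), V.smul_mem _ (sub_mem hR (hV _ hR)), ?_, ?_, ?_⟩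
  · rw [star_smul, star_add, star_star, add_comm]
    simp
  · rw [star_smul, star_sub, star_star, ← neg_sub, smul_neg, ← neg_smul]
    simp [neg_div]
  · match_scalars <;> first | ring1 | linear_combination (1 / 2 : ℂ) * Complex.I_mul_I | linear_combination -(1 / 2 : ℂ) * Complex.I_mul_I

theorem exists_selfAdjoint_decomposition (M : VonNeumannAlgebra H) {R : H →L[ℂ] H} (hR : R ∈ M) :
    ∃ S ∈ M, ∃ T ∈ M, star S = S ∧ star T = T ∧ R = S + Complex.I • T :=
  exists_selfAdjoint_decomposition_of_star_mem
    (Subalgebra.toSubmodule M.toStarSubalgebra.toSubalgebra)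
    (fun _ hT => M.toStarSubalgebra.star_mem' hT) hR

/-- If `z` is real orthogonal to `M_sa w` and to `i M'_sa w`, then it is orthogonal to `M w`. -/
theorem inner_eq_zero_of_real_orthogonal (M : VonNeumannAlgebra H) {w z : H}
    (hM : ∀ T ∈ M, star T = T → (⟪z, T w⟫_ℂ).re = 0)
    (hM' : ∀ S ∈ M.commutant, star S = S → (⟪z, S w⟫_ℂ).im = 0) {T : H →L[ℂ] H} (hT : T ∈ M) :
    ⟪z, T w⟫_ℂ = 0 := by
  -- Doubling trick: `M` acts diagonally on `H ⊕ H`, and `p` is the projection onto the cyclic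
  -- subspace of `(w, z)`. It commutes with the diagonal action, so its matrix entries lie in `M'`.
  let D : (H →L[ℂ] H) → (WithLp 2 (H × H) →L[ℂ] WithLp 2 (H × H)) := fun T =>
    (WithLp.prodContinuousLinearEquiv 2 ℂ H H).symm.toContinuousLinearMap ∘L
      (T.prodMap T) ∘L (WithLp.prodContinuousLinearEquiv 2 ℂ H H).toContinuousLinearMap
  have hD : ∀ T v v', D T (WithLp.toLp 2 (v, v')) = WithLp.toLp 2 (T v, T v') := fun _ _ _ => rfl
  have hDs : ∀ T, star (D T) = D (star T) := by
    intro T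
    rw [ContinuousLinearMap.star_eq_adjoint, eq_comm, ContinuousLinearMap.eq_adjoint_iff]
    intro x y
    rw [WithLp.prod_inner_apply, WithLp.prod_inner_apply]
    exact congrArg₂ (· + ·) (inner_star_left T _ _) (inner_star_left T _ _)
  set Y : Submodule ℂ (WithLp 2 (H × H)) :=
    (Submodule.span ℂ {y | ∃ T ∈ M, y = D T (WithLp.toLp 2 (w, z))}).topologicalClosure with hY
  set p := Y.starProjection with hp
  have hinv : ∀ T ∈ M, ∀ v ∈ Y, D T v ∈ Y := by
    intro T hT v hv
    have hle : Y ≤ Y.comap (D T : WithLp 2 (H × H) →ₗ[ℂ] WithLp 2 (H × H)) := by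
      refine Submodule.topologicalClosure_minimal _ (Submodule.span_le.2 ?_)
        ((Submodule.isClosed_topologicalClosure _).preimage (D T).continuous)
      rintro _ ⟨S, hS, rfl⟩
      exact Submodule.le_topologicalClosure _ (Submodule.subset_span ⟨T * S, mul_mem hT hS, rfl⟩)
    exact hle hv
  have hcomm : ∀ T ∈ M, ∀ v, p (D T v) = D T (p v) := fun T hT v =>
    congrArg (fun A : _ →L[ℂ] _ => A v) (starProjection_mul_comm Y (D T) (hinv T hT)
      (by rw [hDs]; exact hinv _ (star_mem hT)))
  have hsym : ∀ u v, ⟪p u, v⟫_ℂ = ⟪u, p v⟫_ℂ := fun u v => Y.inner_starProjection_left_eq_right u v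
  have hpp : ∀ u, p (p u) = p u := fun u =>
    Submodule.starProjection_eq_self_iff.2 (Y.starProjection_apply_mem u)
  have hfix : p (WithLp.toLp 2 (w, z)) = WithLp.toLp 2 (w, z) :=
    Submodule.starProjection_eq_self_iff.2 (Submodule.le_topologicalClosure _
      (Submodule.subset_span ⟨1, one_mem M, rfl⟩))
  -- The first hypothesis makes `⟨T w, z⟩ + ⟨T z, w⟩` twice a vanishing real part for self-adjoint
  -- `T`, so the flipped vector is orthogonal to the cyclic subspace.
  have hkill : p (WithLp.toLp 2 (z, w)) = 0 := by
    rw [hp, Submodule.starProjection_apply_eq_zero_iff, Submodule.orthogonal_closure,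
      Submodule.mem_orthogonal]
    intro u hu
    refine Submodule.span_induction ?_ (by simp)
      (fun a b _ _ ha hb => by rw [inner_add_left, ha, hb, add_zero])
      (fun c a _ ha => by rw [inner_smul_left, ha, mul_zero]) hu
    rintro _ ⟨R, hR, rfl⟩
    have hsa : ∀ T ∈ M, star T = T → ⟪T w, z⟫_ℂ + ⟪T z, w⟫_ℂ = 0 := by
      intro T hT hs
      have h1 : ⟪T z, w⟫_ℂ = ⟪z, T w⟫_ℂ := by rw [← inner_star_left, hs]
      rw [h1, ← inner_conj_symm (T w) z]
      apply Complex.ext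
      · rw [Complex.add_re, Complex.conj_re, hM T hT hs, add_zero, Complex.zero_re]
      · rw [Complex.add_im, Complex.conj_im, neg_add_cancel, Complex.zero_im]
    obtain ⟨S, hS, T, hT, hS', hT', rfl⟩ := exists_selfAdjoint_decomposition M hR
    rw [hD, WithLp.prod_inner_apply]
    change ⟪S w + Complex.I • T w, z⟫_ℂ + ⟪S z + Complex.I • T z, w⟫_ℂ = 0
    rw [inner_add_left, inner_add_left, inner_smul_left, inner_smul_left]
    linear_combination hsa S hS hS' + (starRingEnd ℂ) Complex.I * hsa T hT hT'
  -- The lower left entry of `p`, the element of `M'` to which the second hypothesis is applied.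
  let q : H →L[ℂ] H :=
    WithLp.sndL 2 ℂ H H ∘L p ∘L (WithLp.prodContinuousLinearEquiv 2 ℂ H H).symm.toContinuousLinearMap
      ∘L ContinuousLinearMap.inl ℂ H H
  have hq : ∀ v, q v = (p (WithLp.toLp 2 (v, 0))).snd := fun v => rfl
  have hqM : q ∈ M.commutant := by
    rw [VonNeumannAlgebra.mem_commutant_iff]
    intro T hT
    ext v
    rw [mul_apply_eq_comp, mul_apply_eq_comp, hq, hq]
    have := hcomm T hT (WithLp.toLp 2 (v, 0))
    rw [hD, map_zero] at this
    rw [this]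
    rfl
  have hsymm' : ∀ S ∈ M.commutant, ⟪z, S w⟫_ℂ = ⟪w, S z⟫_ℂ := by
    have hsa : ∀ S ∈ M.commutant, star S = S → ⟪z, S w⟫_ℂ = ⟪w, S z⟫_ℂ := by
      intro S hS hs
      rw [← inner_conj_symm w, ← inner_star_right, hs, Complex.conj_eq_iff_im.2 (hM' S hS hs)]
    intro R hR
    obtain ⟨S, hS, T, hT, hS', hT', rfl⟩ := exists_selfAdjoint_decomposition _ hR
    change ⟪z, S w + Complex.I • T w⟫_ℂ = ⟪w, S z + Complex.I • T z⟫_ℂ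
    rw [inner_add_right, inner_add_right, inner_smul_right, inner_smul_right, hsa S hS hS',
      hsa T hT hT']
  set a : WithLp 2 (H × H) := WithLp.toLp 2 (w, 0) with ha
  set b : WithLp 2 (H × H) := WithLp.toLp 2 (0, w) with hb
  set a' : WithLp 2 (H × H) := WithLp.toLp 2 (z, 0) with ha'
  set b' : WithLp 2 (H × H) := WithLp.toLp 2 (0, z) with hb'
  have e1 : a + b' = WithLp.toLp 2 (w, z) := by
    rw [ha, hb', ← WithLp.toLp_add]; simp
  have e2 : a' + b = WithLp.toLp 2 (z, w) := by
    rw [ha', hb, ← WithLp.toLp_add]; simp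
  rw [← e1, map_add] at hfix
  rw [← e2, map_add] at hkill
  have hinl : ∀ u v, ⟪WithLp.toLp 2 (0, u), p (WithLp.toLp 2 (v, 0))⟫_ℂ = ⟪u, q v⟫_ℂ := by
    intro u v
    rw [WithLp.prod_inner_apply, hq]
    simp
  have k1 : ⟪b', p a⟫_ℂ = ⟪b, p a'⟫_ℂ := by
    rw [hinl, hinl]
    exact hsymm' q hqM
  have hab' : ⟪b', a⟫_ℂ = 0 := by simp [WithLp.prod_inner_apply, ha, hb']
  -- From `p (a + b') = a + b'` and `p (a' + b) = 0`, the numbers `‖a - p a‖²` and `‖p b‖²` are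
  -- opposite, because `⟨z, q w⟩ = ⟨w, q z⟩`. So both vanish: `p` fixes `(w, 0)` and `(0, z)` and
  -- kills `(0, w)`. Since `p` commutes with `T ⊕ T`, the claim follows.
  have h1 : ⟪a - p a, a - p a⟫_ℂ = ⟪b', p a⟫_ℂ := by
    have h : ⟪a - p a, p a⟫_ℂ = 0 := by rw [← hsym, map_sub, hpp, sub_self, inner_zero_left]
    have h2 : a - p a = p b' - b' := by
      rw [sub_eq_sub_iff_add_eq_add, add_comm (p b'), hfix]
    rw [inner_sub_right, h, sub_zero, h2, inner_sub_left, hsym, hab', sub_zero]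
  have h2 : ⟪p b, p b⟫_ℂ = -⟪b', p a⟫_ℂ := by
    rw [hsym, hpp, eq_neg_of_add_eq_zero_right hkill, inner_neg_right, k1]
  have h3 : ‖a - p a‖ ^ 2 + ‖p b‖ ^ 2 = 0 := by
    have := congrArg₂ (· + ·) h1 h2
    simp only [add_neg_cancel, inner_self_eq_norm_sq_to_K] at this
    exact (RCLike.ofReal_eq_zero (K := ℂ)).1 (by push_cast; exact this)
  have hpb : p b = 0 := norm_eq_zero.1 (by nlinarith [sq_nonneg ‖a - p a‖, sq_nonneg ‖p b‖])
  have hpa : a - p a = 0 := norm_eq_zero.1 (by nlinarith [sq_nonneg ‖a - p a‖, sq_nonneg ‖p b‖])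
  have hpb' : p b' = b' := by
    rw [← sub_eq_zero.1 hpa] at hfix
    exact add_left_cancel hfix
  have h4 : ⟪z, T w⟫_ℂ = ⟪b', D T b⟫_ℂ := by
    rw [hb, hD, WithLp.prod_inner_apply, hb']
    simp
  rw [h4, ← hpb', hsym, hcomm T hT, hpb, map_zero, inner_zero_right]

/-! ### Cyclic subspaces and the dual pair attached to a vector -/

/-- The closed subspace spanned by `M w`. -/
noncomputable def cyclicSpace (M : VonNeumannAlgebra H) (w : H) : Submodule ℂ H :=
  (Submodule.span ℂ {v | ∃ T ∈ M, v = T w}).topologicalClosure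

noncomputable instance (M : VonNeumannAlgebra H) (w : H) : CompleteSpace (cyclicSpace M w) :=
  (Submodule.isClosed_topologicalClosure _).completeSpace_coe

/-- The projection onto the closed subspace spanned by `M w`. -/
noncomputable def cyclicProj (M : VonNeumannAlgebra H) (w : H) : H →L[ℂ] H :=
  (cyclicSpace M w).starProjection

theorem apply_mem_cyclicSpace (M : VonNeumannAlgebra H) (w : H) {T : H →L[ℂ] H} (hT : T ∈ M) :
    T w ∈ cyclicSpace M w :=
  Submodule.le_topologicalClosure _ (Submodule.subset_span ⟨T, hT, rfl⟩)

theorem map_mem_cyclicSpace (M : VonNeumannAlgebra H) (w : H) {T : H →L[ℂ] H} (hT : T ∈ M)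
    {v : H} (hv : v ∈ cyclicSpace M w) : T v ∈ cyclicSpace M w := by
  have hle : cyclicSpace M w ≤ (cyclicSpace M w).comap (T : H →ₗ[ℂ] H) := by
    refine Submodule.topologicalClosure_minimal _ (Submodule.span_le.2 ?_)
      ((Submodule.isClosed_topologicalClosure _).preimage T.continuous)
    rintro _ ⟨S, hS, rfl⟩
    exact apply_mem_cyclicSpace M w (mul_mem hT hS)
  exact hle hv

theorem cyclicProj_mem (M : VonNeumannAlgebra H) (w : H) : cyclicProj M w ∈ M.commutant := by
  rw [VonNeumannAlgebra.mem_commutant_iff]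
  intro T hT
  exact (starProjection_mul_comm _ T (fun _ => map_mem_cyclicSpace M w hT)
    fun _ => map_mem_cyclicSpace M w (star_mem hT)).symm

theorem cyclicProj_commutant_mem (M : VonNeumannAlgebra H) (w : H) :
    cyclicProj M.commutant w ∈ M := by
  have := cyclicProj_mem M.commutant w
  rwa [VonNeumannAlgebra.commutant_commutant] at this

theorem star_cyclicProj (M : VonNeumannAlgebra H) (w : H) :
    star (cyclicProj M w) = cyclicProj M w := star_starProjection _

theorem cyclicProj_eq_self {M : VonNeumannAlgebra H} {w v : H} :
    cyclicProj M w v = v ↔ v ∈ cyclicSpace M w := Submodule.starProjection_eq_self_iff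

theorem cyclicProj_apply_mem (M : VonNeumannAlgebra H) (w v : H) :
    cyclicProj M w v ∈ cyclicSpace M w := Submodule.starProjection_apply_mem _ v

theorem mem_cyclicSpace_self (M : VonNeumannAlgebra H) (w : H) : w ∈ cyclicSpace M w :=
  apply_mem_cyclicSpace M w (one_mem M)

theorem eq_zero_of_mem_cyclicSpace {M : VonNeumannAlgebra H} {w z : H}
    (hz : z ∈ cyclicSpace M w) (h : ∀ T ∈ M, ⟪z, T w⟫_ℂ = 0) : z = 0 := by
  have hle : cyclicSpace M w ≤ (innerSL ℂ z).ker := by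
    refine Submodule.topologicalClosure_minimal _ (Submodule.span_le.2 ?_)
      (ContinuousLinearMap.isClosed_ker _)
    rintro _ ⟨T, hT, rfl⟩
    exact h T hT
  exact inner_self_eq_zero.1 (hle hz)

/-- The intersection of the closed subspaces spanned by `M w` and `M' w`. -/
noncomputable def bicyclicSpace (M : VonNeumannAlgebra H) (w : H) : Submodule ℂ H :=
  cyclicSpace M w ⊓ cyclicSpace M.commutant w

noncomputable instance (M : VonNeumannAlgebra H) (w : H) : CompleteSpace (bicyclicSpace M w) :=
  ((Submodule.isClosed_topologicalClosure _).inter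
    (Submodule.isClosed_topologicalClosure _)).completeSpace_coe

/-- The image of `M_sa w` in the closed subspace spanned by `M' w`. -/
def realOrbit (M : VonNeumannAlgebra H) (w : H) : Set H :=
  {v | ∃ T ∈ M, star T = T ∧ v = cyclicProj M.commutant w (T w)}

theorem realOrbit_subset (M : VonNeumannAlgebra H) (w : H) :
    realOrbit M w ⊆ bicyclicSpace M w := by
  rintro _ ⟨T, hT, -, rfl⟩
  exact ⟨apply_mem_cyclicSpace M w (mul_mem (cyclicProj_commutant_mem M w) hT),
    cyclicProj_apply_mem _ _ _⟩

theorem realOrbit_commutant_subset (M : VonNeumannAlgebra H) (w : H) :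
    realOrbit M.commutant w ⊆ bicyclicSpace M w := by
  rw [bicyclicSpace, inf_comm]
  have := realOrbit_subset M.commutant w
  rwa [bicyclicSpace, VonNeumannAlgebra.commutant_commutant] at this

/-- A vector of `realOrbit M w` is of the form `T w` with a self-adjoint element `T`. -/
theorem exists_of_mem_realOrbit {M : VonNeumannAlgebra H} {w v : H} (hv : v ∈ realOrbit M w) :
    ∃ T ∈ M, star T = T ∧ v = T w := by
  obtain ⟨T, hT, hs, rfl⟩ := hv
  have he := cyclicProj_commutant_mem M w
  -- The projection `e` onto the closure of `M' w` belongs to `M` and fixes `w`, so `e T w = (e T e)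
  -- w`.
  refine ⟨cyclicProj M.commutant w * T * cyclicProj M.commutant w, mul_mem (mul_mem he hT) he,
    ?_, ?_⟩
  · rw [star_mul, star_mul, hs, star_cyclicProj, mul_assoc]
  · rw [mul_apply_eq_comp, mul_apply_eq_comp, cyclicProj_eq_self.2 (mem_cyclicSpace_self _ w)]

theorem inner_realOrbit {M : VonNeumannAlgebra H} {w z : H} (hz : z ∈ cyclicSpace M.commutant w)
    (T : H →L[ℂ] H) : ⟪z, cyclicProj M.commutant w (T w)⟫_ℂ = ⟪z, T w⟫_ℂ := by
  rw [← inner_star_left, star_cyclicProj, cyclicProj_eq_self.2 hz]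

theorem eq_zero_of_inner_realOrbit {M : VonNeumannAlgebra H} {w z : H}
    (hz : z ∈ bicyclicSpace M w) (h : ∀ v ∈ realOrbit M w, ⟪z, v⟫_ℂ = 0) : z = 0 := by
  refine eq_zero_of_mem_cyclicSpace hz.1 fun R hR => ?_
  obtain ⟨S, hS, T, hT, hS', hT', rfl⟩ := exists_selfAdjoint_decomposition M hR
  change ⟪z, S w + Complex.I • T w⟫_ℂ = 0
  rw [inner_add_right, inner_smul_right, ← inner_realOrbit hz.2 S, ← inner_realOrbit hz.2 T,
    h _ ⟨S, hS, hS', rfl⟩, h _ ⟨T, hT, hT', rfl⟩, mul_zero, add_zero]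

/-- Elements of `M` and of `M'` commute, whence the real inner products. Separation is
`inner_eq_zero_of_real_orthogonal`: for `z` in the bicyclic space the two compressing projections
can be dropped from the inner products. -/
theorem isDualPair_realOrbit (M : VonNeumannAlgebra H) (w : H) :
    IsDualPair ((↑) ⁻¹' realOrbit M w : Set (bicyclicSpace M w))
      ((↑) ⁻¹' realOrbit M.commutant w : Set (bicyclicSpace M w)) := by
  have hcc := VonNeumannAlgebra.commutant_commutant M
  have hz' : ∀ z ∈ bicyclicSpace M w, z ∈ bicyclicSpace M.commutant w := fun z hz => by
    rw [bicyclicSpace, hcc]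
    exact hz.symm
  refine ⟨?_, ?_, ?_, ?_⟩
  · intro k hk l hl
    obtain ⟨S, hS, hS', hk⟩ := exists_of_mem_realOrbit hk
    obtain ⟨T, hT, hT', hl⟩ := exists_of_mem_realOrbit hl
    rw [Submodule.coe_inner, hk, hl]
    exact inner_im_eq_zero_of_comm hS' hT' (VonNeumannAlgebra.mem_commutant_iff.1 hT S hS) w
  · intro z hK hL
    refine Subtype.ext (eq_zero_of_mem_cyclicSpace z.2.1 fun T hT =>
      inner_eq_zero_of_real_orthogonal M (fun T hT hs => ?_) (fun S hS hs => ?_) hT)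
    · have hv : cyclicProj M.commutant w (T w) ∈ realOrbit M w := ⟨T, hT, hs, rfl⟩
      rw [← inner_realOrbit z.2.2]
      exact hK ⟨_, realOrbit_subset M w hv⟩ hv
    · have hv : cyclicProj M.commutant.commutant w (S w) ∈ realOrbit M.commutant w :=
        ⟨S, hS, hs, rfl⟩
      rw [← inner_realOrbit (M := M.commutant) (hz' _ z.2).2]
      exact hL ⟨_, realOrbit_commutant_subset M w hv⟩ hv
  · intro z h
    exact Subtype.ext (eq_zero_of_inner_realOrbit z.2 fun v hv =>
      h ⟨v, realOrbit_subset M w hv⟩ hv)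
  · intro z h
    exact Subtype.ext (eq_zero_of_inner_realOrbit (hz' _ z.2) fun v hv =>
      h ⟨v, realOrbit_commutant_subset M w hv⟩ hv)

end Site

/-! ### Operators on the infinite tensor product -/

theorem mem_of_mem_closure_span {E F : Type*} [NormedAddCommGroup E] [NormedSpace ℂ E]
    [NormedAddCommGroup F] [NormedSpace ℂ F] {s : Set E} {K : Submodule ℂ F}
    (hK : IsClosed (K : Set F)) (A : E →L[ℂ] F) (h : ∀ v ∈ s, A v ∈ K) {v : E}
    (hv : v ∈ (Submodule.span ℂ s).topologicalClosure) : A v ∈ K := by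
  have hle : (Submodule.span ℂ s).topologicalClosure ≤ K.comap (A : E →ₗ[ℂ] F) :=
    Submodule.topologicalClosure_minimal _ (Submodule.span_le.2 h) (hK.preimage A.continuous)
  exact hle hv

theorem eq_of_mem_closure_span {E F : Type*} [NormedAddCommGroup E] [NormedSpace ℂ E]
    [NormedAddCommGroup F] [NormedSpace ℂ F] {s : Set E} (A B : E →L[ℂ] F)
    (h : ∀ v ∈ s, A v = B v) {v : E} (hv : v ∈ (Submodule.span ℂ s).topologicalClosure) :
    A v = B v := by
  have := mem_of_mem_closure_span (K := ⊥) (by simp) (A - B)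
    (fun v hv => by simp [h v hv]) hv
  exact sub_eq_zero.1 (by simpa using this)

theorem eq_zero_of_mem_closure_span {E : Type*} [NormedAddCommGroup E] [InnerProductSpace ℂ E]
    {s : Set E} {z : E} (h : ∀ v ∈ s, ⟪z, v⟫_ℂ = 0)
    (hz : z ∈ (Submodule.span ℂ s).topologicalClosure) : z = 0 :=
  inner_self_eq_zero.1 (eq_of_mem_closure_span (innerSL ℂ z) 0 h hz)

/-- An operator that commutes with `s` and `s*` commutes with the generated algebra. -/
theorem commute_of_mem_generatedBy {K : Type*} [NormedAddCommGroup K] [InnerProductSpace ℂ K]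
    [CompleteSpace K] {s : Set (K →L[ℂ] K)} {R y : K →L[ℂ] K} (hR : R ∈ generatedBy s)
    (h : ∀ S ∈ s, Commute y S ∧ Commute y (star S)) : Commute y R := by
  change R ∈ StarSubalgebra.centralizer ℂ (StarSubalgebra.centralizer ℂ s : Set (K →L[ℂ] K)) at hR
  exact ((StarSubalgebra.mem_centralizer_iff ℂ).1 hR y ((StarSubalgebra.mem_centralizer_iff ℂ).2
    fun S hS => ⟨(h S hS).1.symm.eq, (h S hS).2.symm.eq⟩)).1

section TensorOps

set_option linter.unusedSectionVars false

variable {H : ℕ → Type*} [∀ i, NormedAddCommGroup (H i)] [∀ i, InnerProductSpace ℂ (H i)]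
  {ξ : ∀ i, Metric.sphere (0 : H i) 1}

/-- Replace the `i`-th component. -/
def RSeq.set (i : ℕ) (h : H i) (x : RSeq ξ) : RSeq ξ :=
  ⟨Function.update x.1 i h, (x.2.insert i).subset fun j hj => by
    by_cases e : j = i
    · exact Or.inl e
    · exact Or.inr (by simpa [Function.update_of_ne e] using hj)⟩

@[simp]
theorem RSeq.set_self (i : ℕ) (h : H i) (x : RSeq ξ) : (x.set i h).1 i = h := by simp [RSeq.set]

theorem RSeq.set_of_ne {i j : ℕ} (e : j ≠ i) (h : H i) (x : RSeq ξ) :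
    (x.set i h).1 j = x.1 j := by simp [RSeq.set, e]

theorem RSeq.set_set (i : ℕ) (h h' : H i) (x : RSeq ξ) : (x.set i h).set i h' = x.set i h' :=
  Subtype.ext (by simp [RSeq.set])

theorem RSeq.set_eq_self (i : ℕ) (x : RSeq ξ) : x.set i (x.1 i) = x :=
  Subtype.ext (by simp [RSeq.set])

theorem RSeq.site_set (i : ℕ) (T : H i →L[ℂ] H i) (h : H i) (x : RSeq ξ) :
    (x.set i h).site i T = x.set i (T h) :=
  Subtype.ext (by simp [RSeq.set, RSeq.site])

theorem RSeq.site_eq_set (i : ℕ) (T : H i →L[ℂ] H i) (x : RSeq ξ) :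
    x.site i T = x.set i (T (x.1 i)) := rfl

/-- The sequence `ξ` itself. -/
def RSeq.base (ξ : ∀ i, Metric.sphere (0 : H i) 1) : RSeq ξ := ⟨fun i => ξ i, by simp⟩

/-- The elementary tensors `⊗ x i` with `x i ∈ S i` for `i < m` and `x i = ξ i` for `i ≥ m`. -/
def tensorSet (ξ : ∀ i, Metric.sphere (0 : H i) 1) (S : ∀ i, Set (H i)) (m : ℕ) :
    Set (InfTensor ξ) :=
  {v | ∃ x : RSeq ξ, (∀ i < m, x.1 i ∈ S i) ∧ (∀ i ≥ m, x.1 i = ξ i) ∧ v = tprod x}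

/-- The closed subspace spanned by `tensorSet ξ S m`. -/
noncomputable def tensorSpace (ξ : ∀ i, Metric.sphere (0 : H i) 1) (S : ∀ i, Set (H i)) (m : ℕ) :
    Submodule ℂ (InfTensor ξ) := (Submodule.span ℂ (tensorSet ξ S m)).topologicalClosure

noncomputable instance (S : ∀ i, Set (H i)) (m : ℕ) : CompleteSpace (tensorSpace ξ S m) :=
  (Submodule.isClosed_topologicalClosure _).completeSpace_coe

theorem isClosed_tensorSpace (S : ∀ i, Set (H i)) (m : ℕ) :
    IsClosed (tensorSpace ξ S m : Set (InfTensor ξ)) := Submodule.isClosed_topologicalClosure _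

theorem tensorSet_subset_tensorSpace (S : ∀ i, Set (H i)) (m : ℕ) :
    tensorSet ξ S m ⊆ tensorSpace ξ S m :=
  Submodule.subset_span.trans (Submodule.le_topologicalClosure _)

theorem tensorSet_mono {S S' : ∀ i, Set (H i)} (h : ∀ i, S i ⊆ S' i) (m : ℕ) :
    tensorSet ξ S m ⊆ tensorSet ξ S' m := by
  rintro _ ⟨x, h1, h2, rfl⟩
  exact ⟨x, fun i hi => h i (h1 i hi), h2, rfl⟩

theorem tensorSet_zero (S : ∀ i, Set (H i)) : tensorSet ξ S 0 = {tprod (RSeq.base ξ)} := by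
  ext v
  constructor
  · rintro ⟨x, -, h2, rfl⟩
    exact congrArg tprod (Subtype.ext (funext fun i => h2 i (Nat.zero_le i)))
  · rintro rfl
    exact ⟨RSeq.base ξ, by simp, fun _ _ => rfl, rfl⟩

variable [∀ i, CompleteSpace (H i)]

theorem siteOp_zero (i : ℕ) : siteOp ξ i (0 : H i →L[ℂ] H i) = 0 := by
  have := siteOp_smul (ξ := ξ) i 0 (0 : H i →L[ℂ] H i)
  simpa using this

theorem siteOp_mul (i : ℕ) (S T : H i →L[ℂ] H i) :
    siteOp ξ i (S * T) = siteOp ξ i S * siteOp ξ i T := by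
  refine ext_tprod fun x => ?_
  rw [mul_apply_eq_comp, siteOp_tprod, siteOp_tprod, siteOp_tprod, RSeq.site_site]

theorem star_siteOp (i : ℕ) (T : H i →L[ℂ] H i) :
    star (siteOp ξ i T) = siteOp ξ i (star T) := by
  refine ext_inner_tprod fun x y => ?_
  rw [inner_star_right, siteOp_tprod, siteOp_tprod, inner_tprod, inner_tprod]
  exact kernel_site_adjoint i T x y

theorem siteOp_commute {i j : ℕ} (h : i ≠ j) (S : H i →L[ℂ] H i) (T : H j →L[ℂ] H j) :
    Commute (siteOp ξ i S) (siteOp ξ j T) := by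
  refine ext_tprod fun x => ?_
  rw [mul_apply_eq_comp, mul_apply_eq_comp, siteOp_tprod, siteOp_tprod, siteOp_tprod, siteOp_tprod]
  refine congrArg tprod (Subtype.ext ?_)
  simp only [RSeq.site, Function.update_of_ne h, Function.update_of_ne h.symm]
  exact Function.update_comm h.symm _ _ _

/-! ### Slots and slices of a single factor -/

/-- `siteOp` as a continuous linear map. -/
noncomputable def siteL (ξ : ∀ i, Metric.sphere (0 : H i) 1) (i : ℕ) :
    (H i →L[ℂ] H i) →L[ℂ] (InfTensor ξ →L[ℂ] InfTensor ξ) :=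
  LinearMap.mkContinuous
    { toFun := siteOp ξ i
      map_add' := siteOp_add i
      map_smul' := siteOp_smul i } 1 fun T => by
    rw [one_mul]
    exact norm_siteOp_le i T

/-- The operators `1 ⊗ ⋯ ⊗ |h⟩⟨ξ i| ⊗ 1 ⊗ ⋯`, linear in `h`. -/
noncomputable def creation (ξ : ∀ i, Metric.sphere (0 : H i) 1) (i : ℕ) :
    H i →L[ℂ] (InfTensor ξ →L[ℂ] InfTensor ξ) :=
  siteL ξ i ∘L (ContinuousLinearMap.smulRightL ℂ (H i) (H i) (innerSL ℂ (ξ i : H i)))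

theorem creation_tprod (i : ℕ) (h : H i) {x : RSeq ξ} (hx : x.1 i = ξ i) :
    creation ξ i h (tprod x) = tprod (x.set i h) := by
  change siteOp ξ i _ (tprod x) = _
  rw [siteOp_tprod, RSeq.site_eq_set, hx]
  congr 2
  change ⟪(ξ i : H i), (ξ i : H i)⟫_ℂ • h = h
  rw [inner_unit, one_smul]

/-- The map `h ↦ ⊗ x' j`, where `x' i = h` and `x' j = x j` for `j ≠ i`. -/
noncomputable def slot (x : RSeq ξ) (i : ℕ) : H i →L[ℂ] InfTensor ξ :=
  ContinuousLinearMap.apply ℂ (InfTensor ξ) (tprod (x.set i (ξ i))) ∘L creation ξ i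

theorem slot_apply (x : RSeq ξ) (i : ℕ) (h : H i) : slot x i h = tprod (x.set i h) := by
  change creation ξ i h (tprod (x.set i (ξ i))) = _
  rw [creation_tprod i h (x.set_self i _), RSeq.set_set]

theorem slot_map (x : RSeq ξ) (i : ℕ) (T : H i →L[ℂ] H i) (h : H i) :
    slot x i (T h) = siteOp ξ i T (slot x i h) := by
  rw [slot_apply, slot_apply, siteOp_tprod, RSeq.site_set]

/-- The compression of an operator to the `i`-th factor. -/
noncomputable def slice (x y : RSeq ξ) (i : ℕ) (A : InfTensor ξ →L[ℂ] InfTensor ξ) :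
    H i →L[ℂ] H i :=
  ContinuousLinearMap.adjoint (slot x i) ∘L A ∘L slot y i

theorem inner_slice (x y : RSeq ξ) (i : ℕ) (A : InfTensor ξ →L[ℂ] InfTensor ξ) (h h' : H i) :
    ⟪h, slice x y i A h'⟫_ℂ = ⟪tprod (x.set i h), A (tprod (y.set i h'))⟫_ℂ := by
  rw [slice, ContinuousLinearMap.comp_apply, ContinuousLinearMap.adjoint_inner_right,
    ContinuousLinearMap.comp_apply, slot_apply, slot_apply]

theorem slice_mul (x y : RSeq ξ) (i : ℕ) (A : InfTensor ξ →L[ℂ] InfTensor ξ)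
    (T : H i →L[ℂ] H i) : slice x y i (A * siteOp ξ i T) = slice x y i A * T := by
  refine ContinuousLinearMap.ext fun h => ext_inner_left ℂ fun h' => ?_
  rw [mul_apply_eq_comp, inner_slice, inner_slice, mul_apply_eq_comp, siteOp_tprod,
    RSeq.site_set]

theorem slice_mul' (x y : RSeq ξ) (i : ℕ) (A : InfTensor ξ →L[ℂ] InfTensor ξ)
    (T : H i →L[ℂ] H i) : slice x y i (siteOp ξ i T * A) = T * slice x y i A := by
  refine ContinuousLinearMap.ext fun h => ext_inner_left ℂ fun h' => ?_
  rw [mul_apply_eq_comp, ← inner_star_left T, inner_slice, inner_slice, mul_apply_eq_comp,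
    ← inner_star_left, star_siteOp, siteOp_tprod, RSeq.site_set]

/-- If `A` commutes with the operators of a von Neumann algebra in the `i`-th place whenever these
are in a self-adjoint set `s`, then it does so for all elements of the generated algebra. -/
theorem commute_siteOp_of_generatedBy (i : ℕ) (s : Set (H i →L[ℂ] H i))
    (hs : ∀ T ∈ s, star T ∈ s) {A : InfTensor ξ →L[ℂ] InfTensor ξ}
    (h : ∀ T ∈ s, Commute A (siteOp ξ i T)) {T : H i →L[ℂ] H i} (hT : T ∈ generatedBy s) :
    Commute A (siteOp ξ i T) := by
  refine ext_inner_tprod fun x y => ?_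
  -- Commutation with operators at place `i` can be tested on slices, which act on `H i` itself;
  -- there the double commutant applies.
  have hc : ∀ S ∈ s, Commute (slice x y i A) S := fun S hS => by
    change _ * _ = _ * _
    rw [← slice_mul, ← slice_mul', h S hS]
  have key := (commute_of_mem_generatedBy hT fun S hS => ⟨hc S hS, hc _ (hs S hS)⟩).eq
  rw [← slice_mul, ← slice_mul'] at key
  have := congrArg (fun B : H i →L[ℂ] H i => ⟪x.1 i, B (y.1 i)⟫_ℂ) key
  simpa only [inner_slice, RSeq.set_eq_self] using this

/-- The finite product `T 0 ⊗ ⋯ ⊗ T (n - 1) ⊗ 1 ⊗ 1 ⊗ ⋯`. -/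
noncomputable def prodOp (ξ : ∀ i, Metric.sphere (0 : H i) 1) (T : ∀ i, H i →L[ℂ] H i) :
    ℕ → (InfTensor ξ →L[ℂ] InfTensor ξ)
  | 0 => 1
  | n + 1 => prodOp ξ T n * siteOp ξ n (T n)

theorem commute_prodOp (T : ∀ i, H i →L[ℂ] H i) {n : ℕ} {A : InfTensor ξ →L[ℂ] InfTensor ξ}
    (h : ∀ i < n, Commute A (siteOp ξ i (T i))) : Commute A (prodOp ξ T n) := by
  induction n with
  | zero => exact Commute.one_right A
  | succ n ih => exact (ih fun i hi => h i (hi.trans n.lt_succ_self)).mul_right (h n n.lt_succ_self)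

theorem prodOp_commute_siteOp (T : ∀ i, H i →L[ℂ] H i) {n i : ℕ} (h : n ≤ i)
    (S : H i →L[ℂ] H i) : Commute (siteOp ξ i S) (prodOp ξ T n) :=
  commute_prodOp T fun j hj => siteOp_commute (by omega) _ _

theorem prodOp_mul (S T : ∀ i, H i →L[ℂ] H i) (n : ℕ) :
    prodOp ξ S n * prodOp ξ T n = prodOp ξ (fun i => S i * T i) n := by
  induction n with
  | zero => exact one_mul 1
  | succ n ih =>
    rw [prodOp, prodOp, prodOp, ← ih, siteOp_mul, mul_assoc, ← mul_assoc (siteOp ξ n (S n)),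
      (prodOp_commute_siteOp T le_rfl (S n)).eq]
    simp only [mul_assoc]

theorem star_prodOp (T : ∀ i, H i →L[ℂ] H i) (n : ℕ) :
    star (prodOp ξ T n) = prodOp ξ (fun i => star (T i)) n := by
  induction n with
  | zero => exact star_one _
  | succ n ih =>
    rw [prodOp, prodOp, star_mul, ih, star_siteOp, (prodOp_commute_siteOp _ le_rfl _).eq]

theorem prodOp_tprod (T : ∀ i, H i →L[ℂ] H i) (n : ℕ) (x y : RSeq ξ)
    (h : ∀ i, y.1 i = if i < n then T i (x.1 i) else x.1 i) :
    prodOp ξ T n (tprod x) = tprod y := by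
  induction n generalizing x with
  | zero =>
    have : x = y := Subtype.ext (funext fun i => by simp [h])
    rw [this]; rfl
  | succ n ih =>
    rw [prodOp, mul_apply_eq_comp, siteOp_tprod]
    refine ih _ fun i => ?_
    rw [h]
    by_cases hi : i = n
    · subst hi; simp [RSeq.site]
    · rw [if_congr (show i < n + 1 ↔ i < n by omega) rfl rfl]
      simp [RSeq.site, hi]

/-! ### Projections onto the first factors -/

/-- The projection onto the vectors that are `ξ n ⊗ ξ (n + 1) ⊗ ⋯` from the `n`-th place on. -/
noncomputable def headProj (ξ : ∀ i, Metric.sphere (0 : H i) 1) (n : ℕ) :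
    InfTensor ξ →L[ℂ] InfTensor ξ := (tensorSpace ξ (fun _ => Set.univ) n).starProjection

theorem headProj_mul_self (n : ℕ) : headProj ξ n * headProj ξ n = headProj ξ n :=
  Submodule.isIdempotentElem_starProjection _

theorem star_headProj (n : ℕ) : star (headProj ξ n) = headProj ξ n := star_starProjection _

theorem headProj_apply_mem (n : ℕ) (v : InfTensor ξ) :
    headProj ξ n v ∈ tensorSpace ξ (fun _ => Set.univ) n := Submodule.starProjection_apply_mem _ v

theorem headProj_tprod {n : ℕ} {x : RSeq ξ} (hx : ∀ i ≥ n, x.1 i = ξ i) :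
    headProj ξ n (tprod x) = tprod x :=
  Submodule.starProjection_eq_self_iff.2
    (tensorSet_subset_tensorSpace _ n ⟨x, fun _ _ => Set.mem_univ _, hx, rfl⟩)

theorem headProj_commute {n : ℕ} {A : InfTensor ξ →L[ℂ] InfTensor ξ}
    (h : ∀ v ∈ tensorSet ξ (fun _ => Set.univ) n, A v ∈ tensorSet ξ (fun _ => Set.univ) n)
    (h' : ∀ v ∈ tensorSet ξ (fun _ => Set.univ) n, star A v ∈ tensorSet ξ (fun _ => Set.univ) n) :
    Commute (headProj ξ n) A :=
  starProjection_mul_comm _ A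
    (fun _ => mem_of_mem_closure_span (isClosed_tensorSpace _ n) A
      fun v hv => tensorSet_subset_tensorSpace _ n (h v hv))
    (fun _ => mem_of_mem_closure_span (isClosed_tensorSpace _ n) (star A)
      fun v hv => tensorSet_subset_tensorSpace _ n (h' v hv))

theorem headProj_commute_siteOp {n i : ℕ} (hi : i < n) (T : H i →L[ℂ] H i) :
    Commute (headProj ξ n) (siteOp ξ i T) := by
  have h : ∀ T : H i →L[ℂ] H i, ∀ v ∈ tensorSet ξ (fun _ => Set.univ) n,
      siteOp ξ i T v ∈ tensorSet ξ (fun _ => Set.univ) n := by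
    rintro T _ ⟨x, -, h2, rfl⟩
    rw [siteOp_tprod]
    refine ⟨_, fun _ _ => Set.mem_univ _, fun j hj => ?_, rfl⟩
    rw [RSeq.site_eq_set, RSeq.set_of_ne (by omega), h2 j hj]
  exact headProj_commute (h T) (by rw [star_siteOp]; exact h _)

theorem tendsto_headProj (v : InfTensor ξ) :
    Filter.Tendsto (fun n => headProj ξ n v) Filter.atTop (nhds v) := by
  refine Submodule.starProjection_tendsto_self (𝕜 := ℂ)
    (fun n => tensorSpace ξ (fun _ => Set.univ) n) (fun m n hmn => ?_) v ?_
  · refine Submodule.topologicalClosure_mono (Submodule.span_mono ?_)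
    rintro _ ⟨x, -, h2, rfl⟩
    exact ⟨x, fun _ _ => Set.mem_univ _, fun i hi => h2 i (hmn.trans hi), rfl⟩
  · set Λ := (⨆ n, tensorSpace ξ (fun _ => Set.univ) n).topologicalClosure with hΛ
    have : CompleteSpace Λ := (Submodule.isClosed_topologicalClosure _).completeSpace_coe
    -- Each elementary tensor agrees with `ξ` from some place on, and so is fixed by the projection
    -- onto the closed union.
    have h1 : Λ.starProjection = 1 := by
      refine ext_tprod fun x => ?_
      refine Submodule.starProjection_eq_self_iff.2 (Submodule.le_topologicalClosure _ ?_)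
      obtain ⟨n, hn⟩ := x.2.bddAbove
      refine Submodule.mem_iSup_of_mem (n + 1) (tensorSet_subset_tensorSpace _ _
        ⟨x, fun _ _ => Set.mem_univ _, fun i hi => ?_, rfl⟩)
      by_contra hne
      have := hn hne
      omega
    intro u _
    have := congrArg (fun A : InfTensor ξ →L[ℂ] InfTensor ξ => A u) h1
    exact Submodule.starProjection_eq_self_iff.1 this

end TensorOps

/-! ### Dual pairs in the infinite tensor product -/

section TensorDualPair

set_option linter.unusedSectionVars false

variable {H : ℕ → Type*} [∀ i, NormedAddCommGroup (H i)] [∀ i, InnerProductSpace ℂ (H i)]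
  [∀ i, CompleteSpace (H i)] {ξ : ∀ i, Metric.sphere (0 : H i) 1}

theorem im_inner_tensorSet {K L : ∀ i, Set (H i)} {m : ℕ}
    (h : ∀ i < m, ∀ k ∈ K i, ∀ l ∈ L i, (⟪k, l⟫_ℂ).im = 0) {v w : InfTensor ξ}
    (hv : v ∈ tensorSet ξ K m) (hw : w ∈ tensorSet ξ L m) : (⟪v, w⟫_ℂ).im = 0 := by
  obtain ⟨x, hx, hx', rfl⟩ := hv
  obtain ⟨y, hy, hy', rfl⟩ := hw
  rw [inner_tprod]
  refine finprod_induction (fun z : ℂ => z.im = 0) Complex.one_im (fun a b ha hb => ?_) fun i => ?_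
  · rw [Complex.mul_im, ha, hb, mul_zero, zero_mul, add_zero]
  · rcases lt_or_ge i m with hi | hi
    · exact h i hi _ (hx i hi) _ (hy i hi)
    · rw [hx' i hi, hy' i hi, inner_unit, Complex.one_im]

/-- The bilinear form `(v, f) ↦ ⟨z, v ⊗ f⟩`, with `f` in the `m`-th place. -/
noncomputable def insertForm (z : InfTensor ξ) (S : ∀ i, Set (H i)) (m : ℕ)
    (F : Submodule ℂ (H m)) : tensorSpace ξ S m →L[ℂ] F →L[ℂ] ℂ :=
  ((ContinuousLinearMap.compL ℂ (InfTensor ξ) (InfTensor ξ) ℂ (innerSL ℂ z)) ∘L creation ξ m ∘L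
    F.subtypeL).flip ∘L (tensorSpace ξ S m).subtypeL

theorem insertForm_tprod (z : InfTensor ξ) (S : ∀ i, Set (H i)) (m : ℕ)
    (F : Submodule ℂ (H m)) {x : RSeq ξ} (hx : x.1 m = ξ m) (hv : tprod x ∈ tensorSpace ξ S m)
    (f : F) : insertForm z S m F ⟨tprod x, hv⟩ f = ⟪z, tprod (x.set m (f : H m))⟫_ℂ := by
  change ⟪z, creation ξ m (f : H m) (tprod x)⟫_ℂ = _
  rw [creation_tprod m _ hx]

theorem tprod_set_mem_tensorSet {S : ∀ i, Set (H i)} {m : ℕ} {x : RSeq ξ}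
    (h : ∀ i < m, x.1 i ∈ S i) (h' : ∀ i ≥ m, x.1 i = ξ i) {f : H m} (hf : f ∈ S m) :
    tprod (x.set m f) ∈ tensorSet ξ S (m + 1) := by
  refine ⟨_, fun i hi => ?_, fun i hi => ?_, rfl⟩
  · rcases eq_or_ne i m with rfl | hne
    · rwa [RSeq.set_self]
    · rw [RSeq.set_of_ne hne]
      exact h i (by omega)
  · rw [RSeq.set_of_ne (by omega)]
    exact h' i (by omega)

/-- A vector of the `(m + 1)`-st space vanishes if its bilinear form does. -/
theorem eq_zero_of_insertForm {F : ∀ i, Submodule ℂ (H i)} {m : ℕ} {z : InfTensor ξ}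
    (hz : z ∈ tensorSpace ξ (fun i => (F i : Set (H i))) (m + 1))
    (h : insertForm z (fun i => (F i : Set (H i))) m (F m) = 0) : z = 0 := by
  refine eq_zero_of_mem_closure_span ?_ hz
  rintro _ ⟨x, hx, hx', rfl⟩
  have hmem : tprod (x.set m (ξ m)) ∈ tensorSet ξ (fun i => (F i : Set (H i))) m := by
    refine ⟨_, fun i hi => ?_, fun i hi => ?_, rfl⟩
    · rw [RSeq.set_of_ne hi.ne]
      exact hx i (by omega)
    · rcases eq_or_ne i m with rfl | hne
      · rw [RSeq.set_self]
      · rw [RSeq.set_of_ne hne, hx' i (by omega)]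
  have := insertForm_tprod z (fun i => (F i : Set (H i))) m (F m) (x.set_self m _)
    (tensorSet_subset_tensorSpace _ m hmem) ⟨x.1 m, hx m (by omega)⟩
  rw [h, RSeq.set_set, RSeq.set_eq_self] at this
  exact this.symm

/-- The complex linear counterpart of `IsDualPair.bilinear_eq_zero`, used for the two totality
conditions of a tensor product of dual pairs. -/
theorem bilinear_eq_zero_of_total {E F : Type*} [NormedAddCommGroup E] [InnerProductSpace ℂ E]
    [CompleteSpace E] [NormedAddCommGroup F] [InnerProductSpace ℂ F] [CompleteSpace F]
    {K : Set E} {K' : Set F} (hK : ∀ z : E, (∀ k ∈ K, ⟪z, k⟫_ℂ = 0) → z = 0)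
    (hK' : ∀ z : F, (∀ k ∈ K', ⟪z, k⟫_ℂ = 0) → z = 0) (b : E →L[ℂ] F →L[ℂ] ℂ)
    (h : ∀ k ∈ K, ∀ k' ∈ K', b k k' = 0) : b = 0 := by
  have h1 : ∀ k' ∈ K', ∀ v, b v k' = 0 := by
    intro k' hk' v
    have hz := hK ((InnerProductSpace.toDual ℂ E).symm (b.flip k')) fun k hk => by
      rw [InnerProductSpace.toDual_symm_apply]
      exact h k hk k' hk'
    have : ⟪(InnerProductSpace.toDual ℂ E).symm (b.flip k'), v⟫_ℂ = b v k' :=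
      InnerProductSpace.toDual_symm_apply
    rw [← this, hz, inner_zero_left]
  ext v w
  have hz := hK' ((InnerProductSpace.toDual ℂ F).symm (b v)) fun k hk => by
    rw [InnerProductSpace.toDual_symm_apply]
    exact h1 k hk v
  have : ⟪(InnerProductSpace.toDual ℂ F).symm (b v), w⟫_ℂ = b v w :=
    InnerProductSpace.toDual_symm_apply
  rw [← this, hz, inner_zero_left]
  rfl

/-- The property `p` will be vanishing, vanishing of the real part, or vanishing of the imaginary
part; this passes from tests on `m + 1` factors to the bilinear form on `m` factors times one. -/
theorem insertForm_of_forall {p : ℂ → Prop} {F : ∀ i, Submodule ℂ (H i)} {K : ∀ i, Set (H i)}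
    {m : ℕ} {z : InfTensor ξ} (h : ∀ k ∈ tensorSet ξ K (m + 1), p ⟪z, k⟫_ℂ)
    (k : tensorSpace ξ (fun i => (F i : Set (H i))) m) (hk : (k : InfTensor ξ) ∈ tensorSet ξ K m)
    (k' : F m) (hk' : (k' : H m) ∈ K m) :
    p (insertForm z (fun i => (F i : Set (H i))) m (F m) k k') := by
  obtain ⟨v, hv⟩ := k
  obtain ⟨x, hx, hx', rfl⟩ := hk
  rw [insertForm_tprod z _ m (F m) (hx' m le_rfl)]
  exact h _ (tprod_set_mem_tensorSet hx hx' hk')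

/-- By induction on `m`: a vector of the next tensor space is determined by its bilinear form, which
vanishes on a product of total sets. -/
theorem tensorSet_total (F : ∀ i, Submodule ℂ (H i)) [∀ i, CompleteSpace (F i)]
    {K : ∀ i, Set (H i)} (hK : ∀ i, ∀ z : F i, (∀ k : F i, (k : H i) ∈ K i → ⟪z, k⟫_ℂ = 0) → z = 0)
    (hKF : ∀ i, K i ⊆ F i) (m : ℕ) :
    ∀ z : tensorSpace ξ (fun i => (F i : Set (H i))) m,
      (∀ k ∈ ((↑) ⁻¹' tensorSet ξ K m : Set (tensorSpace ξ (fun i => (F i : Set (H i))) m)),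
        ⟪z, k⟫_ℂ = 0) → z = 0 := by
  have hsub := fun m => (tensorSet_mono hKF m).trans
    (tensorSet_subset_tensorSpace (ξ := ξ) (fun i => (F i : Set (H i))) m)
  induction m with
  | zero =>
    intro z h
    refine Subtype.ext (eq_zero_of_mem_closure_span (fun v hv => ?_) z.2)
    rw [tensorSet_zero] at hv
    rw [← tensorSet_zero K] at hv
    exact h ⟨v, hsub 0 hv⟩ hv
  | succ m ih =>
    intro z h
    refine Subtype.ext (eq_zero_of_insertForm z.2 ?_)
    refine bilinear_eq_zero_of_total ih (K' := (↑) ⁻¹' K m) (hK m) _ fun k hk k' hk' =>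
      insertForm_of_forall (p := fun c => c = 0) (fun v hv => h ⟨v, hsub (m + 1) hv⟩ hv)
        k hk k' hk'

/-- Tensor products of dual pairs are dual pairs. -/
theorem isDualPair_tensor (F : ∀ i, Submodule ℂ (H i)) [∀ i, CompleteSpace (F i)]
    {K L : ∀ i, Set (H i)} (hK : ∀ i, K i ⊆ F i) (hL : ∀ i, L i ⊆ F i)
    (h : ∀ i, IsDualPair ((↑) ⁻¹' K i : Set (F i)) ((↑) ⁻¹' L i)) (m : ℕ) :
    IsDualPair ((↑) ⁻¹' tensorSet ξ K m : Set (tensorSpace ξ (fun i => (F i : Set (H i))) m))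
      ((↑) ⁻¹' tensorSet ξ L m) := by
  have hsub := fun m => (tensorSet_mono hK m).trans
    (tensorSet_subset_tensorSpace (ξ := ξ) (fun i => (F i : Set (H i))) m)
  have hsub' := fun m => (tensorSet_mono hL m).trans
    (tensorSet_subset_tensorSpace (ξ := ξ) (fun i => (F i : Set (H i))) m)
  induction m with
  | zero =>
    refine ⟨fun k hk l hl => im_inner_tensorSet (by simp) hk hl, fun z h1 h2 => ?_,
      tensorSet_total F (fun i => (h i).sep_left) hK 0,
      tensorSet_total F (fun i => (h i).sep_right) hL 0⟩
    -- Without factors both sets consist of the vector `⊗ ξ i` alone, so its real and imaginary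
    -- tests together say that the inner product is zero.
    refine tensorSet_total F (K := K) (fun i => (h i).sep_left) hK 0 z fun k hk =>
      Complex.ext (h1 k hk) (h2 k ?_)
    rw [Set.mem_preimage, tensorSet_zero] at hk ⊢
    exact hk
  | succ m ih =>
    refine ⟨fun k hk l hl => im_inner_tensorSet (fun i _ k hk l hl =>
        (h i).im_inner ⟨k, hK i hk⟩ hk ⟨l, hL i hl⟩ hl) hk hl, fun z h1 h2 => ?_,
      tensorSet_total F (fun i => (h i).sep_left) hK _,
      tensorSet_total F (fun i => (h i).sep_right) hL _⟩
    -- Separation for `m + 1` factors is exactly the vanishing theorem for a form that is imaginary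
    -- on the `K` sides and real on the `L` sides.
    refine Subtype.ext (eq_zero_of_insertForm z.2 (ih.bilinear_eq_zero (h m) _ ?_ ?_))
    · exact fun k hk k' hk' => insertForm_of_forall (p := fun c => c.re = 0)
        (fun v hv => h1 ⟨v, hsub (m + 1) hv⟩ hv) k hk k' hk'
    · exact fun k hk k' hk' => insertForm_of_forall (p := fun c => c.im = 0)
        (fun v hv => h2 ⟨v, hsub' (m + 1) hv⟩ hv) k hk k' hk'

end TensorDualPair

/-! ### The commutation theorem for finitely many factors -/

section Commutation

variable {H : ℕ → Type*} [∀ i, NormedAddCommGroup (H i)] [∀ i, InnerProductSpace ℂ (H i)]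
  [∀ i, CompleteSpace (H i)] {ξ : ∀ i, Metric.sphere (0 : H i) 1}

/-- The operators on the first `n` factors that commute with `M i` in the `i`-th place. -/
noncomputable def headCommutant (ξ : ∀ i, Metric.sphere (0 : H i) 1)
    (M : ∀ i, VonNeumannAlgebra (H i)) (n : ℕ) :
    Submodule ℂ (InfTensor ξ →L[ℂ] InfTensor ξ) where
  carrier := {y | headProj ξ n * y = y ∧ y * headProj ξ n = y ∧
    ∀ i < n, ∀ T ∈ M i, Commute y (siteOp ξ i T)}
  add_mem' := by
    rintro a b ⟨h1, h2, h3⟩ ⟨h1', h2', h3'⟩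
    exact ⟨by rw [mul_add, h1, h1'], by rw [add_mul, h2, h2'],
      fun i hi T hT => (h3 i hi T hT).add_left (h3' i hi T hT)⟩
  zero_mem' := ⟨mul_zero _, zero_mul _, fun _ _ _ _ => Commute.zero_left _⟩
  smul_mem' := by
    rintro c a ⟨h1, h2, h3⟩
    exact ⟨by rw [mul_smul_comm, h1], by rw [smul_mul_assoc, h2],
      fun i hi T hT => (h3 i hi T hT).smul_left c⟩

theorem star_mem_headCommutant {M : ∀ i, VonNeumannAlgebra (H i)} {n : ℕ}
    {y : InfTensor ξ →L[ℂ] InfTensor ξ} (hy : y ∈ headCommutant ξ M n) :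
    star y ∈ headCommutant ξ M n := by
  obtain ⟨h1, h2, h3⟩ := hy
  refine ⟨?_, ?_, fun i hi T hT => ?_⟩
  · have := congrArg star h2
    rwa [star_mul, star_headProj] at this
  · have := congrArg star h1
    rwa [star_mul, star_headProj] at this
  · have := (h3 i hi _ (star_mem hT)).star_star
    rwa [star_siteOp, star_star] at this

/-- The tensor product of the projections onto the closed subspaces spanned by `M i (w i)`. -/
noncomputable def cyclicProdProj (M : ∀ i, VonNeumannAlgebra (H i)) (w : RSeq ξ) (n : ℕ) :
    InfTensor ξ →L[ℂ] InfTensor ξ := prodOp ξ (fun i => cyclicProj (M i) (w.1 i)) n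

theorem star_cyclicProdProj (M : ∀ i, VonNeumannAlgebra (H i)) (w : RSeq ξ) (n : ℕ) :
    star (cyclicProdProj M w n) = cyclicProdProj M w n := by
  simp only [cyclicProdProj, star_prodOp, star_cyclicProj]

theorem cyclicProdProj_tprod (M : ∀ i, VonNeumannAlgebra (H i)) (w : RSeq ξ) (n : ℕ) :
    cyclicProdProj M w n (tprod w) = tprod w := by
  refine prodOp_tprod _ n w w fun i => ?_
  rw [cyclicProj_eq_self.2 (mem_cyclicSpace_self (M i) (w.1 i)), ite_self]

/-- The vector `k` is `T w` for a product `T` of self-adjoint elements of the `M i`. Such a `T`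
commutes with `y` and with the cyclic projections, which lie in the commutants `M i'` and fix `w`;
what remains is `⟨y w, T w⟩`. -/
theorem im_inner_cyclicProdProj {M : ∀ i, VonNeumannAlgebra (H i)} {n : ℕ} {w : RSeq ξ}
    (hw : ∀ i ≥ n, w.1 i = ξ i) {y : InfTensor ξ →L[ℂ] InfTensor ξ}
    (hy : y ∈ headCommutant ξ M n) (hs : star y = y) {k : InfTensor ξ}
    (hk : k ∈ tensorSet ξ (fun i => realOrbit (M i) (w.1 i)) n) :
    (⟪cyclicProdProj M w n (y (tprod w)), k⟫_ℂ).im = 0 := by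
  obtain ⟨x, hx, hx', rfl⟩ := hk
  have hex : ∀ i, ∃ T ∈ M i, star T = T ∧ (i < n → x.1 i = T (w.1 i)) := by
    intro i
    by_cases hi : i < n
    · obtain ⟨T, hT, hT', e⟩ := exists_of_mem_realOrbit (hx i hi)
      exact ⟨T, hT, hT', fun _ => e⟩
    · exact ⟨1, one_mem _, star_one _, fun h => absurd h hi⟩
  choose T hT hT' e using hex
  have h1 : tprod x = prodOp ξ T n (tprod w) := by
    refine (prodOp_tprod T n w x fun i => ?_).symm
    split_ifs with hi
    · exact e i hi
    · rw [hx' i (by omega), hw i (by omega)]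
  have h2 : Commute (cyclicProdProj M w n) (prodOp ξ T n) := by
    change _ * _ = _ * _
    rw [cyclicProdProj, prodOp_mul, prodOp_mul]
    congr 1
    funext i
    exact (VonNeumannAlgebra.mem_commutant_iff.1 (cyclicProj_mem (M i) (w.1 i)) _ (hT i)).symm
  have h3 : Commute y (prodOp ξ T n) := commute_prodOp T fun i hi => hy.2.2 i hi _ (hT i)
  have h4 : star (prodOp ξ T n) = prodOp ξ T n := by
    rw [star_prodOp]
    congr 1
    exact funext hT'
  rw [h1, ← star_cyclicProdProj, inner_star_left, ← mul_apply_eq_comp (cyclicProdProj M w n), h2.eq,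
    mul_apply_eq_comp, cyclicProdProj_tprod]
  exact inner_im_eq_zero_of_comm hs h4 h3.eq _

theorem commute_cyclicProdProj {M : ∀ i, VonNeumannAlgebra (H i)} {n : ℕ} (w : RSeq ξ)
    {y : InfTensor ξ →L[ℂ] InfTensor ξ} (hy : y ∈ headCommutant ξ M n) :
    Commute y (cyclicProdProj (fun i => (M i).commutant) w n) :=
  commute_prodOp _ fun i hi => hy.2.2 i hi _ (cyclicProj_commutant_mem _ _)

theorem cyclicProdProj_comm (M : ∀ i, VonNeumannAlgebra (H i)) (w : RSeq ξ) (n : ℕ) :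
    Commute (cyclicProdProj M w n) (cyclicProdProj (fun i => (M i).commutant) w n) := by
  change _ * _ = _ * _
  rw [cyclicProdProj, cyclicProdProj, prodOp_mul, prodOp_mul]
  congr 1
  funext i
  exact (VonNeumannAlgebra.mem_commutant_iff.1 (cyclicProj_mem (M i) (w.1 i)) _
    (cyclicProj_commutant_mem (M i) (w.1 i))).symm

/-- Since `y` commutes with the projections onto the closures of the `M i' (w i)`, these fix `y w`.
So the other family of cyclic projections sends `y w` into the product of the intersections. -/
theorem cyclicProdProj_mem {M : ∀ i, VonNeumannAlgebra (H i)} {n : ℕ} (w : RSeq ξ)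
    {y : InfTensor ξ →L[ℂ] InfTensor ξ} (hy : y ∈ headCommutant ξ M n) :
    cyclicProdProj M w n (y (tprod w)) ∈
      tensorSpace ξ (fun i => (bicyclicSpace (M i) (w.1 i) : Set (H i))) n := by
  have h1 : cyclicProdProj M w n (y (tprod w)) = prodOp ξ (fun i => cyclicProj (M i) (w.1 i) *
      cyclicProj (M i).commutant (w.1 i)) n (y (tprod w)) := by
    rw [← prodOp_mul]
    change _ = cyclicProdProj M w n (cyclicProdProj (fun i => (M i).commutant) w n (y (tprod w)))
    rw [← mul_apply_eq_comp (cyclicProdProj (fun i => (M i).commutant) w n) y, ← (commute_cyclicProdProj w hy).eq, mul_apply_eq_comp,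
      cyclicProdProj_tprod]
  have h2 : y (tprod w) ∈ tensorSpace ξ (fun _ => Set.univ) n := by
    rw [← hy.1]
    exact headProj_apply_mem n _
  rw [h1]
  refine mem_of_mem_closure_span (isClosed_tensorSpace _ n) _ (fun v hv => ?_) h2
  obtain ⟨x, -, hx, rfl⟩ := hv
  have hfin : {i | (if i < n then (cyclicProj (M i) (w.1 i) *
      cyclicProj (M i).commutant (w.1 i)) (x.1 i) else x.1 i) ≠ ξ i}.Finite := by
    refine (Set.finite_lt_nat n).subset fun i hi => ?_
    by_contra hlt
    exact hi (by rw [if_neg (show ¬ i < n from hlt), hx i (not_lt.1 hlt)])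
  refine tensorSet_subset_tensorSpace _ n ⟨⟨_, hfin⟩, fun i hi => ?_, fun i hi => ?_,
    prodOp_tprod _ n x _ fun i => rfl⟩
  · change (if i < n then _ else _) ∈ bicyclicSpace (M i) (w.1 i)
    rw [if_pos hi]
    refine ⟨cyclicProj_apply_mem _ _ _, ?_⟩
    rw [VonNeumannAlgebra.mem_commutant_iff.1 (cyclicProj_mem (M i) (w.1 i)) _
      (cyclicProj_commutant_mem (M i) (w.1 i)) |>.symm]
    exact cyclicProj_apply_mem _ _ _
  · exact (if_neg (not_lt.2 hi)).trans (hx i hi)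

/-- Compressed to the tensor product of bicyclic spaces, `y w` and `x w` are symplectically
orthogonal to the two halves of the product dual pair. -/
theorem im_inner_headCommutant {M : ∀ i, VonNeumannAlgebra (H i)} {n : ℕ} {w : RSeq ξ}
    (hw : ∀ i ≥ n, w.1 i = ξ i) {x y : InfTensor ξ →L[ℂ] InfTensor ξ}
    (hy : y ∈ headCommutant ξ M n) (hy' : star y = y)
    (hx : x ∈ headCommutant ξ (fun i => (M i).commutant) n) (hx' : star x = x) :
    (⟪y (tprod w), x (tprod w)⟫_ℂ).im = 0 := by
  set e := cyclicProdProj (fun i => (M i).commutant) w n with he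
  set e' := cyclicProdProj M w n with he'
  have hes : star e = e := star_cyclicProdProj _ w n
  have hes' : star e' = e' := star_cyclicProdProj _ w n
  have hcc : (fun i => (M i).commutant.commutant) = M :=
    funext fun i => VonNeumannAlgebra.commutant_commutant (M i)
  have hxe : Commute x e' := by
    have := commute_cyclicProdProj w hx
    rwa [hcc] at this
  -- `e` fixes `y w` and `e'` fixes `x w`; as the two projections commute, they can be exchanged
  -- across the inner product.
  have h1 : ⟪y (tprod w), x (tprod w)⟫_ℂ = ⟪e' (y (tprod w)), e (x (tprod w))⟫_ℂ := by
    have a1 : y (tprod w) = e (y (tprod w)) := by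
      rw [← mul_apply_eq_comp, ← (commute_cyclicProdProj w hy).eq, mul_apply_eq_comp,
        cyclicProdProj_tprod]
    have a2 : x (tprod w) = e' (x (tprod w)) := by
      rw [← mul_apply_eq_comp, ← hxe.eq, mul_apply_eq_comp, cyclicProdProj_tprod]
    calc ⟪y (tprod w), x (tprod w)⟫_ℂ = ⟪e (y (tprod w)), e' (x (tprod w))⟫_ℂ := by rw [← a1, ← a2]
      _ = ⟪y (tprod w), (e' * e) (x (tprod w))⟫_ℂ := by
        rw [(cyclicProdProj_comm M w n).eq, mul_apply_eq_comp, ← inner_star_left e, hes]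
      _ = ⟪e' (y (tprod w)), e (x (tprod w))⟫_ℂ := by
        rw [mul_apply_eq_comp, ← inner_star_left e', hes']
  have hpair := isDualPair_tensor (ξ := ξ) (fun i => bicyclicSpace (M i) (w.1 i))
    (fun i => realOrbit_subset (M i) (w.1 i)) (fun i => realOrbit_commutant_subset (M i) (w.1 i))
    (fun i => isDualPair_realOrbit (M i) (w.1 i)) n
  have hmem : e (x (tprod w)) ∈
      tensorSpace ξ (fun i => (bicyclicSpace (M i) (w.1 i) : Set (H i))) n := by
    have := cyclicProdProj_mem w hx
    simp only [bicyclicSpace, VonNeumannAlgebra.commutant_commutant] at this ⊢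
    simpa only [inf_comm] using this
  rw [h1]
  exact hpair.im_inner_of_mem (g := ⟨_, cyclicProdProj_mem w hy⟩) (g' := ⟨_, hmem⟩)
    (fun k hk => im_inner_cyclicProdProj hw hy hy' hk)
    (fun l hl => im_inner_cyclicProdProj hw hx hx' hl)

/-- An operator on the first `n` factors whose quadratic form vanishes on elementary tensors
is zero. -/
theorem eq_zero_of_inner_tprod_self {n : ℕ} {D : InfTensor ξ →L[ℂ] InfTensor ξ}
    (h1 : headProj ξ n * D = D) (h2 : D * headProj ξ n = D)
    (h : ∀ w : RSeq ξ, (∀ i ≥ n, w.1 i = ξ i) → ⟪tprod w, D (tprod w)⟫_ℂ = 0) : D = 0 := by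
  -- Polarization one factor at a time: `m` bounds the places at which the two tensors may differ.
  -- Over `ℂ` a slice with zero quadratic form is zero.
  have key : ∀ m ≤ n, ∀ a b : RSeq ξ, (∀ i ≥ n, a.1 i = ξ i) → (∀ i ≥ m, a.1 i = b.1 i) →
      ⟪tprod a, D (tprod b)⟫_ℂ = 0 := by
    intro m
    induction m with
    | zero =>
      intro _ a b ha hab
      have : a = b := Subtype.ext (funext fun i => hab i (Nat.zero_le i))
      rw [← this]
      exact h a ha
    | succ m ih =>
      intro hm a b ha hab
      have hs : slice a b m D = 0 := by
        have : (slice a b m D : H m →ₗ[ℂ] H m) = 0 := by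
          rw [← inner_map_self_eq_zero]
          intro u
          rw [← inner_conj_symm]
          change (starRingEnd ℂ) ⟪u, slice a b m D u⟫_ℂ = 0
          rw [inner_slice, ih (by omega) (a.set m u) (b.set m u), map_zero]
          · intro i hi
            rw [RSeq.set_of_ne (by omega), ha i hi]
          · intro i hi
            rcases eq_or_ne i m with rfl | hne
            · rw [RSeq.set_self, RSeq.set_self]
            · rw [RSeq.set_of_ne hne, RSeq.set_of_ne hne, hab i (by omega)]
        exact ContinuousLinearMap.coe_injective this
      have := inner_slice a b m D (a.1 m) (b.1 m)
      rw [hs, RSeq.set_eq_self, RSeq.set_eq_self] at this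
      rw [← this]
      exact inner_zero_right _
  have hb : ∀ v ∈ tensorSet ξ (fun _ => Set.univ) n, D v = (0 : InfTensor ξ →L[ℂ] InfTensor ξ) v := by
    rintro _ ⟨b, -, hb, rfl⟩
    refine eq_zero_of_mem_closure_span (s := tensorSet ξ (fun _ => Set.univ) n) ?_ ?_
    · rintro _ ⟨a, -, ha, rfl⟩
      rw [← inner_conj_symm, key n le_rfl a b ha fun i hi => (ha i hi).trans (hb i hi).symm,
        map_zero]
    · rw [← h1]
      exact headProj_apply_mem n _
  ext v
  rw [← h2]
  exact eq_of_mem_closure_span D 0 hb (headProj_apply_mem n v)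

/-- The commutation theorem for finitely many factors. -/
theorem commute_of_mem_headCommutant {M : ∀ i, VonNeumannAlgebra (H i)} {n : ℕ}
    {x y : InfTensor ξ →L[ℂ] InfTensor ξ} (hy : y ∈ headCommutant ξ M n)
    (hx : x ∈ headCommutant ξ (fun i => (M i).commutant) n) : Commute x y := by
  have hsa : ∀ y ∈ headCommutant ξ M n, ∀ x ∈ headCommutant ξ (fun i => (M i).commutant) n,
      star y = y → star x = x → Commute x y := by
    intro y hy x hx hy' hx'
    refine sub_eq_zero.1 (eq_zero_of_inner_tprod_self (n := n) ?_ ?_ fun w hw => ?_)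
    · rw [mul_sub, ← mul_assoc, ← mul_assoc, hy.1, hx.1]
    · rw [sub_mul, mul_assoc, mul_assoc, hy.2.1, hx.2.1]
    · change ⟪tprod w, x (y (tprod w)) - y (x (tprod w))⟫_ℂ = 0
      have b1 : ⟪tprod w, x (y (tprod w))⟫_ℂ = ⟪x (tprod w), y (tprod w)⟫_ℂ := by
        rw [← inner_star_left, hx']
      have b2 : ⟪tprod w, y (x (tprod w))⟫_ℂ = ⟪y (tprod w), x (tprod w)⟫_ℂ := by
        rw [← inner_star_left, hy']
      rw [inner_sub_right, b1, b2, ← inner_conj_symm (x (tprod w)), sub_eq_zero,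
        Complex.conj_eq_iff_im]
      exact im_inner_headCommutant hw hy hy' hx hx'
  obtain ⟨S, hS, T, hT, hS', hT', rfl⟩ :=
    exists_selfAdjoint_decomposition_of_star_mem _ (fun _ => star_mem_headCommutant) hy
  obtain ⟨S₁, hS₁, T₁, hT₁, hS₁', hT₁', rfl⟩ :=
    exists_selfAdjoint_decomposition_of_star_mem _ (fun _ => star_mem_headCommutant) hx
  have a1 := hsa S hS S₁ hS₁ hS' hS₁'
  have a2 := hsa S hS T₁ hT₁ hS' hT₁'
  have a3 := hsa T hT S₁ hS₁ hT' hS₁'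
  have a4 := hsa T hT T₁ hT₁ hT' hT₁'
  exact (a1.add_left (a2.smul_left _)).add_right ((a3.add_left (a4.smul_left _)).smul_right _)

end Commutation

/-! ### Even and odd operators -/

section Parity

variable {H : Type*} [NormedAddCommGroup H] [InnerProductSpace ℂ H] [CompleteSpace H]

theorem Grading.mul_cancel_left (U : Grading H) (T : H →L[ℂ] H) : U.op * (U.op * T) = T := by
  rw [← mul_assoc, U.op_mul_op, one_mul]

theorem Grading.mul_cancel_right (U : Grading H) (T : H →L[ℂ] H) : T * U.op * U.op = T := by
  rw [mul_assoc, U.op_mul_op, mul_one]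

theorem evenPart_add_oddPart (U : Grading H) (T : H →L[ℂ] H) : evenPart U T + oddPart U T = T := by
  rw [evenPart, oddPart]
  module

theorem commute_evenPart (U : Grading H) (T : H →L[ℂ] H) : Commute U.op (evenPart U T) := by
  change U.op * _ = _ * U.op
  rw [evenPart, mul_smul_comm, smul_mul_assoc, mul_add, add_mul, U.mul_cancel_right, mul_assoc,
    U.mul_cancel_left, add_comm]

theorem semiconjBy_oddPart (U : Grading H) (T : H →L[ℂ] H) :
    SemiconjBy U.op (oddPart U T) (-oddPart U T) := by
  change U.op * _ = -_ * U.op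
  rw [oddPart, ← smul_neg, mul_smul_comm, smul_mul_assoc, mul_sub, neg_sub, sub_mul,
    U.mul_cancel_right, mul_assoc, U.mul_cancel_left]

theorem evenPart_of_commute {U : Grading H} {T : H →L[ℂ] H} (h : Commute U.op T) :
    evenPart U T = T := by
  rw [evenPart, h.eq, U.mul_cancel_right]
  module

theorem oddPart_of_commute {U : Grading H} {T : H →L[ℂ] H} (h : Commute U.op T) :
    oddPart U T = 0 := by
  rw [oddPart, h.eq, U.mul_cancel_right, sub_self, smul_zero]

theorem evenPart_of_semiconjBy {U : Grading H} {T : H →L[ℂ] H} (h : SemiconjBy U.op T (-T)) :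
    evenPart U T = 0 := by
  rw [evenPart, h.eq, neg_mul, neg_mul, U.mul_cancel_right, add_neg_cancel, smul_zero]

theorem oddPart_of_semiconjBy {U : Grading H} {T : H →L[ℂ] H} (h : SemiconjBy U.op T (-T)) :
    oddPart U T = T := by
  rw [oddPart, h.eq, neg_mul, neg_mul, U.mul_cancel_right]
  module

theorem evenPart_oddPart_add {U : Grading H} {A B : H →L[ℂ] H} (hA : Commute U.op A)
    (hB : SemiconjBy U.op B (-B)) : evenPart U (A + B) = A ∧ oddPart U (A + B) = B := by
  have e1 : evenPart U (A + B) = evenPart U A + evenPart U B := by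
    simp only [evenPart, mul_add, add_mul]
    module
  have e2 : oddPart U (A + B) = oddPart U A + oddPart U B := by
    simp only [oddPart, mul_add, add_mul]
    module
  rw [e1, e2, evenPart_of_commute hA, oddPart_of_commute hA, evenPart_of_semiconjBy hB,
    oddPart_of_semiconjBy hB, add_zero, zero_add]
  exact ⟨rfl, rfl⟩

theorem evenPart_star (U : Grading H) (T : H →L[ℂ] H) :
    evenPart U (star T) = star (evenPart U T) := by
  simp [evenPart, U.star_op, mul_assoc]

theorem oddPart_star (U : Grading H) (T : H →L[ℂ] H) :
    oddPart U (star T) = star (oddPart U T) := by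
  simp [oddPart, U.star_op, mul_assoc]

/-- `U * T` is odd if `T` is odd. -/
theorem Grading.semiconjBy_mul {U : Grading H} {T : H →L[ℂ] H} (h : SemiconjBy U.op T (-T)) :
    SemiconjBy U.op (U.op * T) (-(U.op * T)) := by
  have := SemiconjBy.mul_right (Commute.refl U.op) h
  rwa [mul_neg] at this

theorem IsGraded.conj_mem {U : Grading H} {M : VonNeumannAlgebra H} (h : IsGraded U M)
    {T : H →L[ℂ] H} (hT : T ∈ M) : U.op * T * U.op ∈ M := by
  have : U.op * T * U.op ∈ (M : Set (H →L[ℂ] H)) := by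
    rw [← h]
    exact ⟨T, hT, rfl⟩
  exact this

theorem IsGraded.conj_mem_commutant {U : Grading H} {M : VonNeumannAlgebra H} (h : IsGraded U M)
    {S : H →L[ℂ] H} (hS : S ∈ M.commutant) : U.op * S * U.op ∈ M.commutant := by
  rw [VonNeumannAlgebra.mem_commutant_iff] at hS ⊢
  intro T hT
  have := congrArg (fun A => U.op * A * U.op) (hS _ (h.conj_mem hT))
  simp only [mul_assoc, U.mul_cancel_left, U.op_mul_op, mul_one] at this ⊢
  exact this

theorem evenPart_mem {U : Grading H} {M : VonNeumannAlgebra H} {T : H →L[ℂ] H} (hT : T ∈ M)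
    (h : U.op * T * U.op ∈ M) : evenPart U T ∈ M := smul_mem_vonNeumann M _ (add_mem hT h)

theorem oddPart_mem {U : Grading H} {M : VonNeumannAlgebra H} {T : H →L[ℂ] H} (hT : T ∈ M)
    (h : U.op * T * U.op ∈ M) : oddPart U T ∈ M := smul_mem_vonNeumann M _ (sub_mem hT h)

/-! ### The common kernel of the odd elements of the commutant -/

/-- The common kernel of the odd elements of `M'`. -/
def oddKernel (U : Grading H) (M : VonNeumannAlgebra H) : Submodule ℂ H where
  carrier := {h | ∀ S ∈ M.commutant, SemiconjBy U.op S (-S) → S h = 0}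
  add_mem' ha hb S hS hS' := by rw [map_add, ha S hS hS', hb S hS hS', add_zero]
  zero_mem' S _ _ := map_zero S
  smul_mem' c h hh S hS hS' := by rw [map_smul, hh S hS hS', smul_zero]

theorem mem_oddKernel {U : Grading H} {M : VonNeumannAlgebra H} {h : H} :
    h ∈ oddKernel U M ↔ ∀ S ∈ M.commutant, SemiconjBy U.op S (-S) → S h = 0 := Iff.rfl

noncomputable instance (U : Grading H) (M : VonNeumannAlgebra H) :
    CompleteSpace (oddKernel U M) := by
  have : IsClosed (oddKernel U M : Set H) := by
    have e : (oddKernel U M : Set H) =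
        ⋂ S ∈ M.commutant, ⋂ _ : SemiconjBy U.op S (-S), {h | S h = 0} := by
      ext h
      simp [mem_oddKernel]
    rw [e]
    exact isClosed_biInter fun S _ => isClosed_iInter fun _ =>
      isClosed_eq S.continuous continuous_const
  exact this.completeSpace_coe

/-- The projection onto the common kernel of the odd elements of `M'`. -/
noncomputable def oddKernelProj (U : Grading H) (M : VonNeumannAlgebra H) : H →L[ℂ] H :=
  (oddKernel U M).starProjection

theorem oddKernelProj_mem_commutant (U : Grading H) (M : VonNeumannAlgebra H) :
    oddKernelProj U M ∈ M.commutant := by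
  have h : ∀ T ∈ M, ∀ v ∈ oddKernel U M, T v ∈ oddKernel U M := by
    intro T hT v hv S hS hS'
    rw [← mul_apply_eq_comp, ← VonNeumannAlgebra.mem_commutant_iff.1 hS T hT, mul_apply_eq_comp,
      hv S hS hS', map_zero]
  rw [VonNeumannAlgebra.mem_commutant_iff]
  exact fun T hT => (starProjection_mul_comm _ T (h T hT) (h _ (star_mem hT))).symm

theorem commute_oddKernelProj (U : Grading H) (M : VonNeumannAlgebra H) :
    Commute U.op (oddKernelProj U M) := by
  have h : ∀ v ∈ oddKernel U M, U.op v ∈ oddKernel U M := by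
    intro v hv S hS hS'
    have := hS'.eq
    rw [neg_mul, ← neg_eq_iff_eq_neg] at this
    rw [← mul_apply_eq_comp, ← this]
    change -(U.op (S v)) = 0
    rw [hv S hS hS', map_zero, neg_zero]
  exact (starProjection_mul_comm _ U.op h (by rwa [U.star_op])).symm

theorem odd_mul_oddKernelProj {U : Grading H} {M : VonNeumannAlgebra H} {S : H →L[ℂ] H}
    (hS : S ∈ M.commutant) (hS' : SemiconjBy U.op S (-S)) : S * oddKernelProj U M = 0 :=
  ContinuousLinearMap.ext fun v => (oddKernel U M).starProjection_apply_mem v S hS hS'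

/-- On the kernel an element of `M'` acts through its even part, and an odd element times an even
one is again odd. Hence the kernel is invariant under `M'`, and its projection is central. -/
theorem oddKernelProj_comm {U : Grading H} {M : VonNeumannAlgebra H} (hM : IsGraded U M)
    {R : H →L[ℂ] H} (hR : R ∈ M.commutant) : Commute R (oddKernelProj U M) := by
  have h : ∀ R ∈ M.commutant, ∀ v ∈ oddKernel U M, R v ∈ oddKernel U M := by
    intro R hR v hv S hS hS'
    have ho := oddPart_mem hR (hM.conj_mem_commutant hR)
    have he := evenPart_mem hR (hM.conj_mem_commutant hR)
    have e1 : R v = evenPart U R v := by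
      conv_lhs => rw [← evenPart_add_oddPart U R]
      change evenPart U R v + oddPart U R v = evenPart U R v
      rw [hv _ ho (semiconjBy_oddPart U R), add_zero]
    rw [e1, ← mul_apply_eq_comp]
    refine hv _ (mul_mem hS he) ?_
    have := hS'.mul_right (commute_evenPart U R)
    rwa [neg_mul] at this
  exact (starProjection_mul_comm _ R (h R hR) (h _ (star_mem hR))).symm

theorem oddKernelProj_mem {U : Grading H} {M : VonNeumannAlgebra H} (hM : IsGraded U M) :
    oddKernelProj U M ∈ M := by
  suffices h : oddKernelProj U M ∈ M.commutant.commutant by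
    rwa [VonNeumannAlgebra.commutant_commutant] at h
  rw [VonNeumannAlgebra.mem_commutant_iff]
  exact fun R hR => oddKernelProj_comm hM hR

/-- `U` commutes with the even elements of `M'`, while the odd ones are annihilated by the
projection from both sides. So the product commutes with all of `M'`, even though `U` itself need
not lie in `M`. -/
theorem oddKernelProj_mul_mem {U : Grading H} {M : VonNeumannAlgebra H} (hM : IsGraded U M) :
    oddKernelProj U M * U.op ∈ M := by
  suffices h : oddKernelProj U M * U.op ∈ M.commutant.commutant by
    rwa [VonNeumannAlgebra.commutant_commutant] at h
  rw [VonNeumannAlgebra.mem_commutant_iff]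
  intro R hR
  have ho := oddPart_mem hR (hM.conj_mem_commutant hR)
  have he := evenPart_mem hR (hM.conj_mem_commutant hR)
  have h1 := odd_mul_oddKernelProj ho (semiconjBy_oddPart U R)
  have h2 : oddKernelProj U M * oddPart U R = 0 := by
    rw [← (oddKernelProj_comm hM ho).eq, h1]
  have h3 : Commute (evenPart U R) (oddKernelProj U M * U.op) :=
    (oddKernelProj_comm hM he).mul_right (commute_evenPart U R).symm
  have h4 : SemiconjBy U.op (oddPart U R) (-oddPart U R) := semiconjBy_oddPart U R
  rw [← evenPart_add_oddPart U R, add_mul, mul_add, h3.eq, ← mul_assoc, h1, zero_mul, mul_assoc _ _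
    (oddPart U R), h4.eq, neg_mul, mul_neg, ← mul_assoc, h2, zero_mul, neg_zero]

end Parity

/-! ### Left and right Fermi products -/

section Fermi

set_option linter.unusedSectionVars false

variable {H : ℕ → Type*} [∀ i, NormedAddCommGroup (H i)] [∀ i, InnerProductSpace ℂ (H i)]
  [∀ i, CompleteSpace (H i)] {U : ∀ i, Grading (H i)} {ξ : ∀ i, Metric.sphere (0 : H i) 1}
  (hξ : ∀ i, (U i).op (ξ i) = ξ i)

theorem siteOp_op_mul_self (i : ℕ) : siteOp ξ i (U i).op * siteOp ξ i (U i).op = 1 := by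
  rw [← siteOp_mul, (U i).op_mul_op, siteOp_one]

theorem siteOp_semiconjBy {i : ℕ} {S T : H i →L[ℂ] H i} (h : SemiconjBy S T (-T)) :
    SemiconjBy (siteOp ξ i S) (siteOp ξ i T) (-siteOp ξ i T) := by
  change _ * _ = _ * _
  rw [neg_mul, ← siteOp_mul, h.eq, ← siteOp_mul, neg_mul, ← neg_one_smul ℂ (T * S), siteOp_smul,
    neg_one_smul]

theorem siteOp_commute_of_commute {i : ℕ} {S T : H i →L[ℂ] H i} (h : Commute S T) :
    Commute (siteOp ξ i S) (siteOp ξ i T) := by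
  change _ * _ = _ * _
  rw [← siteOp_mul, h.eq, siteOp_mul]

theorem partialGrading_eq_prodOp (n : ℕ) :
    partialGrading U ξ n = prodOp ξ (fun i => (U i).op) n := by
  induction n with
  | zero => rfl
  | succ n ih => rw [partialGrading, prodOp, ih]

theorem commute_partialGrading {n : ℕ} {A : InfTensor ξ →L[ℂ] InfTensor ξ}
    (h : ∀ i < n, Commute A (siteOp ξ i (U i).op)) : Commute A (partialGrading U ξ n) := by
  rw [partialGrading_eq_prodOp]
  exact commute_prodOp _ h

theorem partialGrading_mul_self (n : ℕ) : partialGrading U ξ n * partialGrading U ξ n = 1 := by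
  induction n with
  | zero => exact one_mul 1
  | succ n ih =>
    have h : Commute (siteOp ξ n (U n).op) (partialGrading U ξ n) :=
      commute_partialGrading fun i hi => siteOp_commute (by omega) _ _
    rw [partialGrading, mul_assoc, ← mul_assoc (siteOp ξ n (U n).op), h.eq, mul_assoc,
      siteOp_op_mul_self, mul_one, ih]

theorem star_partialGrading (n : ℕ) : star (partialGrading U ξ n) = partialGrading U ξ n := by
  rw [partialGrading_eq_prodOp, star_prodOp]
  congr 1
  exact funext fun i => (U i).star_op

theorem partialGrading_commute_even (n : ℕ) {i : ℕ} {T : H i →L[ℂ] H i}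
    (h : Commute (U i).op T) : Commute (siteOp ξ i T) (partialGrading U ξ n) := by
  refine commute_partialGrading fun j _ => ?_
  rcases eq_or_ne i j with rfl | hne
  · exact (siteOp_commute_of_commute h).symm
  · exact siteOp_commute hne _ _

theorem partialGrading_commute_of_le {n i : ℕ} (h : n ≤ i) (T : H i →L[ℂ] H i) :
    Commute (siteOp ξ i T) (partialGrading U ξ n) :=
  commute_partialGrading fun j hj => siteOp_commute (by omega) _ _

theorem partialGrading_semiconjBy {n i : ℕ} (hi : i < n) {T : H i →L[ℂ] H i}
    (h : SemiconjBy (U i).op T (-T)) :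
    SemiconjBy (partialGrading U ξ n) (siteOp ξ i T) (-siteOp ξ i T) := by
  induction n with
  | zero => omega
  | succ n ih =>
    rcases eq_or_ne i n with rfl | hne
    · exact SemiconjBy.mul_left (partialGrading_commute_of_le le_rfl T).symm.neg_right
        (siteOp_semiconjBy h)
    · exact SemiconjBy.mul_left (ih (by omega)) (siteOp_commute hne.symm _ _)

theorem tensorGrading_tprod (x : RSeq ξ) :
    (tensorGrading U hξ).op (tprod x) = tprod (x.all (fun i => (U i).op) hξ) :=
  tensorGradingOp_tprod U hξ x

theorem RSeq.all_set (i : ℕ) (h : H i) (x : RSeq ξ) :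
    (x.set i h).all (fun i => (U i).op) hξ = (x.all (fun i => (U i).op) hξ).set i ((U i).op h) := by
  refine Subtype.ext (funext fun j => ?_)
  rcases eq_or_ne j i with rfl | hne
  · rw [RSeq.set_self]
    exact congrArg _ (x.set_self j h)
  · rw [RSeq.set_of_ne hne]
    exact congrArg _ (x.set_of_ne hne h)

theorem tensorGrading_commute {i : ℕ} {T : H i →L[ℂ] H i} (h : Commute (U i).op T) :
    Commute (tensorGrading U hξ).op (siteOp ξ i T) := by
  refine ext_tprod fun x => ?_
  rw [mul_apply_eq_comp, mul_apply_eq_comp, siteOp_tprod, tensorGrading_tprod, tensorGrading_tprod,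
    siteOp_tprod, RSeq.site_eq_set, RSeq.site_eq_set, RSeq.all_set, ← mul_apply_eq_comp, h.eq]
  rfl

theorem tensorGrading_semiconjBy {i : ℕ} {T : H i →L[ℂ] H i} (h : SemiconjBy (U i).op T (-T)) :
    SemiconjBy (tensorGrading U hξ).op (siteOp ξ i T) (-siteOp ξ i T) := by
  refine ext_tprod fun x => ?_
  rw [← neg_one_smul ℂ (siteOp ξ i T), ← siteOp_smul, mul_apply_eq_comp, mul_apply_eq_comp,
    siteOp_tprod, tensorGrading_tprod, tensorGrading_tprod, siteOp_tprod, RSeq.site_eq_set,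
    RSeq.site_eq_set, RSeq.all_set, ← mul_apply_eq_comp, h.eq, neg_one_smul]
  rfl

theorem tensorGrading_commute_partialGrading (n : ℕ) :
    Commute (tensorGrading U hξ).op (partialGrading U ξ n) :=
  commute_partialGrading fun _ _ => tensorGrading_commute hξ (Commute.refl _)

theorem headProj_commute_tensorGrading (n : ℕ) :
    Commute (headProj ξ n) (tensorGrading U hξ).op := by
  have h : ∀ v ∈ tensorSet ξ (fun _ => Set.univ) n,
      (tensorGrading U hξ).op v ∈ tensorSet ξ (fun _ => Set.univ) n := by
    rintro _ ⟨x, -, hx, rfl⟩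
    rw [tensorGrading_tprod]
    refine ⟨_, fun _ _ => Set.mem_univ _, fun i hi => ?_, rfl⟩
    change (U i).op (x.1 i) = ξ i
    rw [hx i hi, hξ]
  exact headProj_commute h (by rw [(tensorGrading U hξ).star_op]; exact h)

theorem fermiSite_of_even {n : ℕ} {T : H n →L[ℂ] H n} (h : Commute (U n).op T) :
    fermiSite U ξ n T = siteOp ξ n T := by
  rw [fermiSite, evenPart_of_commute h, oddPart_of_commute h, siteOp_zero, mul_zero, add_zero]

theorem fermiSite_of_odd {n : ℕ} {T : H n →L[ℂ] H n} (h : SemiconjBy (U n).op T (-T)) :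
    fermiSite U ξ n T = partialGrading U ξ n * siteOp ξ n T := by
  rw [fermiSite, evenPart_of_semiconjBy h, oddPart_of_semiconjBy h, siteOp_zero, zero_add]

theorem star_fermiSite (n : ℕ) (T : H n →L[ℂ] H n) :
    star (fermiSite U ξ n T) = fermiSite U ξ n (star T) := by
  rw [fermiSite, fermiSite, star_add, star_mul, star_siteOp, star_siteOp, star_partialGrading,
    evenPart_star, oddPart_star, (partialGrading_commute_of_le le_rfl _).eq]

/-! ### Right Fermi operators -/

/-- The odd part of `T` in the `n`-th place picks up the gradings of the places after it. -/
noncomputable def rightSite (n : ℕ) (T : H n →L[ℂ] H n) : InfTensor ξ →L[ℂ] InfTensor ξ :=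
  siteOp ξ n (evenPart (U n) T) +
    (tensorGrading U hξ).op * partialGrading U ξ n * siteOp ξ n ((U n).op * oddPart (U n) T)

theorem rightSite_of_even {n : ℕ} {T : H n →L[ℂ] H n} (h : Commute (U n).op T) :
    rightSite hξ n T = siteOp ξ n T := by
  rw [rightSite, evenPart_of_commute h, oddPart_of_commute h, mul_zero, siteOp_zero, mul_zero,
    add_zero]

theorem rightSite_of_odd {n : ℕ} {T : H n →L[ℂ] H n} (h : SemiconjBy (U n).op T (-T)) :
    rightSite hξ n T =
      (tensorGrading U hξ).op * partialGrading U ξ n * siteOp ξ n ((U n).op * T) := by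
  rw [rightSite, evenPart_of_semiconjBy h, oddPart_of_semiconjBy h, siteOp_zero, zero_add]

theorem commute_even_even {m n : ℕ} {T : H m →L[ℂ] H m} {S : H n →L[ℂ] H n}
    (h : ∀ e : m = n, Commute (e ▸ T) S) : Commute (siteOp ξ m T) (siteOp ξ n S) := by
  rcases eq_or_ne m n with rfl | hne
  · exact siteOp_commute_of_commute (h rfl)
  · exact siteOp_commute hne _ _

/-- The left and right Fermi operators of commuting operators commute. -/
theorem fermiSite_commute_rightSite {m n : ℕ} {T : H m →L[ℂ] H m} {S : H n →L[ℂ] H n}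
    (h1 : ∀ e : m = n, Commute (e ▸ evenPart (U m) T) (evenPart (U n) S))
    (h2 : ∀ e : m = n, Commute (e ▸ evenPart (U m) T) (oddPart (U n) S))
    (h3 : ∀ e : m = n, Commute (e ▸ oddPart (U m) T) (evenPart (U n) S))
    (h4 : ∀ e : m = n, Commute (e ▸ oddPart (U m) T) (oddPart (U n) S)) :
    Commute (fermiSite U ξ m T) (rightSite hξ n S) := by
  have eT := commute_evenPart (U m) T
  have oT := semiconjBy_oddPart (U m) T
  have eS := commute_evenPart (U n) S
  have oS := semiconjBy_oddPart (U n) S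
  have oUS := Grading.semiconjBy_mul oS
  refine Commute.add_left (Commute.add_right (commute_even_even h1) ?_) (Commute.add_right ?_ ?_)
  · refine Commute.mul_right ((tensorGrading_commute hξ eT).symm.mul_right
      (partialGrading_commute_even n eT)) (commute_even_even fun e => ?_)
    subst e
    exact eT.symm.mul_right (h2 rfl)
  · exact Commute.mul_left (partialGrading_commute_even m eS).symm (commute_even_even h3)
  · set A := partialGrading U ξ m * siteOp ξ m (oddPart (U m) T) with hA
    have hAV : SemiconjBy A (tensorGrading U hξ).op (-(tensorGrading U hξ).op) := by
      have := (tensorGrading_semiconjBy (ξ := ξ) hξ oT).eq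
      change _ * _ = _ * _
      rw [hA, mul_assoc, ← neg_eq_iff_eq_neg.2 (this.trans (neg_mul _ _)), mul_neg, ← mul_assoc,
        ← (tensorGrading_commute_partialGrading hξ m).eq, neg_mul, mul_assoc]
    have flip : ∀ {a b : InfTensor ξ →L[ℂ] InfTensor ξ}, SemiconjBy a b (-b) →
        SemiconjBy b a (-a) := by
      intro a b h
      change _ * _ = _ * _
      rw [neg_mul, h.eq, neg_mul, neg_neg]
    have hpp : ∀ k, Commute (partialGrading U ξ m) (partialGrading U ξ k) := fun k =>
      commute_partialGrading fun j _ => (partialGrading_commute_even m (Commute.refl _)).symm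
    -- The odd operator `A` always anticommutes with the total grading. A second sign comes from the
    -- partial grading if `m < n`, and from the operator at place `n` otherwise: through the factor
    -- `U n` at that place if `m = n`, through the gradings contained in `A` if `n < m`. The two
    -- signs cancel.
    rcases lt_trichotomy m n with hlt | rfl | hlt
    · have k1 : SemiconjBy A (partialGrading U ξ n) (-partialGrading U ξ n) :=
        SemiconjBy.mul_left (hpp n).neg_right (flip (partialGrading_semiconjBy hlt oT))
      have k2 : Commute A (siteOp ξ n ((U n).op * oddPart (U n) S)) :=
        Commute.mul_left (partialGrading_commute_of_le hlt.le _).symm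
          (siteOp_commute hlt.ne _ _)
      have := (hAV.mul_right k1).mul_right k2
      rwa [neg_mul_neg] at this
    · have k1 : Commute A (partialGrading U ξ m) :=
        Commute.mul_left (hpp m) (partialGrading_commute_of_le le_rfl _)
      have k2 : SemiconjBy (oddPart (U m) T) ((U m).op * oddPart (U m) S)
          (-((U m).op * oddPart (U m) S)) := by
        have h0 : SemiconjBy (oddPart (U m) T) (U m).op (-(U m).op) := by
          change _ * _ = _ * _
          rw [neg_mul, oT.eq, neg_mul, neg_neg]
        have := h0.mul_right (h4 rfl)
        rwa [neg_mul] at this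
      have k3 : SemiconjBy A (siteOp ξ m ((U m).op * oddPart (U m) S))
          (-siteOp ξ m ((U m).op * oddPart (U m) S)) :=
        SemiconjBy.mul_left (partialGrading_commute_of_le le_rfl _).symm.neg_right
          (siteOp_semiconjBy k2)
      have := (hAV.mul_right k1).mul_right k3
      rwa [neg_mul, neg_mul_neg] at this
    · have k1 : Commute A (partialGrading U ξ n) :=
        Commute.mul_left (hpp n) (partialGrading_commute_of_le hlt.le _)
      have k3 : SemiconjBy A (siteOp ξ n ((U n).op * oddPart (U n) S))
          (-siteOp ξ n ((U n).op * oddPart (U n) S)) :=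
        SemiconjBy.mul_left (partialGrading_semiconjBy hlt oUS) (siteOp_commute hlt.ne' _ _)
      have := (hAV.mul_right k1).mul_right k3
      rwa [neg_mul, neg_mul_neg] at this

theorem fermiSite_commute_rightSite_of_mem {N : ∀ i, VonNeumannAlgebra (H i)}
    (hN : ∀ i, IsGraded (U i) (N i)) {m n : ℕ} {T : H m →L[ℂ] H m} (hT : T ∈ N m)
    {S : H n →L[ℂ] H n} (hS : S ∈ (N n).commutant) :
    Commute (fermiSite U ξ m T) (rightSite hξ n S) := by
  have e1 := evenPart_mem hT ((hN m).conj_mem hT)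
  have o1 := oddPart_mem hT ((hN m).conj_mem hT)
  have e2 := evenPart_mem hS ((hN n).conj_mem_commutant hS)
  have o2 := oddPart_mem hS ((hN n).conj_mem_commutant hS)
  refine fermiSite_commute_rightSite hξ (fun e => ?_) (fun e => ?_) (fun e => ?_) fun e => ?_ <;>
    subst e
  · exact VonNeumannAlgebra.mem_commutant_iff.1 e2 _ e1
  · exact VonNeumannAlgebra.mem_commutant_iff.1 o2 _ e1
  · exact VonNeumannAlgebra.mem_commutant_iff.1 e2 _ o1
  · exact VonNeumannAlgebra.mem_commutant_iff.1 o2 _ o1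

/-- The twist carries the right Fermi operators to the Fermi operators of the twists. -/
theorem twist_rightSite (n : ℕ) (S : H n →L[ℂ] H n) :
    twist (tensorGrading U hξ) (rightSite hξ n S) = fermiSite U ξ n (twist (U n) S) := by
  have eS := commute_evenPart (U n) S
  have oUS := Grading.semiconjBy_mul (semiconjBy_oddPart (U n) S)
  have h1 : SemiconjBy (tensorGrading U hξ).op
      ((tensorGrading U hξ).op * partialGrading U ξ n * siteOp ξ n ((U n).op * oddPart (U n) S))
      (-((tensorGrading U hξ).op * partialGrading U ξ n *
        siteOp ξ n ((U n).op * oddPart (U n) S))) := by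
    have := ((Commute.refl (tensorGrading U hξ).op).mul_right
      (tensorGrading_commute_partialGrading hξ n)).semiconjBy.mul_right
      (tensorGrading_semiconjBy (ξ := ξ) hξ oUS)
    rwa [mul_neg] at this
  obtain ⟨a1, a2⟩ := evenPart_oddPart_add (U := tensorGrading U hξ)
    (tensorGrading_commute (ξ := ξ) hξ eS) h1
  have h2 : SemiconjBy (U n).op (Complex.I • ((U n).op * oddPart (U n) S))
      (-(Complex.I • ((U n).op * oddPart (U n) S))) := by
    change _ * _ = _ * _
    rw [mul_smul_comm, oUS.eq, ← smul_neg, smul_mul_assoc]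
  obtain ⟨b1, b2⟩ := evenPart_oddPart_add eS h2
  rw [twist, rightSite, a1, a2, fermiSite, twist, b1, b2, siteOp_smul, mul_smul_comm, mul_assoc,
    (tensorGrading U hξ).mul_cancel_left]

end Fermi

/-! ### The twisted commutation theorem -/

section TwistedCommutation

set_option linter.unusedSectionVars false

variable {H : ℕ → Type*} [∀ i, NormedAddCommGroup (H i)] [∀ i, InnerProductSpace ℂ (H i)]
  [∀ i, CompleteSpace (H i)] {U : ∀ i, Grading (H i)} {ξ : ∀ i, Metric.sphere (0 : H i) 1}
  (hξ : ∀ i, (U i).op (ξ i) = ξ i) {N : ∀ i, VonNeumannAlgebra (H i)}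

/-- The operators on the first `n` factors that commute with the Fermi product of the `N i` and
with the gradings of the first `j` factors. -/
def fermiHeadCommutant (U : ∀ i, Grading (H i)) (ξ : ∀ i, Metric.sphere (0 : H i) 1)
    (N : ∀ i, VonNeumannAlgebra (H i)) (n j : ℕ) :
    Submodule ℂ (InfTensor ξ →L[ℂ] InfTensor ξ) where
  carrier := {y | headProj ξ n * y = y ∧ y * headProj ξ n = y ∧
    (∀ i < n, ∀ T ∈ N i, Commute y (fermiSite U ξ i T)) ∧
    ∀ i < j, Commute y (siteOp ξ i (U i).op)}
  add_mem' := by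
    rintro a b ⟨h1, h2, h3, h4⟩ ⟨h1', h2', h3', h4'⟩
    exact ⟨by rw [mul_add, h1, h1'], by rw [add_mul, h2, h2'],
      fun i hi T hT => (h3 i hi T hT).add_left (h3' i hi T hT),
      fun i hi => (h4 i hi).add_left (h4' i hi)⟩
  zero_mem' := ⟨mul_zero _, zero_mul _, fun _ _ _ _ => Commute.zero_left _,
    fun _ _ => Commute.zero_left _⟩
  smul_mem' := by
    rintro c a ⟨h1, h2, h3, h4⟩
    exact ⟨by rw [mul_smul_comm, h1], by rw [smul_mul_assoc, h2],
      fun i hi T hT => (h3 i hi T hT).smul_left c, fun i hi => (h4 i hi).smul_left c⟩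

theorem rightSite_commute_siteOp {n i : ℕ} (h : i ≠ n) (S : H n →L[ℂ] H n) :
    Commute (rightSite hξ n S) (siteOp ξ i (U i).op) :=
  Commute.add_left (siteOp_commute h.symm _ _)
    (((tensorGrading_commute hξ (Commute.refl _)).mul_left
      (partialGrading_commute_even n (Commute.refl _)).symm).mul_left (siteOp_commute h.symm _ _))

theorem headProj_commute_partialGrading {m n : ℕ} (h : m ≤ n) :
    Commute (headProj ξ n) (partialGrading U ξ m) :=
  commute_partialGrading fun i hi => headProj_commute_siteOp (by omega) _

theorem headProj_commute_fermiSite {m n : ℕ} (h : m < n) (T : H m →L[ℂ] H m) :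
    Commute (headProj ξ n) (fermiSite U ξ m T) :=
  (headProj_commute_siteOp h _).add_right
    ((headProj_commute_partialGrading h.le).mul_right (headProj_commute_siteOp h _))

theorem headProj_commute_rightSite {m n : ℕ} (h : m < n) (S : H m →L[ℂ] H m) :
    Commute (headProj ξ n) (rightSite hξ m S) :=
  (headProj_commute_siteOp h _).add_right
    (((headProj_commute_tensorGrading hξ n).mul_right
      (headProj_commute_partialGrading h.le)).mul_right (headProj_commute_siteOp h _))

/-- The case of the twisted commutation theorem where all gradings are adjoined. -/
theorem commute_of_mem_fermiHeadCommutant_self (hN : ∀ i, IsGraded (U i) (N i)) {n : ℕ}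
    {x y : InfTensor ξ →L[ℂ] InfTensor ξ}
    (hx1 : headProj ξ n * x = x) (hx2 : x * headProj ξ n = x)
    (hx : ∀ i < n, ∀ S ∈ (N i).commutant, Commute x (rightSite hξ i S))
    (hy : y ∈ fermiHeadCommutant U ξ N n n) : Commute x y := by
  obtain ⟨hy1, hy2, hy3, hy4⟩ := hy
  refine commute_of_mem_headCommutant
    -- Here `M i` is generated by `N i` and `U i`; its commutant consists of the even elements of `N
    -- i'`, for which the right operator carries no grading.
    (M := fun i => generatedBy ((N i : Set (H i →L[ℂ] H i)) ∪ {(U i).op})) (n := n)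
    ⟨hy1, hy2, fun i hi T hT => ?_⟩ ⟨hx1, hx2, fun i hi S hS => ?_⟩
  · refine commute_siteOp_of_generatedBy i _ ?_ ?_ hT
    · rintro S (hS | rfl)
      · exact Or.inl (star_mem (S := VonNeumannAlgebra (H i)) (s := N i) hS)
      · exact Or.inr (U i).star_op
    · rintro S (hS | rfl)
      · have hS' : S ∈ N i := hS
        have he := hy3 i hi _ (evenPart_mem hS' ((hN i).conj_mem hS'))
        have ho := hy3 i hi _ (oddPart_mem hS' ((hN i).conj_mem hS'))
        rw [fermiSite_of_even (commute_evenPart (U i) S)] at he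
        rw [fermiSite_of_odd (semiconjBy_oddPart (U i) S)] at ho
        -- As `y` commutes with each earlier grading, the grading string can be cancelled from the
        -- Fermi operator of the odd part.
        have hp : Commute y (partialGrading U ξ i) :=
          commute_partialGrading fun k hk => hy4 k (hk.trans hi)
        have ho' := hp.mul_right ho
        rw [← mul_assoc, partialGrading_mul_self, one_mul] at ho'
        rw [← evenPart_add_oddPart (U i) S, siteOp_add]
        exact he.add_right ho'
      · exact hy4 i hi
  · rw [VonNeumannAlgebra.mem_commutant_iff] at hS
    have h1 : S ∈ (N i).commutant := VonNeumannAlgebra.mem_commutant_iff.2 fun T hT =>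
      hS T (subset_generatedBy _ (Or.inl hT))
    have h2 : Commute (U i).op S := hS _ (subset_generatedBy _ (Or.inr rfl))
    rw [← rightSite_of_even hξ h2]
    exact hx i hi S h1

theorem conj_siteOp_fermiSite (j : ℕ) (T : H j →L[ℂ] H j) :
    siteOp ξ j (U j).op * fermiSite U ξ j T =
      fermiSite U ξ j ((U j).op * T * (U j).op) * siteOp ξ j (U j).op := by
  have e1 : evenPart (U j) ((U j).op * T * (U j).op) = (U j).op * evenPart (U j) T * (U j).op := by
    simp only [evenPart, mul_add, add_mul, mul_smul_comm, smul_mul_assoc, mul_assoc]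
  have e2 : oddPart (U j) ((U j).op * T * (U j).op) = (U j).op * oddPart (U j) T * (U j).op := by
    simp only [oddPart, mul_sub, sub_mul, mul_smul_comm, smul_mul_assoc, mul_assoc]
  rw [fermiSite, fermiSite, e1, e2, mul_add, add_mul, ← mul_assoc,
    (partialGrading_commute_of_le le_rfl (U j).op).eq]
  simp only [mul_assoc, ← siteOp_mul, (U j).op_mul_op, mul_one]

theorem siteOp_commute_fermiSite {i j : ℕ} (h : i ≠ j) (T : H i →L[ℂ] H i) :
    Commute (siteOp ξ j (U j).op) (fermiSite U ξ i T) :=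
  (siteOp_commute h.symm _ _).add_right
    ((partialGrading_commute_even i (Commute.refl _)).mul_right (siteOp_commute h.symm _ _))

/-- Conjugation by the grading at place `j` permutes the Fermi operators of `N j`, because `N j` is
graded, and fixes those at the other places. It is what allows `y` to be split into even and odd
parts at `j`. -/
theorem conj_mem_fermiHeadCommutant (hN : ∀ i, IsGraded (U i) (N i)) {n j : ℕ} (hj : j < n)
    {y : InfTensor ξ →L[ℂ] InfTensor ξ} (hy : y ∈ fermiHeadCommutant U ξ N n j) :
    siteOp ξ j (U j).op * y * siteOp ξ j (U j).op ∈ fermiHeadCommutant U ξ N n j := by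
  obtain ⟨h1, h2, h3, h4⟩ := hy
  set u := siteOp ξ j (U j).op with hu
  have hP : Commute (headProj ξ n) u := headProj_commute_siteOp hj _
  refine ⟨?_, ?_, fun i hi T hT => ?_, fun i hi => ?_⟩
  · rw [← mul_assoc, ← mul_assoc, hP.eq, mul_assoc u, h1]
  · rw [mul_assoc, ← hP.eq, ← mul_assoc, mul_assoc u, h2]
  · rcases eq_or_ne i j with rfl | hne
    · have hT' := (hN i).conj_mem hT
      have e : fermiSite U ξ i T = u * fermiSite U ξ i ((U i).op * T * (U i).op) * u := by
        rw [hu, conj_siteOp_fermiSite]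
        simp only [mul_assoc, (U i).mul_cancel_left, (U i).op_mul_op, mul_one, siteOp_op_mul_self]
      have huu : ∀ A, u * (u * A) = A := fun A => by
        rw [← mul_assoc, hu, siteOp_op_mul_self, one_mul]
      have hz := h3 i hi _ hT'
      generalize fermiSite U ξ i ((U i).op * T * (U i).op) = z at e hz
      change _ * _ = _ * _
      rw [e]
      simp only [mul_assoc, huu]
      rw [← mul_assoc y, hz.eq, mul_assoc]
    · have hc := siteOp_commute_fermiSite (U := U) (ξ := ξ) hne T
      exact (hc.mul_left (h3 i hi T hT)).mul_left hc
  · have hc : Commute u (siteOp ξ i (U i).op) := siteOp_commute (by omega) _ _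
    exact (hc.mul_left (h4 i hi)).mul_left hc

/-- A vector killed by all odd elements of `M'` in the `j`-th place is fixed by the projection
onto the common kernel in the `j`-th place. -/
theorem siteOp_oddKernelProj_apply {j : ℕ} {M : VonNeumannAlgebra (H j)} {v : InfTensor ξ}
    (hv : ∀ S ∈ M.commutant, SemiconjBy (U j).op S (-S) → siteOp ξ j S v = 0) :
    siteOp ξ j (oddKernelProj (U j) M) v = v := by
  have h : innerSL ℂ (siteOp ξ j (oddKernelProj (U j) M) v) = innerSL ℂ v := by
    refine ext_tprod fun a => ?_
    -- The partial inner products of `v` with elementary tensors away from place `j` are vectors of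
    -- `H j` killed by all the odd `S`.
    have hmem : ContinuousLinearMap.adjoint (slot a j) v ∈ oddKernel (U j) M := by
      intro S hS hS'
      refine ext_inner_left ℂ fun h => ?_
      rw [← inner_star_left, ContinuousLinearMap.adjoint_inner_right, slot_map, ← star_siteOp,
        inner_star_left, hv S hS hS', inner_zero_right, inner_zero_right]
    have hs : star (oddKernelProj (U j) M) = oddKernelProj (U j) M := star_starProjection _
    have h1 : ∀ z : InfTensor ξ, ⟪z, tprod a⟫_ℂ = ⟪z, slot a j (a.1 j)⟫_ℂ := fun z => by
      rw [slot_apply, RSeq.set_eq_self]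
    have h2 : ∀ h, ⟪v, slot a j h⟫_ℂ = ⟪ContinuousLinearMap.adjoint (slot a j) v, h⟫_ℂ := fun h =>
      (ContinuousLinearMap.adjoint_inner_left _ _ _).symm
    rw [innerSL_apply_apply, innerSL_apply_apply, h1, h1, ← inner_star_right, star_siteOp, hs,
      ← slot_map, h2, h2, ← inner_star_left, hs]
    congr 1
    exact Submodule.starProjection_eq_self_iff.2 hmem
  exact innerSL_inj.1 h

/-- The inductive step: the odd part with respect to the grading of the `j`-th factor. -/
theorem commute_of_odd (hN : ∀ i, IsGraded (U i) (N i)) {n j : ℕ} (hj : j < n)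
    {x y : InfTensor ξ →L[ℂ] InfTensor ξ}
    (hx : ∀ i < n, ∀ S ∈ (N i).commutant, Commute x (rightSite hξ i S))
    (hxy : ∀ z ∈ fermiHeadCommutant U ξ N n (j + 1), Commute x z)
    (hy : y ∈ fermiHeadCommutant U ξ N n j)
    (hodd : SemiconjBy (siteOp ξ j (U j).op) y (-y)) : Commute x y := by
  obtain ⟨h1, h2, h3, h4⟩ := hy
  set u := siteOp ξ j (U j).op with hu
  set V := (tensorGrading U hξ).op with hV
  set G := partialGrading U ξ j with hG
  set r := oddKernelProj (U j) (N j) with hr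
  -- A right operator `R` of odd type makes `R y` even at `j`, so `x` commutes with `R y` and with
  -- `R`, giving `R (x y - y x) = 0`. The gradings in `R` are invertible and can be stripped off.
  have hD : ∀ S ∈ (N j).commutant, SemiconjBy (U j).op S (-S) →
      siteOp ξ j S * (x * y - y * x) = 0 := by
    intro S hS hS'
    set R := rightSite hξ j S with hR
    have hmem : R * y ∈ fermiHeadCommutant U ξ N n (j + 1) := by
      have hP : Commute (headProj ξ n) R := headProj_commute_rightSite hξ hj S
      refine ⟨by rw [← mul_assoc, hP.eq, mul_assoc, h1], by rw [mul_assoc, h2],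
        fun i hi T hT => (fermiSite_commute_rightSite_of_mem hξ hN hT hS).symm.mul_left
          (h3 i hi T hT), fun i hi => ?_⟩
      rcases eq_or_ne i j with rfl | hne
      · have hUR : SemiconjBy u R (-R) := by
          rw [hR, rightSite_of_odd hξ hS']
          have a1 : Commute u (tensorGrading U hξ).op :=
            (tensorGrading_commute hξ (Commute.refl _)).symm
          have a2 : Commute u (partialGrading U ξ i) := partialGrading_commute_of_le le_rfl _
          have a3 : SemiconjBy u (siteOp ξ i ((U i).op * S)) (-siteOp ξ i ((U i).op * S)) :=
            siteOp_semiconjBy (Grading.semiconjBy_mul hS')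
          have := SemiconjBy.mul_right (a1.mul_right a2) a3
          rwa [mul_neg] at this
        have := hUR.mul_right hodd
        rw [neg_mul_neg] at this
        exact Commute.symm this
      · exact (rightSite_commute_siteOp hξ hne S).mul_left (h4 i (by omega))
    have h5 : R * (x * y - y * x) = 0 := by
      have a1 := (hxy _ hmem).eq
      have a2 := (hx j hj S hS).eq
      rw [mul_sub, ← mul_assoc, ← mul_assoc, ← a1, ← a2, mul_assoc, sub_self]
    rw [hR, rightSite_of_odd hξ hS', siteOp_mul] at h5
    have h6 := congrArg (fun A => u * (G * (V * A))) h5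
    simp only [mul_zero] at h6
    rw [← h6]
    simp only [mul_assoc]
    rw [(tensorGrading U hξ).mul_cancel_left, ← mul_assoc G, hG, partialGrading_mul_self, one_mul,
      ← mul_assoc u, hu, siteOp_op_mul_self, one_mul]
  -- `r` and `r U j` are even elements of `N j`, so their Fermi operators are plain site operators
  -- commuting with `y`. Since `y` anticommutes with `u`, comparing the two relations gives `r y u =
  -- -(r y u)`.
  have hr1 : Commute y (siteOp ξ j r) := by
    have := h3 j hj r (oddKernelProj_mem (hN j))
    rwa [fermiSite_of_even (commute_oddKernelProj _ _)] at this
  have hr2 : Commute y (siteOp ξ j r * u) := by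
    have := h3 j hj (r * (U j).op) (oddKernelProj_mul_mem (hN j))
    rwa [fermiSite_of_even ((commute_oddKernelProj _ _).mul_right (Commute.refl _)),
      siteOp_mul] at this
  have hr3 : Commute x (siteOp ξ j r) := by
    have := hx j hj r (oddKernelProj_mem_commutant _ _)
    rwa [rightSite_of_even hξ (commute_oddKernelProj _ _)] at this
  have hry : siteOp ξ j r * y = 0 := by
    have a1 : siteOp ξ j r * y * u = -(siteOp ξ j r * y * u) := by
      have e1 := hr2.eq
      rw [← mul_assoc, hr1.eq, mul_assoc _ u, hodd.eq, neg_mul, mul_neg, ← mul_assoc] at e1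
      exact e1
    have a2 : siteOp ξ j r * y * u = 0 := by
      have := add_eq_zero_iff_eq_neg.2 a1
      rw [← two_smul ℂ] at this
      exact (smul_eq_zero.1 this).resolve_left two_ne_zero
    have a3 := congrArg (fun A => A * u) a2
    simpa only [mul_assoc, hu, siteOp_op_mul_self, mul_one, zero_mul] using a3
  -- The commutator has its range under `r`, yet `r` commutes with `x` and annihilates `y` on the
  -- left.
  have hfix : siteOp ξ j r * (x * y - y * x) = x * y - y * x :=
    ContinuousLinearMap.ext fun v => siteOp_oddKernelProj_apply fun S hS hS' =>
      congrArg (fun A : InfTensor ξ →L[ℂ] InfTensor ξ => A v) (hD S hS hS')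
  have : x * y - y * x = 0 := by
    rw [← hfix, mul_sub, ← mul_assoc, ← hr3.eq, mul_assoc, hry, ← mul_assoc, hry, mul_zero,
      zero_mul, sub_zero]
  exact sub_eq_zero.1 this

/-- The twisted commutation theorem for operators on finitely many factors. -/
theorem commute_of_mem_fermiHeadCommutant (hN : ∀ i, IsGraded (U i) (N i)) {n : ℕ}
    {x : InfTensor ξ →L[ℂ] InfTensor ξ}
    (hx1 : headProj ξ n * x = x) (hx2 : x * headProj ξ n = x)
    (hx : ∀ i < n, ∀ S ∈ (N i).commutant, Commute x (rightSite hξ i S)) :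
    ∀ k j : ℕ, j + k = n → ∀ y ∈ fermiHeadCommutant U ξ N n j, Commute x y := by
  intro k
  -- The number `k = n - j` counts the gradings with which `y` is not yet assumed to commute.
  induction k with
  | zero =>
    rintro j rfl y hy
    exact commute_of_mem_fermiHeadCommutant_self hξ hN hx1 hx2 hx hy
  | succ k ih =>
    intro j hj y hy
    have hxy := ih (j + 1) (by omega)
    have hc := conj_mem_fermiHeadCommutant hN (by omega : j < n) hy
    set u := siteOp ξ j (U j).op with hu
    have huu : ∀ A, u * (u * A) = A := fun A => by
      rw [← mul_assoc, hu, siteOp_op_mul_self, one_mul]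
    have huu' : u * u = 1 := siteOp_op_mul_self j
    -- Twice the even part of `y` commutes with one more grading, so the induction hypothesis
    -- applies to it; the odd part is left to `commute_of_odd`.
    have he : y + u * y * u ∈ fermiHeadCommutant U ξ N n (j + 1) := by
      obtain ⟨h1, h2, h3, h4⟩ := add_mem hy hc
      refine ⟨h1, h2, h3, fun i hi => ?_⟩
      rcases eq_or_ne i j with rfl | hne
      · change _ * u = u * _
        simp only [add_mul, mul_add, mul_assoc, huu, huu', mul_one]
        exact add_comm _ _
      · exact h4 i (by omega)
    have ho : Commute x (y - u * y * u) := by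
      refine commute_of_odd hξ hN (by omega : j < n) hx hxy (sub_mem hy hc) ?_
      change u * _ = _ * u
      simp only [neg_sub, sub_mul, mul_sub, mul_assoc, huu, huu', mul_one]
    have e : y = (1 / 2 : ℂ) • (y + u * y * u) + (1 / 2 : ℂ) • (y - u * y * u) := by module
    rw [e]
    exact ((hxy _ he).smul_right _).add_right (ho.smul_right _)

/-! ### Passage to infinitely many factors -/

theorem tendsto_inner_headProj (a b : RSeq ξ) (x y : InfTensor ξ →L[ℂ] InfTensor ξ) :
    Filter.Tendsto (fun n => ⟪tprod a, (headProj ξ n * x * headProj ξ n *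
      (headProj ξ n * y * headProj ξ n)) (tprod b)⟫_ℂ) Filter.atTop
      (nhds ⟪tprod a, x (y (tprod b))⟫_ℂ) := by
  have h1 : Filter.Tendsto (fun n => ⟪tprod a, x (headProj ξ n (y (tprod b)))⟫_ℂ) Filter.atTop
      (nhds ⟪tprod a, x (y (tprod b))⟫_ℂ) :=
    ((innerSL ℂ (tprod a) ∘L x).continuous.tendsto _).comp (tendsto_headProj _)
  refine h1.congr' ?_
  -- For large `n` the outer projections fix both elementary tensors, so only the projection between
  -- `x` and `y` has to converge.
  obtain ⟨m, hm⟩ := (a.2.union b.2).bddAbove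
  filter_upwards [Filter.eventually_gt_atTop m] with n hn
  have ha : headProj ξ n (tprod a) = tprod a := headProj_tprod fun i hi => by
    by_contra hne
    have := hm (Or.inl hne)
    omega
  have hb : headProj ξ n (tprod b) = tprod b := headProj_tprod fun i hi => by
    by_contra hne
    have := hm (Or.inr hne)
    omega
  have e : headProj ξ n * x * headProj ξ n * (headProj ξ n * y * headProj ξ n) =
      headProj ξ n * (x * (headProj ξ n * (y * headProj ξ n))) := by
    simp only [mul_assoc]
    rw [← mul_assoc (headProj ξ n) (headProj ξ n), headProj_mul_self]
  rw [e]
  simp only [mul_apply_eq_comp, hb]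
  rw [← inner_star_left (headProj ξ n), star_headProj, ha]

/-- Operators that commute with the Fermi product of the `N i` commute with the operators that
commute with the right Fermi product of the `(N i)'`. -/
theorem commute_of_commute_fermiSite (hN : ∀ i, IsGraded (U i) (N i))
    {x y : InfTensor ξ →L[ℂ] InfTensor ξ}
    (hy : ∀ i, ∀ T ∈ N i, Commute y (fermiSite U ξ i T))
    (hx : ∀ i, ∀ S ∈ (N i).commutant, Commute x (rightSite hξ i S)) : Commute x y := by
  refine ext_inner_tprod fun a b => ?_
  rw [mul_apply_eq_comp, mul_apply_eq_comp]
  refine tendsto_nhds_unique (tendsto_inner_headProj a b x y)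
    ((tendsto_inner_headProj a b y x).congr fun n => ?_)
  have hP : ∀ z : InfTensor ξ →L[ℂ] InfTensor ξ,
      headProj ξ n * (headProj ξ n * z * headProj ξ n) = headProj ξ n * z * headProj ξ n ∧
      headProj ξ n * z * headProj ξ n * headProj ξ n = headProj ξ n * z * headProj ξ n := by
    intro z
    refine ⟨?_, ?_⟩
    · rw [← mul_assoc, ← mul_assoc, headProj_mul_self]
    · rw [mul_assoc, headProj_mul_self]
  -- The induction starts from `j = 0`, where no commutation with individual gradings is required.
  have := commute_of_mem_fermiHeadCommutant hξ hN (n := n) (hP x).1 (hP x).2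
    (fun i hi S hS => (((headProj_commute_rightSite hξ hi S).mul_left (hx i S hS)).mul_left
      (headProj_commute_rightSite hξ hi S))) n 0 (zero_add n) (headProj ξ n * y * headProj ξ n)
    ⟨(hP y).1, (hP y).2, fun i hi T hT => ((headProj_commute_fermiSite hi T).mul_left
      (hy i T hT)).mul_left (headProj_commute_fermiSite hi T), fun i hi => absurd hi (by omega)⟩
  rw [this.eq]

theorem fermiSite_one (n : ℕ) : fermiSite U ξ n 1 = 1 := by
  rw [fermiSite_of_even (Commute.one_right _), siteOp_one]

theorem fermiSite_mem_fermiTensor {M : ∀ i, VonNeumannAlgebra (H i)} {n : ℕ} {T : H n →L[ℂ] H n}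
    (hT : T ∈ M n) : fermiSite U ξ n T ∈ fermiTensor U ξ M := by
  refine subset_generatedBy _ ⟨Function.update 1 n T, n + 1, fun i _ => ?_, ?_⟩
  · rcases eq_or_ne i n with rfl | hne
    · rwa [Function.update_self]
    · rw [Function.update_of_ne hne]
      exact one_mem _
  · have h : ∀ k ≤ n, fermiProd U ξ (Function.update 1 n T) k = 1 := by
      intro k
      induction k with
      | zero => exact fun _ => rfl
      | succ k ih =>
        intro hk
        rw [fermiProd, ih (by omega), Function.update_of_ne (by omega), one_mul]
        exact fermiSite_one k
    rw [fermiProd, h n le_rfl, one_mul, Function.update_self]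

/-- Fermi products are products of single-site Fermi operators, and the latter are stable under
adjoints, so the commutant can be tested place by place. -/
theorem mem_commutant_fermiTensor {M : ∀ i, VonNeumannAlgebra (H i)}
    {y : InfTensor ξ →L[ℂ] InfTensor ξ} :
    y ∈ (fermiTensor U ξ M).commutant ↔ ∀ i, ∀ T ∈ M i, Commute y (fermiSite U ξ i T) := by
  rw [VonNeumannAlgebra.mem_commutant_iff]
  refine ⟨fun h i T hT => (h _ (fermiSite_mem_fermiTensor hT)).symm, fun h R hR => ?_⟩
  refine (commute_of_mem_generatedBy hR ?_).symm.eq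
  rintro _ ⟨T, k, hT, rfl⟩
  have key : Commute y (fermiProd U ξ T k) ∧ Commute y (star (fermiProd U ξ T k)) := by
    induction k with
    | zero =>
      rw [fermiProd, star_one]
      exact ⟨Commute.one_right y, Commute.one_right y⟩
    | succ k ih =>
      obtain ⟨a, b⟩ := ih fun i hi => hT i (hi.trans k.lt_succ_self)
      have hk := hT k k.lt_succ_self
      rw [fermiProd, star_mul, star_fermiSite]
      exact ⟨a.mul_right (h k _ hk), (h k _ (star_mem hk)).mul_right b⟩
  exact key

end TwistedCommutation

end FermiTensor

theorem mainTheorem9 {H : ℕ → Type*} [∀ i, NormedAddCommGroup (H i)]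
    [∀ i, InnerProductSpace ℂ (H i)] [∀ i, CompleteSpace (H i)]
    (U : ∀ i, FermiTensor.Grading (H i)) (N : ∀ i, VonNeumannAlgebra (H i))
    (hN : ∀ i, FermiTensor.IsGraded (U i) (N i))
    (ξ : ∀ i, Metric.sphere (0 : H i) 1) (hξ : ∀ i, (U i).op (ξ i) = ξ i) :
    FermiTensor.twistedCommutant (FermiTensor.tensorGrading U hξ)
        (FermiTensor.fermiTensor U ξ N) =
      FermiTensor.fermiTensor U ξ
        (fun i => FermiTensor.twistedCommutant (U i) (N i)) := by
  open FermiTensor in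
  have hsite : ∀ i, ∀ T ∈ twistedCommutant (U i) (N i),
      fermiSite U ξ i T ∈ twistedCommutant (tensorGrading U hξ) (fermiTensor U ξ N) := by
    rintro i _ ⟨S, hS, rfl⟩
    rw [← twist_rightSite hξ]
    exact ⟨_, mem_commutant_fermiTensor.2 fun j T hT =>
      (fermiSite_commute_rightSite_of_mem hξ hN hT hS).symm, rfl⟩
  refine le_antisymm ?_ (FermiTensor.generatedBy_le _ _ ?_)
  · rintro _ ⟨y, hy, rfl⟩
    suffices h : FermiTensor.twist (FermiTensor.tensorGrading U hξ) y ∈ (FermiTensor.fermiTensor U ξ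
        (fun i => FermiTensor.twistedCommutant (U i) (N i))).commutant.commutant by
      rwa [VonNeumannAlgebra.commutant_commutant] at h
    rw [VonNeumannAlgebra.mem_commutant_iff]
    intro x hx
    -- Pulling `x` back through the twist turns commutation with the Fermi operators of the twisted
    -- commutants into commutation with the right operators of the `N i'`.
    obtain ⟨x, rfl⟩ := (FermiTensor.twist_bijective (FermiTensor.tensorGrading U hξ)).2 x
    rw [← FermiTensor.twist_mul, ← FermiTensor.twist_mul]
    congr 1
    refine FermiTensor.commute_of_commute_fermiSite hξ hN
      (FermiTensor.mem_commutant_fermiTensor.1 hy) fun i S hS => ?_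
    have := FermiTensor.mem_commutant_fermiTensor.1 hx i _ ⟨S, hS, rfl⟩
    rw [← FermiTensor.twist_rightSite hξ] at this
    have h2 := this.eq
    rw [← FermiTensor.twist_mul, ← FermiTensor.twist_mul] at h2
    exact (FermiTensor.twist_bijective _).1 h2
  · rintro _ ⟨T, k, hT, rfl⟩
    induction k with
    | zero => exact one_mem _
    | succ k ih =>
      exact mul_mem (ih fun i hi => hT i (hi.trans k.lt_succ_self))
        (hsite k _ (hT k k.lt_succ_self))
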